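/- Let $\sigma>0$, $k>0$ and consider, for $x>0$, the equation $$u_t=\tfrac12\sigma^2x^2u_{xx}-kx^2u_x+\tfrac{k^2}{2\sigma^2}x^2u \qquad(1)$$ (the equation $u_t=\frac12\sigma^2x^2u_{xx}+kx(\alpha-x)u_x+\lambda x^2u$ with $\alpha=0$, $\lambda=\frac{k^2}{2\sigma^2}$). Let $\mathfrak g$ be the linear span of the vector fields \begin{align*} V_1&=\partial_t,\qquad V_2=t\partial_t+\tfrac12x\ln x\,\partial_x+\left(\tfrac{k}{2\sigma^2}x\ln x+\tfrac14\ln x-\tfrac{\sigma^2}{8}t\right)u\partial_u,\\ V_3&=t^2\partial_t+tx\ln x\,\partial_x+\left(\tfrac{k}{\sigma^2}tx\ln x-\tfrac1{2\sigma^2}\ln^2x+\tfrac12t\ln x-\tfrac{\sigma^2}8t^2-\tfrac12t\right)u\partial_u,\\ V_4&=x\partial_x+\tfrac{k}{\sigma^2}xu\partial_u,\qquad V_5=tx\partial_x+\left(\tfrac{k}{\sigma^2}tx-\tfrac1{\sigma^2}\ln x+\tfrac12t\right)u\partial_u,\qquad V_6=u\partial_u, \end{align*} and let $G$ be the local group generated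 by the one-parameter groups (flows on $\{x>0\}$) of $V_1,\dots,V_6$. Its elements are finite compositions of flow maps. They act on functions by transforming graphs: on $\Omega$, $u$ is the transform $g\cdot v$ of a function $v$ with domain $D$ if every point of the graph of $u$ over $\Omega$ is the image under $g$ of a point of the graph of $v$ over $D$. For $X=\tau\partial_t+\xi\partial_x+\phi\partial_u\in\mathfrak g$, an $X$-invariant solution on an open set $\Omega\subset\{x>0\}$ is a $C^2$ solution $u$ of (1) on $\Omega$ with $\phi=\tau u_t+\xi u_x$ along $u$. Let $U,V,W$ be the standard parabolic cylinder functions and $\mathrm{Ai},\mathrm{Bi}$ the Airy functions. For $a\in\mathbb R$ and constants $c,c_1,c_2\in\mathbb R$ consider the following functions, all on $\{x>0\}$, except that those for $V_2+aV_6$ are on $\{t>0,\ x>0\}$. * For $V_4$: $\;u=c\,e^{kx/\sigma^2}$. * For $V_2+aV_6$: $\;u=t^ax^{1/2}e^{\frac{k}{\sigma^2}x-\frac{\sigma^2}8t-\frac{\ln^2x}{4\sigma^2t}}\left(c_1U\big(2a+\tfrac12,\tfrac{\ln x}{\sigma\sqrt t}\big)+c_2V\big(2a+\tfrac12,\tfrac{\ln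 x}{\sigma\sqrt t}\big)\right)$. * For $V_1+V_3+aV_6$: $\;u=(1+t^2)^{-1/4}x^{1/2}e^{\frac{k}{\sigma^2}x-\frac{\sigma^2}8t+\frac{\sigma^2+8a}8\arctan t-\frac{t\ln^2x}{2\sigma^2(1+t^2)}}\left(c_1W\big(\tfrac{\sigma^2+8a}8,z\big)+c_2W\big(\tfrac{\sigma^2+8a}8,-z\big)\right)$, with $z=\frac{\sqrt2\,\ln x}{\sigma\sqrt{1+t^2}}$. * For $V_1\pm V_5$: $\;u=x^{1/2}e^{\frac{k}{\sigma^2}x+\frac{t^3}{3\sigma^2}\mp\frac{t\ln x}{\sigma^2}}\left(c_1\mathrm{Ai}(w)+c_2\mathrm{Bi}(w)\right)$, with $w=(4\sigma)^{-4/3}(\sigma^4\mp8\ln x+4t^2)$. * For $V_1+aV_6$: $\;u=x^{1/2}e^{\frac{k}{\sigma^2}x+at}f(x)$, where $f$ is $c_1x^{\sqrt{\sigma^2+8a}/(2\sigma)}+c_2x^{-\sqrt{\sigma^2+8a}/(2\sigma)}$ if $\sigma^2+8a>0$, $\;c_1+c_2\ln x$ if $\sigma^2+8a=0$, and $c_1\cos\big(\tfrac{\sqrt{-\sigma^2-8a}}{2\sigma}\ln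 x\big)+c_2\sin\big(\tfrac{\sqrt{-\sigma^2-8a}}{2\sigma}\ln x\big)$ if $\sigma^2+8a<0$. **Theorem 4.1.** These functions form an optimal system of invariant solutions of (1), in the following sense. 1. On every non-empty connected open $\Omega\subset\{x>0\}$ (with $\Omega\subset\{t>0\}$ in the case of $V_2+aV_6$), the invariant solutions for $V_4$, $V_2+aV_6$, $V_1+V_3+aV_6$, $V_1+V_5$, $V_1-V_5$ and $V_1+aV_6$ are exactly the restrictions to $\Omega$ of the functions listed for that generator. The only invariant solution for $V_6$ is $0$. 2. Let $0\ne X=\tau\partial_t+\xi\partial_x+\phi\partial_u\in\mathfrak g$, and let $\Omega\subset\{x>0\}$ be non-empty, open and connected and such that $X$ is regular on $\Omega$, that is, either $\tau$ has no zero on $\Omega$, or $\tau\equiv0$ on $\Omega$ and $\xi$ either has no zero on $\Omega$ or vanishes identically on $\Omega$. Then every $X$-invariant solution on $\Omega$ is, on $\Omega$, the transform $g\cdot v$ of one of the listed functions $v$ by some $g\in G$. -/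

import Mathlib

noncomputable section

namespace GMR

/-! ### Special functions -/

/-- `odeCoeff p q r y₀ y₁ n` is the `n`-th derivative at `0` of the solution of
`y'' = (p + q x + r x²) y`, `y(0) = y₀`, `y'(0) = y₁`
(differentiate the equation `n` times at `0`). -/
def odeCoeff (p q r y₀ y₁ : ℝ) : ℕ → ℝ
  | 0 => y₀
  | 1 => y₁
  | n + 2 => p * odeCoeff p q r y₀ y₁ n + q * n * odeCoeff p q r y₀ y₁ (n - 1)
      + r * (n * (n - 1)) * odeCoeff p q r y₀ y₁ (n - 2)

/-- The (everywhere convergent) Maclaurin series of the solution of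
`y'' = (p + q x + r x²) y`, `y(0) = y₀`, `y'(0) = y₁`. -/
def odeSol (p q r y₀ y₁ x : ℝ) : ℝ :=
  ∑' n : ℕ, odeCoeff p q r y₀ y₁ n / (n.factorial : ℝ) * x ^ n

/-- The Airy function `Ai`: `y'' = x y` with the standard values of `Ai(0)`, `Ai'(0)`. -/
def airyAi (x : ℝ) : ℝ :=
  odeSol 0 1 0 (1 / ((3 : ℝ) ^ (2 / 3 : ℝ) * Real.Gamma (2 / 3)))
    (-(1 / ((3 : ℝ) ^ (1 / 3 : ℝ) * Real.Gamma (1 / 3)))) x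

/-- The Airy function `Bi`: `y'' = x y` with the standard values of `Bi(0)`, `Bi'(0)`. -/
def airyBi (x : ℝ) : ℝ :=
  odeSol 0 1 0 (1 / ((3 : ℝ) ^ (1 / 6 : ℝ) * Real.Gamma (2 / 3)))
    ((3 : ℝ) ^ (1 / 6 : ℝ) / Real.Gamma (1 / 3)) x

/-- The parabolic cylinder function `U(a, x)`: `y'' = (x²/4 + a) y`,
`U(a,0) = √π / (2^(a/2+1/4) Γ(3/4+a/2))`, `U'(a,0) = -√π / (2^(a/2-1/4) Γ(1/4+a/2))`.
(`1/Γ` vanishes at the poles of `Γ`, which is also the value Lean gives it.) -/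
def pcU (a x : ℝ) : ℝ :=
  odeSol a 0 (1 / 4)
    (√Real.pi / ((2 : ℝ) ^ (a / 2 + 1 / 4) * Real.Gamma (3 / 4 + a / 2)))
    (-(√Real.pi / ((2 : ℝ) ^ (a / 2 - 1 / 4) * Real.Gamma (1 / 4 + a / 2)))) x

/-- The parabolic cylinder function `V(a, x)`: `y'' = (x²/4 + a) y`,
`V(a,0) = 2^(a/2+1/4) sin(π(3/4-a/2)) / Γ(3/4-a/2)`,
`V'(a,0) = 2^(a/2+3/4) sin(π(1/4-a/2)) / Γ(1/4-a/2)`. -/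
def pcV (a x : ℝ) : ℝ :=
  odeSol a 0 (1 / 4)
    ((2 : ℝ) ^ (a / 2 + 1 / 4) * Real.sin (Real.pi * (3 / 4 - a / 2))
      / Real.Gamma (3 / 4 - a / 2))
    ((2 : ℝ) ^ (a / 2 + 3 / 4) * Real.sin (Real.pi * (1 / 4 - a / 2))
      / Real.Gamma (1 / 4 - a / 2)) x

/-- The parabolic cylinder function `W(a, x)`: `y'' = (a - x²/4) y`,
`W(a,0) = 2^(-3/4) |Γ(1/4+ia/2)/Γ(3/4+ia/2)|^(1/2)`,
`W'(a,0) = -2^(-1/4) |Γ(3/4+ia/2)/Γ(1/4+ia/2)|^(1/2)`. -/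
def pcW (a x : ℝ) : ℝ :=
  odeSol a 0 (-(1 / 4))
    ((2 : ℝ) ^ (-(3 / 4) : ℝ) *
      √(‖Complex.Gamma (1 / 4 + Complex.I * a / 2)‖ / ‖Complex.Gamma (3 / 4 + Complex.I * a / 2)‖))
    (-((2 : ℝ) ^ (-(1 / 4) : ℝ) *
      √(‖Complex.Gamma (3 / 4 + Complex.I * a / 2)‖ /
        ‖Complex.Gamma (1 / 4 + Complex.I * a / 2)‖))) x

/-! ### The equation -/

/-- The half-plane `{(t, x) : x > 0}` on which the equation is posed. -/
def halfPlane : Set (ℝ × ℝ) := {p | 0 < p.2}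

/-- `u` is a (classical, `C²`) solution on `Ω` of
`u_t = ½ σ² x² u_xx + k x (α - x) u_x + lam x² u`. -/
def IsSolutionOn (σ k α lam : ℝ) (Ω : Set (ℝ × ℝ)) (u : ℝ → ℝ → ℝ) : Prop :=
  ContDiffOn ℝ 2 (Function.uncurry u) Ω ∧
  ∀ t x : ℝ, (t, x) ∈ Ω →
    deriv (fun s => u s x) t =
      1 / 2 * σ ^ 2 * x ^ 2 * deriv (deriv (u t)) x + k * x * (α - x) * deriv (u t) x
        + lam * x ^ 2 * u t x

/-! ### The symmetry algebra

A vector field `τ ∂_t + ξ ∂_x + φ ∂_u` is the map `(t, x, u) ↦ (τ, ξ, φ)`. -/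

/-- Vector fields on `(t, x, u)`-space. -/
abbrev VField : Type := ℝ × ℝ × ℝ → ℝ × ℝ × ℝ

def V1 : VField := fun _ => (1, 0, 0)

def V2 (σ k : ℝ) : VField := fun (t, x, u) =>
  (t, 1 / 2 * x * Real.log x,
    (k / (2 * σ ^ 2) * x * Real.log x + 1 / 4 * Real.log x - σ ^ 2 / 8 * t) * u)

def V3 (σ k : ℝ) : VField := fun (t, x, u) =>
  (t ^ 2, t * x * Real.log x,
    (k / σ ^ 2 * t * x * Real.log x - 1 / (2 * σ ^ 2) * Real.log x ^ 2
      + 1 / 2 * t * Real.log x - σ ^ 2 / 8 * t ^ 2 - 1 / 2 * t) * u)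

def V4 (σ k : ℝ) : VField := fun (_, x, u) => (0, x, k / σ ^ 2 * x * u)

def V5 (σ k : ℝ) : VField := fun (t, x, u) =>
  (0, t * x, (k / σ ^ 2 * t * x - 1 / σ ^ 2 * Real.log x + 1 / 2 * t) * u)

def V6 : VField := fun (_, _, u) => (0, 0, u)

/-- The six basis fields, `basisField σ k i` being `V_{i+1}`. -/
def basisField (σ k : ℝ) : Fin 6 → VField :=
  ![V1, V2 σ k, V3 σ k, V4 σ k, V5 σ k, V6]

/-- The six-dimensional symmetry algebra `𝔤` spanned by `V₁, …, V₆`. -/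
def symAlgebra (σ k : ℝ) : Submodule ℝ VField :=
  Submodule.span ℝ (Set.range (basisField σ k))

/-- `u` is invariant on `Ω` under the local one-parameter group generated by
`X = τ ∂_t + ξ ∂_x + φ ∂_u`: `X` is tangent to the graph of `u`, i.e.
`φ = τ u_t + ξ u_x` along `u`. -/
def IsInvariantOn (X : VField) (Ω : Set (ℝ × ℝ)) (u : ℝ → ℝ → ℝ) : Prop :=
  ∀ t x : ℝ, (t, x) ∈ Ω →
    (X (t, x, u t x)).2.2 =
      (X (t, x, u t x)).1 * deriv (fun s => u s x) t
        + (X (t, x, u t x)).2.1 * deriv (u t) x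

/-- `u` is an `X`-invariant solution on `Ω` of the equation with `α = 0`,
`lam = k² / (2 σ²)`. -/
def IsInvariantSolution (σ k : ℝ) (X : VField) (Ω : Set (ℝ × ℝ)) (u : ℝ → ℝ → ℝ) : Prop :=
  IsSolutionOn σ k 0 (k ^ 2 / (2 * σ ^ 2)) Ω u ∧ IsInvariantOn X Ω u

/-- The orbits of `X = τ ∂_t + ξ ∂_x + φ ∂_u` over `Ω` have a constant type: `τ` has no zero
on `Ω`, or `τ` vanishes identically on `Ω` and `ξ` has no zero or vanishes identically on `Ω`.
(`τ`, `ξ` do not depend on `u` for `X` in the symmetry algebra.) -/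
def IsRegularOn (X : VField) (Ω : Set (ℝ × ℝ)) : Prop :=
  (∀ t x u : ℝ, (t, x) ∈ Ω → (X (t, x, u)).1 ≠ 0) ∨
  ((∀ t x u : ℝ, (t, x) ∈ Ω → (X (t, x, u)).1 = 0) ∧
    ((∀ t x u : ℝ, (t, x) ∈ Ω → (X (t, x, u)).2.1 ≠ 0) ∨
      (∀ t x u : ℝ, (t, x) ∈ Ω → (X (t, x, u)).2.1 = 0)))

/-! ### The symmetry group -/

/-- `q` is the image of `p` under the transformation with parameter `ε` of the local
one-parameter group generated by `X` on `{x > 0}`: some integral curve of `X` in `{x > 0}` is at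
`p` for parameter `0` and at `q` for parameter `ε`. -/
def FlowsTo (X : VField) (ε : ℝ) (p q : ℝ × ℝ × ℝ) : Prop :=
  ∃ γ : ℝ → ℝ × ℝ × ℝ, γ 0 = p ∧ γ ε = q ∧
    ∀ s ∈ Set.uIcc 0 ε, 0 < (γ s).2.1 ∧ HasDerivAt γ (X (γ s)) s

/-- A transformation of the symmetry group `G` is a finite composition of transformations of the
one-parameter groups `G₁, …, G₆` generated by `V₁, …, V₆`; it is given by the list of the
generators and parameters. `GroupMaps σ k g p q`: `g` is defined at `p` and maps `p` to `q`. -/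
def GroupMaps (σ k : ℝ) : List (Fin 6 × ℝ) → ℝ × ℝ × ℝ → ℝ × ℝ × ℝ → Prop
  | [], p, q => p = q
  | (i, ε) :: g, p, q => ∃ m, FlowsTo (basisField σ k i) ε p m ∧ GroupMaps σ k g m q

/-- On `Ω`, `u` is the transform `g · v` of the function `v` with domain `D`: each point of the
graph of `u` over `Ω` is the image under `g` of a point of the graph of `v`. -/
def IsTransformOn (σ k : ℝ) (g : List (Fin 6 × ℝ)) (D : Set (ℝ × ℝ)) (v : ℝ → ℝ → ℝ)
    (Ω : Set (ℝ × ℝ)) (u : ℝ → ℝ → ℝ) : Prop :=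
  ∀ t x : ℝ, (t, x) ∈ Ω → ∃ t₀ x₀ : ℝ, (t₀, x₀) ∈ D ∧
    GroupMaps σ k g (t₀, x₀, v t₀ x₀) (t, x, u t x)

/-! ### The explicit solutions -/

/-- The invariant solutions for `V₄`. -/
def solV4 (σ k c _t x : ℝ) : ℝ := c * Real.exp (k / σ ^ 2 * x)

/-- The invariant solutions for `V₂ + a V₆` (for `t > 0`). -/
def solV2 (σ k a c₁ c₂ t x : ℝ) : ℝ :=
  t ^ a * x ^ (1 / 2 : ℝ)
    * Real.exp (k / σ ^ 2 * x - σ ^ 2 / 8 * t - 1 / (4 * σ ^ 2) * t⁻¹ * Real.log x ^ 2)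
    * (c₁ * pcU (2 * a + 1 / 2) (1 / σ * t ^ (-(1 / 2) : ℝ) * Real.log x)
      + c₂ * pcV (2 * a + 1 / 2) (1 / σ * t ^ (-(1 / 2) : ℝ) * Real.log x))

/-- The invariant solutions for `V₁ + V₃ + a V₆`. -/
def solV1V3 (σ k a c₁ c₂ t x : ℝ) : ℝ :=
  (1 + t ^ 2) ^ (-(1 / 4) : ℝ) * x ^ (1 / 2 : ℝ)
    * Real.exp (k / σ ^ 2 * x - σ ^ 2 / 8 * t + (σ ^ 2 + 8 * a) / 8 * Real.arctan t
        - 1 / (2 * σ ^ 2) * t * (1 + t ^ 2)⁻¹ * Real.log x ^ 2)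
    * (c₁ * pcW ((σ ^ 2 + 8 * a) / 8) (√2 / σ * (1 + t ^ 2) ^ (-(1 / 2) : ℝ) * Real.log x)
      + c₂ * pcW ((σ ^ 2 + 8 * a) / 8)
          (-(√2 / σ * (1 + t ^ 2) ^ (-(1 / 2) : ℝ) * Real.log x)))

/-- The invariant solutions for `V₁ + V₅`. -/
def solV1addV5 (σ k c₁ c₂ t x : ℝ) : ℝ :=
  x ^ (1 / 2 : ℝ)
    * Real.exp (k / σ ^ 2 * x + 1 / (3 * σ ^ 2) * t ^ 3 - 1 / σ ^ 2 * t * Real.log x)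
    * (c₁ * airyAi ((4 * σ) ^ (-(4 / 3) : ℝ) * (σ ^ 4 - 8 * Real.log x + 4 * t ^ 2))
      + c₂ * airyBi ((4 * σ) ^ (-(4 / 3) : ℝ) * (σ ^ 4 - 8 * Real.log x + 4 * t ^ 2)))

/-- The invariant solutions for `V₁ - V₅`. -/
def solV1subV5 (σ k c₁ c₂ t x : ℝ) : ℝ :=
  x ^ (1 / 2 : ℝ)
    * Real.exp (k / σ ^ 2 * x + 1 / (3 * σ ^ 2) * t ^ 3 + 1 / σ ^ 2 * t * Real.log x)
    * (c₁ * airyAi ((4 * σ) ^ (-(4 / 3) : ℝ) * (σ ^ 4 + 8 * Real.log x + 4 * t ^ 2))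
      + c₂ * airyBi ((4 * σ) ^ (-(4 / 3) : ℝ) * (σ ^ 4 + 8 * Real.log x + 4 * t ^ 2)))

open Classical in
/-- The invariant solutions for `V₁ + a V₆`, in three cases by the sign of `σ² + 8a`. -/
def solV1 (σ k a c₁ c₂ t x : ℝ) : ℝ :=
  x ^ (1 / 2 : ℝ) * Real.exp (k / σ ^ 2 * x + a * t) *
    if 0 < σ ^ 2 + 8 * a then
      c₁ * x ^ (1 / (2 * σ) * √(σ ^ 2 + 8 * a)) + c₂ * x ^ (-(1 / (2 * σ) * √(σ ^ 2 + 8 * a)))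
    else if σ ^ 2 + 8 * a = 0 then
      c₁ + c₂ * Real.log x
    else
      c₁ * Real.cos (√(-σ ^ 2 - 8 * a) / (2 * σ) * Real.log x)
        + c₂ * Real.sin (√(-σ ^ 2 - 8 * a) / (2 * σ) * Real.log x)

/-- The list of explicit solutions, each with its domain: `OptimalSolution σ k D v` says that the
function `v` with domain `D` is on the list. -/
inductive OptimalSolution (σ k : ℝ) : Set (ℝ × ℝ) → (ℝ → ℝ → ℝ) → Prop
  | v4 (c : ℝ) : OptimalSolution σ k halfPlane (solV4 σ k c)
  | v2 (a c₁ c₂ : ℝ) : OptimalSolution σ k {p | 0 < p.1 ∧ 0 < p.2} (solV2 σ k a c₁ c₂)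
  | v1v3 (a c₁ c₂ : ℝ) : OptimalSolution σ k halfPlane (solV1V3 σ k a c₁ c₂)
  | v1addv5 (c₁ c₂ : ℝ) : OptimalSolution σ k halfPlane (solV1addV5 σ k c₁ c₂)
  | v1subv5 (c₁ c₂ : ℝ) : OptimalSolution σ k halfPlane (solV1subV5 σ k c₁ c₂)
  | v1 (a c₁ c₂ : ℝ) : OptimalSolution σ k halfPlane (solV1 σ k a c₁ c₂)

/-- `u` agrees on `Ω` with `v`. -/
def AgreesOn (Ω : Set (ℝ × ℝ)) (u v : ℝ → ℝ → ℝ) : Prop :=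
  ∀ t x : ℝ, (t, x) ∈ Ω → u t x = v t x

end GMR

end

noncomputable section

namespace GMR

/-! ### Entire power series and the special functions -/

/-! With y = ln x / σ and u = x^{1/2} e^{kx/σ² - σ²t/8} h, equation (1) becomes the heat equation
h_t = ½ h_yy, and 𝔤 becomes its six-dimensional symmetry algebra sl₂ ⋉ Heisenberg. A general element
has τ = a₁ + a₂t + a₃t², ξ = (a₂/2 + a₃t)y + b₀ + b₁t and φ = (c - b₁y - a₃(y² + t)/2)h.
`IsInvariantSolution.heatInv` and `isInvariantSolution_weight_iff` pass between the two pictures.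

Explicit solutions. Where τ ≠ 0, invariant solutions are sought as h = e^μ f(z) with a similarity
variable z, and the heat equation reduces to f'' = Q(z) f. Given a fundamental system f₁, f₂ of this
equation, the Wronskians of e^{-μ}h with f₂ and f₁ have zero gradient in the (t, y)-plane, so they
are constant on connected domains, whatever the level sets of z look like. They are the coefficients
of h up to the constant Wronskian of f₁, f₂ (`HeatInv.eq_fundamental`). The special functions are
Maclaurin series with prescribed data at 0, so their independence is checked at 0. For V₄, where τ =
0, invariance is already a differential equation in y (`HeatInv.eq_exp`).

Classification. The flows of V₁, V₂, V₃ act on t by translations, dilations and Möbius maps, and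
those of V₄, V₅ act by shifts and Galilean boosts in y. `Reducible.of_symmetry` turns each flow into
a reduction step from one generator to another. Together with rescaling of the generator, the zeros
of the quadratic τ decide the normal form: τ = 1 + t² if there is no real zero, τ = t if there is a
simple one, τ constant if τ is constant or has a double zero (moved to infinity), and V₄ if τ = 0
and ξ ≠ 0. The remaining freedom removes b₀, b₁, except for the term ±V₅ beside V₁.

The flow of V₃ is only local, so the range I of times is carried along. It is the projection of a
connected set, hence lies on one side of every zero of τ, and this keeps all Möbius maps in use free
of poles on I. -/

/-- The coefficients of an everywhere convergent power series. -/
def EntireCoeff (d : ℕ → ℝ) : Prop := ∀ R : ℝ, 0 < R → ∃ C, ∀ n, |d n| * R ^ n ≤ C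

/-- The sum of a power series. -/
def powerSum (d : ℕ → ℝ) (x : ℝ) : ℝ := ∑' n, d n * x ^ n

/-- The coefficients of the derivative of a power series. -/
def derivCoeff (d : ℕ → ℝ) (n : ℕ) : ℝ := (n + 1) * d (n + 1)

/-- The factor n + 1 ≤ 2^{n+1} is absorbed by the bound for the radius 2R. -/
lemma EntireCoeff.derivCoeff {d : ℕ → ℝ} (hd : EntireCoeff d) : EntireCoeff (derivCoeff d) := by
  intro R hR
  obtain ⟨C, hC⟩ := hd (2 * R) (by positivity)
  refine ⟨C / R, fun n => ?_⟩
  have h1 : ((n : ℝ) + 1) ≤ 2 ^ (n + 1) := by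
    have := (Nat.lt_two_pow_self (n := n + 1)).le
    exact_mod_cast this
  rw [le_div_iff₀ hR]
  have h2 := hC (n + 1)
  calc |GMR.derivCoeff d n| * R ^ n * R = (n + 1) * (|d (n + 1)| * R ^ (n + 1)) := by
        rw [GMR.derivCoeff, abs_mul, abs_of_nonneg (by positivity : (0 : ℝ) ≤ n + 1)]; ring
    _ ≤ 2 ^ (n + 1) * (|d (n + 1)| * R ^ (n + 1)) := by gcongr
    _ = |d (n + 1)| * (2 * R) ^ (n + 1) := by rw [mul_pow]; ring
    _ ≤ C := h2

lemma EntireCoeff.summable_abs {d : ℕ → ℝ} (hd : EntireCoeff d) (R : ℝ) (hR : 0 < R) :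
    Summable fun n => |d n| * R ^ n := by
  obtain ⟨C, hC⟩ := hd (2 * R) (by positivity)
  refine Summable.of_nonneg_of_le (fun n => by positivity) (fun n => ?_)
    ((summable_geometric_two).mul_left C)
  have := hC n
  rw [mul_pow] at this
  rw [div_pow, one_pow, mul_one_div, le_div_iff₀ (by positivity)]
  linarith

lemma EntireCoeff.summable {d : ℕ → ℝ} (hd : EntireCoeff d) (x : ℝ) :
    Summable fun n => d n * x ^ n := by
  refine Summable.of_norm_bounded (hd.summable_abs (|x| + 1) (by positivity)) fun n => ?_
  rw [Real.norm_eq_abs, abs_mul, abs_pow]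
  gcongr
  linarith

/-- Termwise differentiation on the ball of radius R = |x| + 1, where the differentiated series is
dominated by ∑ |d n| n R^{n-1}. -/
lemma EntireCoeff.hasDerivAt {d : ℕ → ℝ} (hd : EntireCoeff d) (x : ℝ) :
    HasDerivAt (powerSum d) (powerSum (GMR.derivCoeff d) x) x := by
  set R := |x| + 1 with hR
  have hR0 : 0 < R := by positivity
  have hshift : powerSum (GMR.derivCoeff d) x = ∑' n : ℕ, d n * (n * x ^ (n - 1)) := by
    have hs : Summable fun n : ℕ => d n * (n * x ^ (n - 1)) := by
      rw [← summable_nat_add_iff 1]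
      refine (hd.derivCoeff.summable x).congr fun n => ?_
      simp [GMR.derivCoeff]; ring
    rw [hs.tsum_eq_zero_add]
    simp only [CharP.cast_eq_zero, zero_mul, mul_zero, zero_add, powerSum]
    refine tsum_congr fun n => ?_
    simp [GMR.derivCoeff]; ring
  have hu : Summable fun n : ℕ => |d n| * (n * R ^ (n - 1)) := by
    rw [← summable_nat_add_iff 1]
    refine (hd.derivCoeff.summable_abs R hR0).congr fun n => ?_
    rw [GMR.derivCoeff, abs_mul, abs_of_nonneg (by positivity : (0 : ℝ) ≤ n + 1)]
    simp; ring
  rw [hshift]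
  refine hasDerivAt_tsum_of_isPreconnected (t := Metric.ball 0 R) (y₀ := 0) hu
    Metric.isOpen_ball (convex_ball 0 R).isPreconnected
    (g := fun n y => d n * y ^ n) (g' := fun n y => d n * (n * y ^ (n - 1)))
    (fun n y _ => (hasDerivAt_pow n y).const_mul (d n)) (fun n y hy => ?_)
    (Metric.mem_ball_self hR0) (hd.summable 0) ?_
  · rw [Real.norm_eq_abs, abs_mul, abs_mul, Nat.abs_cast, abs_pow]
    have : |y| ≤ R := by simpa using (Metric.mem_ball.1 hy).le
    gcongr
  · simp [hR]

lemma EntireCoeff.contDiff {d : ℕ → ℝ} (hd : EntireCoeff d) : ContDiff ℝ 2 (powerSum d) := by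
  have h1 : deriv (powerSum d) = powerSum (GMR.derivCoeff d) :=
    funext fun x => (hd.hasDerivAt x).deriv
  have h2 : deriv (powerSum (GMR.derivCoeff d)) =
      powerSum (GMR.derivCoeff (GMR.derivCoeff d)) :=
    funext fun x => (hd.derivCoeff.hasDerivAt x).deriv
  rw [show (2 : WithTop ℕ∞) = 1 + 1 by norm_num, contDiff_succ_iff_deriv]
  refine ⟨fun x => (hd.hasDerivAt x).differentiableAt, by simp, ?_⟩
  rw [h1, contDiff_one_iff_deriv, h2]
  exact ⟨fun x => (hd.derivCoeff.hasDerivAt x).differentiableAt,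
    continuous_iff_continuousAt.2 fun x =>
      (hd.derivCoeff.derivCoeff.hasDerivAt x).continuousAt⟩

/-! ### Power series solutions of y'' = (p + qx + rx²) y -/

section odeSol
variable (p q r y₀ y₁ : ℝ)

/-- The Maclaurin coefficients of `odeSol`. -/
def odeTaylor (n : ℕ) : ℝ := odeCoeff p q r y₀ y₁ n / (n.factorial : ℝ)

lemma odeTaylor_one : odeTaylor p q r y₀ y₁ 1 = y₁ := by simp [odeTaylor, odeCoeff]

/-- The coefficients 2 and 3 are separate from the general recurrence: there the truncated indices n
- 1, n - 2 of `odeCoeff` can be wrong, but they carry a vanishing factor. -/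
lemma odeTaylor_two :
    2 * odeTaylor p q r y₀ y₁ 2 = p * odeTaylor p q r y₀ y₁ 0 := by
  simp [odeTaylor, odeCoeff, Nat.factorial]; ring

lemma odeTaylor_three :
    6 * odeTaylor p q r y₀ y₁ 3 =
      p * odeTaylor p q r y₀ y₁ 1 + q * odeTaylor p q r y₀ y₁ 0 := by
  simp [odeTaylor, odeCoeff, Nat.factorial]; ring

lemma odeTaylor_add_four (n : ℕ) :
    ((n : ℝ) + 4) * (n + 3) * odeTaylor p q r y₀ y₁ (n + 4) =
      p * odeTaylor p q r y₀ y₁ (n + 2) + q * odeTaylor p q r y₀ y₁ (n + 1)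
        + r * odeTaylor p q r y₀ y₁ n := by
  have h : odeCoeff p q r y₀ y₁ (n + 4) = p * odeCoeff p q r y₀ y₁ (n + 2)
      + q * ((n + 2 : ℕ) : ℝ) * odeCoeff p q r y₀ y₁ (n + 1)
      + r * (((n + 2 : ℕ) : ℝ) * (((n + 2 : ℕ) : ℝ) - 1)) * odeCoeff p q r y₀ y₁ n := by
    rw [odeCoeff.eq_3]; simp
  have f0 : (n.factorial : ℝ) ≠ 0 := by positivity
  simp only [odeTaylor, h, Nat.factorial_succ]
  push_cast
  field_simp
  ring

/-- In the recurrence the factor (m + 4)(m + 3) eventually exceeds (|p| + |q| + |r|) R⁴. From then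
on |d n| Rⁿ cannot exceed the bound valid for the preceding terms. -/
lemma entireCoeff_odeTaylor : EntireCoeff (odeTaylor p q r y₀ y₁) := by
  intro R₀ hR₀
  -- With R ≥ 1 the powers R² and R³ arising from the shifts are at most R⁴.
  suffices h : ∀ R : ℝ, 1 ≤ R → ∃ C, ∀ n, |odeTaylor p q r y₀ y₁ n| * R ^ n ≤ C by
    obtain ⟨C, hC⟩ := h (max 1 R₀) (le_max_left _ _)
    refine ⟨C, fun n => le_trans ?_ (hC n)⟩
    gcongr
    exact le_max_right _ _
  intro R hR
  set d := odeTaylor p q r y₀ y₁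
  set K := |p| + |q| + |r| with hK
  obtain ⟨N, hN⟩ := exists_nat_ge (K * R ^ 4)
  refine ⟨∑ i ∈ Finset.range (N + 4), |d i| * R ^ i, fun n => ?_⟩
  set C := ∑ i ∈ Finset.range (N + 4), |d i| * R ^ i with hC
  have hC0 : 0 ≤ C := Finset.sum_nonneg fun i _ => by positivity
  induction n using Nat.strong_induction_on with
  | _ n ih =>
    by_cases hn : n < N + 4
    · exact Finset.single_le_sum (f := fun i => |d i| * R ^ i)
        (fun i _ => by positivity) (Finset.mem_range.2 hn)
    · obtain ⟨m, rfl⟩ : ∃ m, n = m + 4 := ⟨n - 4, by omega⟩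
      have hm : (N : ℝ) ≤ m := by exact_mod_cast (by omega : N ≤ m)
      have e := odeTaylor_add_four p q r y₀ y₁ m
      have i2 := ih (m + 2) (by omega)
      have i1 := ih (m + 1) (by omega)
      have i0 := ih m (by omega)
      have key : ((m : ℝ) + 4) * (m + 3) * |d (m + 4)| ≤
          |p| * |d (m + 2)| + |q| * |d (m + 1)| + |r| * |d m| := by
        rw [← abs_of_nonneg (by positivity : (0 : ℝ) ≤ (m + 4) * (m + 3)), ← abs_mul, e,
          ← abs_mul, ← abs_mul, ← abs_mul]
        exact abs_add_three _ _ _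
      have b2 : |p| * |d (m + 2)| * R ^ (m + 4) ≤ |p| * C * R ^ 4 := by
        calc _ = |p| * (|d (m + 2)| * R ^ (m + 2)) * R ^ 2 := by ring
          _ ≤ _ := by gcongr; norm_num
      have b1 : |q| * |d (m + 1)| * R ^ (m + 4) ≤ |q| * C * R ^ 4 := by
        calc _ = |q| * (|d (m + 1)| * R ^ (m + 1)) * R ^ 3 := by ring
          _ ≤ _ := by gcongr; norm_num
      have b0 : |r| * |d m| * R ^ (m + 4) ≤ |r| * C * R ^ 4 := by
        calc _ = |r| * (|d m| * R ^ m) * R ^ 4 := by ring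
          _ ≤ _ := by gcongr
      have hRp : 0 < R ^ (m + 4) := by positivity
      have h1 : ((m : ℝ) + 4) * (m + 3) * (|d (m + 4)| * R ^ (m + 4)) ≤ K * R ^ 4 * C := by
        have := mul_le_mul_of_nonneg_right key hRp.le
        rw [hK]; nlinarith
      have h2 : K * R ^ 4 * C ≤ ((m : ℝ) + 4) * (m + 3) * C := by
        have := (Nat.cast_nonneg m : (0 : ℝ) ≤ m)
        exact mul_le_mul_of_nonneg_right (by nlinarith) hC0
      exact le_of_mul_le_mul_left (h1.trans h2) (by positivity)

lemma odeSol_eq_powerSum : odeSol p q r y₀ y₁ = powerSum (odeTaylor p q r y₀ y₁) := rfl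

/-- The derivative of `odeSol`. -/
def odeSolDeriv : ℝ → ℝ := powerSum (derivCoeff (odeTaylor p q r y₀ y₁))

lemma hasDerivAt_odeSol (x : ℝ) :
    HasDerivAt (odeSol p q r y₀ y₁) (odeSolDeriv p q r y₀ y₁ x) x :=
  (entireCoeff_odeTaylor p q r y₀ y₁).hasDerivAt x

/-- Comparison of the coefficients of x^{n+2}; the constant and linear terms are split off and
matched by `odeTaylor_two` and `odeTaylor_three`. -/
lemma hasDerivAt_odeSolDeriv (x : ℝ) :
    HasDerivAt (odeSolDeriv p q r y₀ y₁)
      ((p + q * x + r * x ^ 2) * odeSol p q r y₀ y₁ x) x := by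
  have hd := entireCoeff_odeTaylor p q r y₀ y₁
  refine (hd.derivCoeff.hasDerivAt x).congr_deriv ?_
  rw [odeSol_eq_powerSum]
  set d := odeTaylor p q r y₀ y₁ with hdd
  have s0 : Summable fun n => d n * x ^ n := hd.summable x
  have s1 : Summable fun n => d (n + 1) * x ^ (n + 1) := (summable_nat_add_iff 1).2 s0
  have s2 : Summable fun n => d (n + 2) * x ^ (n + 2) := (summable_nat_add_iff 2).2 s0
  have sd : Summable fun n => derivCoeff (derivCoeff d) n * x ^ n := hd.derivCoeff.derivCoeff.summable x
  have e0 : powerSum d x = ∑' n, d n * x ^ n := rfl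
  have e1 : powerSum d x = d 0 + ∑' n, d (n + 1) * x ^ (n + 1) := by
    rw [e0, s0.tsum_eq_zero_add]; simp
  have e2 : powerSum d x = d 0 + d 1 * x + ∑' n, d (n + 2) * x ^ (n + 2) := by
    rw [e0, ← s0.sum_add_tsum_nat_add 2]; simp [Finset.sum_range_succ]
  have ed : powerSum (derivCoeff (derivCoeff d)) x =
      2 * d 2 + 6 * d 3 * x
        + ∑' n, derivCoeff (derivCoeff d) (n + 2) * x ^ (n + 2) := by
    rw [powerSum, ← sd.sum_add_tsum_nat_add 2]
    simp [Finset.sum_range_succ, derivCoeff]; ring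
  have et : ∑' n, derivCoeff (derivCoeff d) (n + 2) * x ^ (n + 2) =
      p * (∑' n, d (n + 2) * x ^ (n + 2)) + q * x * (∑' n, d (n + 1) * x ^ (n + 1))
        + r * x ^ 2 * ∑' n, d n * x ^ n := by
    rw [← tsum_mul_left, ← tsum_mul_left, ← tsum_mul_left,
      ← (s2.mul_left p).tsum_add (s1.mul_left (q * x)),
      ← ((s2.mul_left p).add (s1.mul_left (q * x))).tsum_add (s0.mul_left (r * x ^ 2))]
    refine tsum_congr fun n => ?_
    have h := odeTaylor_add_four p q r y₀ y₁ n
    rw [← hdd] at h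
    simp only [derivCoeff]
    push_cast
    linear_combination x ^ (n + 2) * h
  have h2 := odeTaylor_two p q r y₀ y₁
  have h3 := odeTaylor_three p q r y₀ y₁
  rw [← hdd] at h2 h3
  rw [ed, et]
  linear_combination h2 + x * h3 - p * e2 - q * x * e1 - r * x ^ 2 * e0

lemma odeSol_zero : odeSol p q r y₀ y₁ 0 = y₀ := by
  rw [odeSol, tsum_eq_single 0 (fun n hn => by simp [hn])]
  simp [odeCoeff]

lemma odeSolDeriv_zero : odeSolDeriv p q r y₀ y₁ 0 = y₁ := by
  rw [odeSolDeriv, powerSum, tsum_eq_single 0 (fun n hn => by simp [hn])]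
  simp [derivCoeff, odeTaylor_one]

lemma contDiff_odeSol : ContDiff ℝ 2 (odeSol p q r y₀ y₁) :=
  (entireCoeff_odeTaylor p q r y₀ y₁).contDiff

end odeSol

/-! ### Fundamental systems and Wronskians -/

/-- A fundamental system of the equation `f'' = Q f`: two solutions (with their derivatives)
of constant non-zero Wronskian. -/
structure IsFundamental (Q f₁ f₁' f₂ f₂' : ℝ → ℝ) : Prop where
  deriv₁ : ∀ z, HasDerivAt f₁ (f₁' z) z
  deriv₁' : ∀ z, HasDerivAt f₁' (Q z * f₁ z) z
  deriv₂ : ∀ z, HasDerivAt f₂ (f₂' z) z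
  deriv₂' : ∀ z, HasDerivAt f₂' (Q z * f₂ z) z
  wronskian : ∃ w, w ≠ 0 ∧ ∀ z, f₁ z * f₂' z - f₁' z * f₂ z = w
  contDiff₁ : ContDiff ℝ 2 f₁
  contDiff₂ : ContDiff ℝ 2 f₂

/-- The equation has no first-order term, so the Wronskian is constant and its value at 0 decides.
-/
lemma IsFundamental.of_wronskian_zero {Q f₁ f₁' f₂ f₂' : ℝ → ℝ}
    (h₁ : ∀ z, HasDerivAt f₁ (f₁' z) z) (h₁' : ∀ z, HasDerivAt f₁' (Q z * f₁ z) z)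
    (h₂ : ∀ z, HasDerivAt f₂ (f₂' z) z) (h₂' : ∀ z, HasDerivAt f₂' (Q z * f₂ z) z)
    (c₁ : ContDiff ℝ 2 f₁) (c₂ : ContDiff ℝ 2 f₂)
    (hw : f₁ 0 * f₂' 0 - f₁' 0 * f₂ 0 ≠ 0) : IsFundamental Q f₁ f₁' f₂ f₂' := by
  refine ⟨h₁, h₁', h₂, h₂', ⟨_, hw, fun z => ?_⟩, c₁, c₂⟩
  have hd : ∀ z, HasDerivAt (fun z => f₁ z * f₂' z - f₁' z * f₂ z) 0 z := fun z => by
    refine (((h₁ z).mul (h₂' z)).sub ((h₁' z).mul (h₂ z))).congr_deriv ?_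
    ring
  exact is_const_of_deriv_eq_zero (fun z => (hd z).differentiableAt) (fun z => (hd z).deriv) z 0

lemma isFundamental_odeSol {Q : ℝ → ℝ} (p q r y₀ y₁ w₀ w₁ : ℝ)
    (hQ : ∀ z, p + q * z + r * z ^ 2 = Q z) (hw : y₀ * w₁ - y₁ * w₀ ≠ 0) :
    IsFundamental Q
      (odeSol p q r y₀ y₁) (odeSolDeriv p q r y₀ y₁)
      (odeSol p q r w₀ w₁) (odeSolDeriv p q r w₀ w₁) := by
  obtain rfl := funext hQ
  refine .of_wronskian_zero (hasDerivAt_odeSol _ _ _ _ _) (hasDerivAt_odeSolDeriv _ _ _ _ _)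
    (hasDerivAt_odeSol _ _ _ _ _) (hasDerivAt_odeSolDeriv _ _ _ _ _)
    (contDiff_odeSol _ _ _ _ _) (contDiff_odeSol _ _ _ _ _) ?_
  simpa only [odeSol_zero, odeSolDeriv_zero] using hw

lemma exists_isFundamental_airy :
    ∃ f₁' f₂', IsFundamental (fun z => z) airyAi f₁' airyBi f₂' := by
  have h1 : 0 < Real.Gamma (1 / 3) := Real.Gamma_pos_of_pos (by norm_num)
  have h2 : 0 < Real.Gamma (2 / 3) := Real.Gamma_pos_of_pos (by norm_num)
  refine ⟨_, _, isFundamental_odeSol 0 1 0 (1 / ((3 : ℝ) ^ (2 / 3 : ℝ) * Real.Gamma (2 / 3)))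
    (-(1 / ((3 : ℝ) ^ (1 / 3 : ℝ) * Real.Gamma (1 / 3))))
    (1 / ((3 : ℝ) ^ (1 / 6 : ℝ) * Real.Gamma (2 / 3)))
    ((3 : ℝ) ^ (1 / 6 : ℝ) / Real.Gamma (1 / 3)) (fun z => by ring) ?_⟩
  · rw [neg_mul, sub_neg_eq_add]; positivity

/-- The Wronskian of U and V at 0 equals √(2/π): the reflection formula, used for both pairs of
Gamma values, leaves a sum sin² + cos². -/
lemma exists_isFundamental_pcUV (a : ℝ) :
    ∃ f₁' f₂', IsFundamental (fun z => a + 1 / 4 * z ^ 2) (pcU a) f₁' (pcV a) f₂' := by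
  refine ⟨_, _, isFundamental_odeSol a 0 (1 / 4)
    (√Real.pi / ((2 : ℝ) ^ (a / 2 + 1 / 4) * Real.Gamma (3 / 4 + a / 2)))
    (-(√Real.pi / ((2 : ℝ) ^ (a / 2 - 1 / 4) * Real.Gamma (1 / 4 + a / 2))))
    ((2 : ℝ) ^ (a / 2 + 1 / 4) * Real.sin (Real.pi * (3 / 4 - a / 2))
      / Real.Gamma (3 / 4 - a / 2))
    ((2 : ℝ) ^ (a / 2 + 3 / 4) * Real.sin (Real.pi * (1 / 4 - a / 2))
      / Real.Gamma (1 / 4 - a / 2)) (fun z => by ring) ?_⟩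
  · have r1 := Real.Gamma_mul_Gamma_one_sub (1 / 4 - a / 2)
    have r2 := Real.Gamma_mul_Gamma_one_sub (3 / 4 - a / 2)
    rw [show 1 - (1 / 4 - a / 2) = 3 / 4 + a / 2 by ring] at r1
    rw [show 1 - (3 / 4 - a / 2) = 1 / 4 + a / 2 by ring] at r2
    have e1 : (2 : ℝ) ^ (a / 2 + 3 / 4) = 2 ^ (1 / 2 : ℝ) * 2 ^ (a / 2 + 1 / 4) := by
      rw [← Real.rpow_add (by norm_num)]; congr 1; ring
    have e2 : (2 : ℝ) ^ (a / 2 + 1 / 4) = 2 ^ (1 / 2 : ℝ) * 2 ^ (a / 2 - 1 / 4) := by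
      rw [← Real.rpow_add (by norm_num)]; congr 1; ring
    have hs : Real.sin (Real.pi * (3 / 4 - a / 2)) = Real.cos (Real.pi * (1 / 4 - a / 2)) := by
      rw [show Real.pi * (3 / 4 - a / 2) = Real.pi * (1 / 4 - a / 2) + Real.pi / 2 by ring,
        Real.sin_add_pi_div_two]
    have q1 : 0 < (2 : ℝ) ^ (a / 2 + 1 / 4) := by positivity
    have q2 : 0 < (2 : ℝ) ^ (a / 2 - 1 / 4) := by positivity
    have q3 : 0 < (2 : ℝ) ^ (1 / 2 : ℝ) := by positivity
    have key : √Real.pi / ((2 : ℝ) ^ (a / 2 + 1 / 4) * Real.Gamma (3 / 4 + a / 2)) *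
        ((2 : ℝ) ^ (a / 2 + 3 / 4) * Real.sin (Real.pi * (1 / 4 - a / 2))
          / Real.Gamma (1 / 4 - a / 2)) -
        -(√Real.pi / ((2 : ℝ) ^ (a / 2 - 1 / 4) * Real.Gamma (1 / 4 + a / 2))) *
        ((2 : ℝ) ^ (a / 2 + 1 / 4) * Real.sin (Real.pi * (3 / 4 - a / 2))
          / Real.Gamma (3 / 4 - a / 2)) = √Real.pi * 2 ^ (1 / 2 : ℝ) / Real.pi := by
      calc _ = √Real.pi * 2 ^ (1 / 2 : ℝ) * (Real.sin (Real.pi * (1 / 4 - a / 2))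
              * (Real.Gamma (1 / 4 - a / 2) * Real.Gamma (3 / 4 + a / 2))⁻¹
              + Real.sin (Real.pi * (3 / 4 - a / 2))
              * (Real.Gamma (3 / 4 - a / 2) * Real.Gamma (1 / 4 + a / 2))⁻¹) := by
            rw [e1, neg_mul, sub_neg_eq_add, mul_add]
            congr 1
            · rw [mul_inv]; generalize Real.Gamma (3 / 4 + a / 2) = g
              simp only [div_eq_mul_inv, mul_inv]
              field_simp
            · rw [e2]
              simp only [div_eq_mul_inv, mul_inv]
              field_simp
        _ = √Real.pi * 2 ^ (1 / 2 : ℝ) * ((Real.sin (Real.pi * (1 / 4 - a / 2)) ^ 2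
              + Real.sin (Real.pi * (3 / 4 - a / 2)) ^ 2) / Real.pi) := by
            -- This also covers the poles of Γ: there the product has the value 0, its inverse is 0,
            -- and the sine vanishes too.
            rw [r1, r2, inv_div, inv_div]; ring
        _ = _ := by rw [hs, Real.sin_sq_add_cos_sq]; ring
    rw [key]
    positivity

/-- The equation is even in z, so W(a, -z) is again a solution. The Wronskian at 0 is -2 W(a,0)
W'(a,0) > 0. -/
lemma exists_isFundamental_pcW (a : ℝ) :
    ∃ f₁' f₂', IsFundamental (fun z => a - 1 / 4 * z ^ 2) (pcW a) f₁' (fun z => pcW a (-z)) f₂' := by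
  have g1 : 0 < ‖Complex.Gamma (1 / 4 + Complex.I * a / 2)‖ :=
    norm_pos_iff.2 (Complex.Gamma_ne_zero_of_re_pos (by
      simp [Complex.add_re, Complex.mul_re]))
  have g2 : 0 < ‖Complex.Gamma (3 / 4 + Complex.I * a / 2)‖ :=
    norm_pos_iff.2 (Complex.Gamma_ne_zero_of_re_pos (by
      simp [Complex.add_re, Complex.mul_re]))
  obtain ⟨y₀, y₁, h0, h1, hW⟩ : ∃ y₀ y₁ : ℝ, 0 < y₀ ∧ y₁ < 0 ∧
      pcW a = odeSol a 0 (-(1 / 4)) y₀ y₁ :=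
    ⟨_, _, by positivity, neg_neg_of_pos (by positivity), rfl⟩
  have d0 := hasDerivAt_odeSol a 0 (-(1 / 4)) y₀ y₁
  have d1 := hasDerivAt_odeSolDeriv a 0 (-(1 / 4)) y₀ y₁
  rw [hW]
  refine ⟨odeSolDeriv a 0 (-(1 / 4)) y₀ y₁, fun z => -odeSolDeriv a 0 (-(1 / 4)) y₀ y₁ (-z), ?_⟩
  refine .of_wronskian_zero d0 (fun z => ?_) (fun z => ?_) (fun z => ?_)
    (contDiff_odeSol _ _ _ _ _) ((contDiff_odeSol _ _ _ _ _).comp contDiff_neg) ?_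
  · convert d1 z using 1; ring
  · exact ((d0 (-z)).comp z (hasDerivAt_neg z)).congr_deriv (by ring)
  · exact ((d1 (-z)).comp z (hasDerivAt_neg z)).neg.congr_deriv (by ring)
  · simp only [neg_zero, odeSol_zero, odeSolDeriv_zero]
    nlinarith [mul_pos h0 (neg_pos.2 h1)]

/-! ### Gradients in the plane -/

/-- `f` is differentiable at `P` with partial derivatives `a`, `b`. -/
def HasGrad (f : ℝ × ℝ → ℝ) (a b : ℝ) (P : ℝ × ℝ) : Prop :=
  HasFDerivAt f (a • ContinuousLinearMap.fst ℝ ℝ ℝ + b • ContinuousLinearMap.snd ℝ ℝ ℝ) P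

namespace HasGrad
variable {f g : ℝ × ℝ → ℝ} {a b c d : ℝ} {P : ℝ × ℝ}

lemma congr_grad (h : HasGrad f a b P) (h1 : a = c) (h2 : b = d) : HasGrad f c d P := by
  subst h1 h2; exact h

lemma fst : HasGrad Prod.fst 1 0 P := by
  have h : HasFDerivAt Prod.fst (ContinuousLinearMap.fst ℝ ℝ ℝ) P := hasFDerivAt_fst
  exact h.congr_fderiv (by simp)

lemma snd : HasGrad Prod.snd 0 1 P := by
  have h : HasFDerivAt Prod.snd (ContinuousLinearMap.snd ℝ ℝ ℝ) P := hasFDerivAt_snd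
  exact h.congr_fderiv (by simp)

lemma const (k : ℝ) : HasGrad (fun _ => k) 0 0 P :=
  (hasFDerivAt_const k P).congr_fderiv (by simp)

lemma add (hf : HasGrad f a b P) (hg : HasGrad g c d P) :
    HasGrad (fun x => f x + g x) (a + c) (b + d) P :=
  (HasFDerivAt.add hf hg).congr_fderiv (by ext <;> simp)

lemma sub (hf : HasGrad f a b P) (hg : HasGrad g c d P) :
    HasGrad (fun x => f x - g x) (a - c) (b - d) P :=
  (HasFDerivAt.sub hf hg).congr_fderiv (by ext <;> simp)

lemma neg (hf : HasGrad f a b P) : HasGrad (fun x => -f x) (-a) (-b) P :=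
  (HasFDerivAt.neg hf).congr_fderiv (by ext <;> simp)

lemma mul (hf : HasGrad f a b P) (hg : HasGrad g c d P) :
    HasGrad (fun x => f x * g x) (f P * c + g P * a) (f P * d + g P * b) P :=
  (HasFDerivAt.mul hf hg).congr_fderiv (by ext <;> simp)

lemma comp {φ : ℝ → ℝ} {φ' : ℝ} (hφ : HasDerivAt φ φ' (f P)) (hf : HasGrad f a b P) :
    HasGrad (fun x => φ (f x)) (φ' * a) (φ' * b) P :=
  (hφ.comp_hasFDerivAt P hf).congr_fderiv (by ext <;> simp)

lemma exp (hf : HasGrad f a b P) :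
    HasGrad (fun x => Real.exp (f x)) (Real.exp (f P) * a) (Real.exp (f P) * b) P :=
  comp (φ := Real.exp) (Real.hasDerivAt_exp _) hf

lemma of_fst {φ : ℝ → ℝ} {φ' : ℝ} (hφ : HasDerivAt φ φ' P.1) :
    HasGrad (fun x => φ x.1) φ' 0 P :=
  (comp (f := Prod.fst) hφ fst).congr_grad (by ring) (by ring)

lemma comp₂ {T Y : ℝ × ℝ → ℝ} {t₁ t₂ y₁ y₂ : ℝ} (hf : HasGrad f a b (T P, Y P))
    (hT : HasGrad T t₁ t₂ P) (hY : HasGrad Y y₁ y₂ P) :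
    HasGrad (fun x => f (T x, Y x)) (a * t₁ + b * y₁) (a * t₂ + b * y₂) P := by
  have hf' : HasFDerivAt f _ ((fun x => (T x, Y x)) P) := hf
  have h := HasFDerivAt.comp P hf' (HasFDerivAt.prodMk hT hY)
  exact h.congr_fderiv (by ext <;> simp)

lemma hasDerivAt_fst {t y : ℝ} (hf : HasGrad f a b (t, y)) :
    HasDerivAt (fun s => f (s, y)) a t := by
  have hf' : HasFDerivAt f _ ((fun s => (s, y)) t) := hf
  have h := HasFDerivAt.comp_hasDerivAt t hf' ((hasDerivAt_id t).prodMk (hasDerivAt_const t y))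
  exact h.congr_deriv (by simp)

lemma hasDerivAt_snd {t y : ℝ} (hf : HasGrad f a b (t, y)) :
    HasDerivAt (fun s => f (t, s)) b y := by
  have hf' : HasFDerivAt f _ ((fun s => (t, s)) y) := hf
  have h := HasFDerivAt.comp_hasDerivAt y hf' ((hasDerivAt_const y t).prodMk (hasDerivAt_id y))
  exact h.congr_deriv (by simp)

lemma exists_const {Ω : Set (ℝ × ℝ)} (ho : IsOpen Ω) (hc : IsConnected Ω)
    (hf : ∀ P ∈ Ω, HasGrad f 0 0 P) : ∃ k, ∀ P ∈ Ω, f P = k := by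
  have h0 : ∀ P ∈ Ω, HasFDerivAt f (0 : ℝ × ℝ →L[ℝ] ℝ) P :=
    fun P hP => HasFDerivAt.congr_fderiv (hf P hP) (by simp)
  obtain ⟨k, hk⟩ := ho.exists_is_const_of_fderiv_eq_zero hc.isPreconnected
    (fun P hP => (h0 P hP).differentiableAt.differentiableWithinAt)
    (fun P hP => (h0 P hP).fderiv)
  exact ⟨k, hk⟩

end HasGrad

/-! ### Invariant solutions of the heat equation -/

/-- `h` solves `h_t = ½ h_yy` on `Ω` and is invariant under
`(a₁ + a₂ t + a₃ t²) ∂_t + ((a₂/2 + a₃ t) y + b₀ + b₁ t) ∂_y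
  + (c - b₁ y - a₃ (y² + t) / 2) h ∂_h`; here `q = h_y`, `r = h_yy`, `s = h_ty`. -/
def HeatInv (a₁ a₂ a₃ b₀ b₁ c : ℝ) (Ω : Set (ℝ × ℝ)) (h : ℝ × ℝ → ℝ) : Prop :=
  ∃ q r s : ℝ × ℝ → ℝ, ∀ P ∈ Ω,
    HasGrad h (r P / 2) (q P) P ∧ HasGrad q (s P) (r P) P ∧
    (a₁ + a₂ * P.1 + a₃ * P.1 ^ 2) * (r P / 2) + ((a₂ / 2 + a₃ * P.1) * P.2 + b₀ + b₁ * P.1) * q P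
      = (c - b₁ * P.2 - a₃ * (P.2 ^ 2 + P.1) / 2) * h P ∧
    (a₁ + a₂ * P.1 + a₃ * P.1 ^ 2) * s P + ((a₂ / 2 + a₃ * P.1) * P.2 + b₀ + b₁ * P.1) * r P
      + (a₂ / 2 + a₃ * P.1) * q P
      = (c - b₁ * P.2 - a₃ * (P.2 ^ 2 + P.1) / 2) * q P + (-b₁ - a₃ * P.2) * h P

lemma HeatInv.smul {a₁ a₂ a₃ b₀ b₁ c : ℝ} {Ω : Set (ℝ × ℝ)} {h : ℝ × ℝ → ℝ}
    (H : HeatInv a₁ a₂ a₃ b₀ b₁ c Ω h) (l : ℝ) :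
    HeatInv (l * a₁) (l * a₂) (l * a₃) (l * b₀) (l * b₁) (l * c) Ω h := by
  obtain ⟨q, r, s, H⟩ := H
  refine ⟨q, r, s, fun P hP => ?_⟩
  obtain ⟨h1, h2, h3, h4⟩ := H P hP
  exact ⟨h1, h2, by linear_combination l * h3, by linear_combination l * h4⟩

/-- Pulling back an invariant solution by `(t, y) = (T(s), A(s) z + B(s))` with multiplier
`exp μ`. The hypotheses say that this is a symmetry of the heat equation which carries the
generator with coefficients `a'`, `b'`, `c'` to the one with coefficients `a`, `b`, `c`. -/
lemma HeatInv.pullback {a₁ a₂ a₃ b₀ b₁ c a₁' a₂' a₃' b₀' b₁' c' : ℝ}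
    {Ω Ω' : Set (ℝ × ℝ)} {h : ℝ × ℝ → ℝ} (H : HeatInv a₁ a₂ a₃ b₀ b₁ c Ω h)
    (T A Y μ μz μzs μzz A' : ℝ × ℝ → ℝ)
    (hT : ∀ P ∈ Ω', HasGrad T (A P ^ 2) 0 P)
    (hA : ∀ P ∈ Ω', HasGrad A (A' P) 0 P)
    (hY : ∀ P ∈ Ω', HasGrad Y (μz P * A P) (A P) P)
    (hμ : ∀ P ∈ Ω', HasGrad μ ((μzz P + μz P ^ 2) / 2) (μz P) P)
    (hμz : ∀ P ∈ Ω', HasGrad μz (μzs P) (μzz P) P)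
    (hA' : ∀ P ∈ Ω', A' P = μzz P * A P)
    (hμzs : ∀ P ∈ Ω', μzs P = μz P * μzz P)
    (hτ : ∀ P ∈ Ω', (a₁' + a₂' * P.1 + a₃' * P.1 ^ 2) * A P ^ 2 = a₁ + a₂ * T P + a₃ * T P ^ 2)
    (hξ : ∀ P ∈ Ω', ((a₂' / 2 + a₃' * P.1) * P.2 + b₀' + b₁' * P.1
        + (a₁' + a₂' * P.1 + a₃' * P.1 ^ 2) * μz P) * A P
      = (a₂ / 2 + a₃ * T P) * Y P + b₀ + b₁ * T P)
    (hξ' : ∀ P ∈ Ω', a₂' / 2 + a₃' * P.1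
        + (a₁' + a₂' * P.1 + a₃' * P.1 ^ 2) * μzz P = a₂ / 2 + a₃ * T P)
    (hφ : ∀ P ∈ Ω', c' - b₁' * P.2 - a₃' * (P.2 ^ 2 + P.1) / 2
      = c - b₁ * Y P - a₃ * (Y P ^ 2 + T P) / 2
        + (a₁' + a₂' * P.1 + a₃' * P.1 ^ 2) * ((μzz P + μz P ^ 2) / 2)
        + ((a₂' / 2 + a₃' * P.1) * P.2 + b₀' + b₁' * P.1) * μz P)
    (hφ' : ∀ P ∈ Ω', -b₁' - a₃' * P.2 = (-b₁ - a₃ * Y P) * A P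
        + (a₁' + a₂' * P.1 + a₃' * P.1 ^ 2) * (μz P * μzz P)
        + (a₂' / 2 + a₃' * P.1) * μz P
        + ((a₂' / 2 + a₃' * P.1) * P.2 + b₀' + b₁' * P.1) * μzz P)
    (hmaps : ∀ P ∈ Ω', (T P, Y P) ∈ Ω) :
    HeatInv a₁' a₂' a₃' b₀' b₁' c' Ω' (fun P => Real.exp (μ P) * h (T P, Y P)) := by
  obtain ⟨q, r, s, H⟩ := H
  -- The chain rule gives the new h_y, h_yy and h_ty; A depends on time only and Y is affine in z.
  refine ⟨fun P => Real.exp (μ P) * (μz P * h (T P, Y P) + A P * q (T P, Y P)),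
    fun P => Real.exp (μ P) * ((μzz P + μz P ^ 2) * h (T P, Y P)
      + 2 * μz P * A P * q (T P, Y P) + A P ^ 2 * r (T P, Y P)),
    fun P => Real.exp (μ P) * ((μzz P + μz P ^ 2) / 2 * (μz P * h (T P, Y P) + A P * q (T P, Y P))
      + μzs P * h (T P, Y P)
      + μz P * (r (T P, Y P) / 2 * A P ^ 2 + q (T P, Y P) * (μz P * A P))
      + A' P * q (T P, Y P)
      + A P * (s (T P, Y P) * A P ^ 2 + r (T P, Y P) * (μz P * A P))), fun P hP => ?_⟩
  obtain ⟨h1, h2, h3, h4⟩ := H _ (hmaps P hP)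
  have k1 := h1.comp₂ (hT P hP) (hY P hP)
  have k2 := h2.comp₂ (hT P hP) (hY P hP)
  have e := (hμ P hP).exp
  simp only at h3 h4
  refine ⟨(e.mul k1).congr_grad (by ring) (by ring),
    (e.mul (((hμz P hP).mul k1).add ((hA P hP).mul k2))).congr_grad (by ring) (by ring), ?_, ?_⟩
  -- The old relation is transported coefficient by coefficient: hτ, hξ and hφ match the
  -- coefficients of h_yy, h_y and h.
  · linear_combination Real.exp (μ P) * h3
      + Real.exp (μ P) * r (T P, Y P) / 2 * hτ P hP + Real.exp (μ P) * q (T P, Y P) * hξ P hP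
      - Real.exp (μ P) * h (T P, Y P) * hφ P hP
  · linear_combination Real.exp (μ P) * μz P * h3 + Real.exp (μ P) * A P * h4
      + Real.exp (μ P) * (A P * s (T P, Y P) + μz P * r (T P, Y P) / 2) * hτ P hP
      + Real.exp (μ P) * (A P * r (T P, Y P) + μz P * q (T P, Y P)) * hξ P hP
      + Real.exp (μ P) * A P * q (T P, Y P) * hξ' P hP
      - Real.exp (μ P) * (μz P * h (T P, Y P) + A P * q (T P, Y P)) * hφ P hP
      - Real.exp (μ P) * h (T P, Y P) * hφ' P hP
      + Real.exp (μ P) * (a₁' + a₂' * P.1 + a₃' * P.1 ^ 2) * q (T P, Y P) * hA' P hP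
      + Real.exp (μ P) * (a₁' + a₂' * P.1 + a₃' * P.1 ^ 2) * h (T P, Y P) * hμzs P hP

/-- Similarity variables for the generator with coefficients `a`, `b`, `c` on `U`: on functions
`exp μ · f(z)` the heat equation becomes `f'' = Q f`. The functions
`μt`, `μy`, `μyt`, `μyy` are the partial derivatives of `μ`, and `A = z_y`. -/
structure IsSimilarity (a₁ a₂ a₃ b₀ b₁ c : ℝ) (Q : ℝ → ℝ) (U : Set (ℝ × ℝ))
    (z μ A μt μy μyt μyy : ℝ × ℝ → ℝ) : Prop where
  grad_A : ∀ P ∈ U, HasGrad A (μyy P * A P) 0 P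
  A_ne_zero : ∀ P ∈ U, A P ≠ 0
  grad_z : ∀ P ∈ U, HasGrad z (μy P * A P) (A P) P
  grad_μ : ∀ P ∈ U, HasGrad μ (μt P) (μy P) P
  grad_μy : ∀ P ∈ U, HasGrad μy (μyt P) (μyy P) P
  contDiff_z : ∀ P ∈ U, ContDiffAt ℝ 2 z P
  contDiff_μ : ∀ P ∈ U, ContDiffAt ℝ 2 μ P
  τ_ne_zero : ∀ P ∈ U, a₁ + a₂ * P.1 + a₃ * P.1 ^ 2 ≠ 0
  ξ_eq : ∀ P ∈ U, (a₂ / 2 + a₃ * P.1) * P.2 + b₀ + b₁ * P.1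
    = -((a₁ + a₂ * P.1 + a₃ * P.1 ^ 2) * μy P)
  ξy_eq : ∀ P ∈ U, a₂ / 2 + a₃ * P.1 = -((a₁ + a₂ * P.1 + a₃ * P.1 ^ 2) * μyy P)
  φ_eq : ∀ P ∈ U, c - b₁ * P.2 - a₃ * (P.2 ^ 2 + P.1) / 2
    = (a₁ + a₂ * P.1 + a₃ * P.1 ^ 2) * (μt P - μy P ^ 2)
  φy_eq : ∀ P ∈ U, -b₁ - a₃ * P.2
    = (a₁ + a₂ * P.1 + a₃ * P.1 ^ 2) * (μyt P - 2 * μy P * μyy P)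
  Q_eq : ∀ P ∈ U, A P ^ 2 * Q (z P) = 2 * μt P - μyy P - μy P ^ 2

section IsSimilarity
variable {a₁ a₂ a₃ b₀ b₁ c : ℝ} {Q : ℝ → ℝ} {U Ω : Set (ℝ × ℝ)}
  {z μ A μt μy μyt μyy : ℝ × ℝ → ℝ} {h : ℝ × ℝ → ℝ}

/-- Let F = e^{-μ} h. Its derivative along z is e^{-μ}(h_y - μ_y h)/A, and the Wronskian of F with a
solution f of f'' = Qf has zero gradient. Cramer's rule with f₁, f₂ then recovers F. -/
lemma HeatInv.eq_fundamental (H : HeatInv a₁ a₂ a₃ b₀ b₁ c Ω h)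
    (ho : IsOpen Ω) (hc : IsConnected Ω)
    (S : IsSimilarity a₁ a₂ a₃ b₀ b₁ c Q U z μ A μt μy μyt μyy) (hU : Ω ⊆ U)
    {f₁ f₁' f₂ f₂' : ℝ → ℝ} (hf : IsFundamental Q f₁ f₁' f₂ f₂') :
    ∃ c₁ c₂ : ℝ, ∀ P ∈ Ω, h P = Real.exp (μ P) * (c₁ * f₁ (z P) + c₂ * f₂ (z P)) := by
  obtain ⟨q, r, s, H⟩ := H
  obtain ⟨w, hw, hW⟩ := hf.wronskian
  have key : ∀ f f' : ℝ → ℝ, (∀ z, HasDerivAt f (f' z) z) → (∀ z, HasDerivAt f' (Q z * f z) z) →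
      ∃ k, ∀ P ∈ Ω, Real.exp (-μ P) *
        (h P * f' (z P) - (q P - μy P * h P) * (A P)⁻¹ * f (z P)) = k := by
    intro f f' hf hf'
    refine HasGrad.exists_const ho hc fun P hP => ?_
    obtain ⟨h1, h2, h3, h4⟩ := H P hP
    have e := (S.grad_μ P (hU hP)).neg.exp
    have kz := HasGrad.comp (hf (z P)) (S.grad_z P (hU hP))
    have kz' := HasGrad.comp (hf' (z P)) (S.grad_z P (hU hP))
    have kA := HasGrad.comp (hasDerivAt_inv (S.A_ne_zero P (hU hP))) (S.grad_A P (hU hP))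
    -- As τ ≠ 0, invariance and its y-derivative can be solved for h_yy and h_ty, so no derivative
    -- of h beyond the second is needed.
    have hr : r P = 2 * (μt P - μy P ^ 2) * h P + 2 * μy P * q P := by
      apply mul_left_cancel₀ (S.τ_ne_zero P (hU hP))
      linear_combination 2 * h3 - 2 * q P * S.ξ_eq P (hU hP) + 2 * h P * S.φ_eq P (hU hP)
    have hs : s P = (μt P - μy P ^ 2) * q P + (μyt P - 2 * μy P * μyy P) * h P
        + μy P * r P + μyy P * q P := by
      apply mul_left_cancel₀ (S.τ_ne_zero P (hU hP))
      linear_combination h4 - r P * S.ξ_eq P (hU hP) - q P * S.ξy_eq P (hU hP) + q P * S.φ_eq P (hU hP) + h P * S.φy_eq P (hU hP)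
    have a0 := S.A_ne_zero P (hU hP)
    have hQ' : Q (z P) = (2 * μt P - μyy P - μy P ^ 2) / A P ^ 2 := by
      rw [← S.Q_eq P (hU hP)]; field_simp
    refine (e.mul ((h1.mul kz').sub (((h2.sub ((S.grad_μy P (hU hP)).mul h1)).mul kA).mul kz))).congr_grad
      ?_ ?_
    · rw [hs, hQ', hr]; field_simp; ring
    · rw [hQ', hr]; field_simp; ring
  obtain ⟨k₁, hk₁⟩ := key f₂ f₂' hf.deriv₂ hf.deriv₂'
  obtain ⟨k₂, hk₂⟩ := key f₁ f₁' hf.deriv₁ hf.deriv₁'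
  -- For F = c₁f₁ + c₂f₂ the constants are k₁ = c₁w (Wronskian with f₂) and k₂ = -c₂w (with f₁).
  refine ⟨k₁ / w, -(k₂ / w), fun P hP => ?_⟩
  have he : Real.exp (μ P) * Real.exp (-μ P) = 1 := by rw [← Real.exp_add]; simp
  apply mul_left_cancel₀ hw
  calc w * h P = Real.exp (μ P) * (k₁ * f₁ (z P) - k₂ * f₂ (z P)) := by
        rw [← hk₁ P hP, ← hk₂ P hP]
        linear_combination -h P * hW (z P)
          - h P * (f₁ (z P) * f₂' (z P) - f₁' (z P) * f₂ (z P)) * he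
    _ = _ := by field_simp; ring

/-- The function `exp μ · f(z)`, where `f'' = Q f`, solves the heat equation and is invariant. -/
lemma IsSimilarity.hasGrad (S : IsSimilarity a₁ a₂ a₃ b₀ b₁ c Q U z μ A μt μy μyt μyy)
    {f f' : ℝ → ℝ}
    (hf : ∀ z, HasDerivAt f (f' z) z) (hf' : ∀ z, HasDerivAt f' (Q z * f z) z) :
    ∃ q r : ℝ × ℝ → ℝ, ∀ P ∈ U,
      HasGrad (fun P => Real.exp (μ P) * f (z P)) (r P / 2) (q P) P ∧
      (∃ s, HasGrad q s (r P) P) ∧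
      (a₁ + a₂ * P.1 + a₃ * P.1 ^ 2) * (r P / 2)
          + ((a₂ / 2 + a₃ * P.1) * P.2 + b₀ + b₁ * P.1) * q P
        = (c - b₁ * P.2 - a₃ * (P.2 ^ 2 + P.1) / 2) * (Real.exp (μ P) * f (z P)) := by
  refine ⟨fun P => Real.exp (μ P) * (μy P * f (z P) + A P * f' (z P)),
    fun P => Real.exp (μ P) * (2 * μt P * f (z P) + 2 * μy P * A P * f' (z P)),
    fun P hP => ?_⟩
  have kf := HasGrad.comp (hf (z P)) (S.grad_z P hP)
  have kf' := HasGrad.comp (hf' (z P)) (S.grad_z P hP)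
  have e := (S.grad_μ P hP).exp
  have k := e.mul (((S.grad_μy P hP).mul kf).add ((S.grad_A P hP).mul kf'))
  refine ⟨(e.mul kf).congr_grad (by ring) (by ring), ⟨_, k.congr_grad rfl ?_⟩, ?_⟩
  · linear_combination Real.exp (μ P) * f (z P) * S.Q_eq P hP
  · linear_combination Real.exp (μ P) * (μy P * f (z P) + A P * f' (z P)) * S.ξ_eq P hP
      - Real.exp (μ P) * f (z P) * S.φ_eq P hP

end IsSimilarity

/-! ### Reduction to the heat equation -/

/-- The general element of the symmetry algebra. -/
def genField (σ k a₁ a₂ a₃ a₄ a₅ a₆ : ℝ) : VField :=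
  a₁ • V1 + a₂ • V2 σ k + a₃ • V3 σ k + a₄ • V4 σ k + a₅ • V5 σ k + a₆ • V6

lemma genField_apply (σ k a₁ a₂ a₃ a₄ a₅ a₆ t x u : ℝ) :
    genField σ k a₁ a₂ a₃ a₄ a₅ a₆ (t, x, u) =
      (a₁ + a₂ * t + a₃ * t ^ 2,
        (a₂ / 2 + a₃ * t) * x * Real.log x + (a₄ + a₅ * t) * x,
        (a₂ * (k / (2 * σ ^ 2) * x * Real.log x + 1 / 4 * Real.log x - σ ^ 2 / 8 * t)
          + a₃ * (k / σ ^ 2 * t * x * Real.log x - 1 / (2 * σ ^ 2) * Real.log x ^ 2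
            + 1 / 2 * t * Real.log x - σ ^ 2 / 8 * t ^ 2 - 1 / 2 * t)
          + a₄ * (k / σ ^ 2 * x)
          + a₅ * (k / σ ^ 2 * t * x - 1 / σ ^ 2 * Real.log x + 1 / 2 * t) + a₆) * u) := by
  simp only [genField, V1, V2, V3, V4, V5, V6, Pi.add_apply, Pi.smul_apply, Prod.smul_mk,
    Prod.mk_add_mk, smul_eq_mul, Prod.mk.injEq]
  refine ⟨by ring, by ring, by ring⟩

/-- The factor `x^{1/2} e^{k x / σ² - σ² t / 8}` relating the equation to the heat equation. -/
def weight (σ k t x : ℝ) : ℝ := Real.exp (1 / 2 * Real.log x + k / σ ^ 2 * x - σ ^ 2 / 8 * t)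

lemma weight_pos (σ k t x : ℝ) : 0 < weight σ k t x := Real.exp_pos _

/-- The domain `Ω` in the coordinates `(t, y)`, `y = ln x / σ`. -/
def heatDomain (σ : ℝ) (Ω : Set (ℝ × ℝ)) : Set (ℝ × ℝ) := {P | (P.1, Real.exp (σ * P.2)) ∈ Ω}

section
variable {σ k : ℝ} {Ω : Set (ℝ × ℝ)}

lemma isOpen_heatDomain (ho : IsOpen Ω) : IsOpen (heatDomain σ Ω) :=
  ho.preimage (by fun_prop)

lemma mem_heatDomain (hσ : 0 < σ) {t x : ℝ} (hx : 0 < x) :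
    (t, Real.log x / σ) ∈ heatDomain σ Ω ↔ (t, x) ∈ Ω := by
  simp only [heatDomain, Set.mem_ofPred_eq]
  rw [mul_div_cancel₀ _ hσ.ne', Real.exp_log hx]

lemma isConnected_heatDomain (hσ : 0 < σ) (hc : IsConnected Ω) (hΩ : Ω ⊆ halfPlane) :
    IsConnected (heatDomain σ Ω) := by
  have h : heatDomain σ Ω = (fun P : ℝ × ℝ => (P.1, Real.log P.2 / σ)) '' Ω := by
    ext ⟨t, y⟩
    constructor
    · intro h
      exact ⟨_, h, by simp [hσ.ne']⟩
    · rintro ⟨⟨t', x⟩, h, e⟩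
      simp only [Prod.mk.injEq] at e
      obtain ⟨rfl, rfl⟩ := e
      exact (mem_heatDomain hσ (hΩ h)).2 h
  rw [h]
  refine hc.image _ fun P hP => ContinuousAt.continuousWithinAt ?_
  have : P.2 ≠ 0 := (hΩ hP).ne'
  fun_prop (disch := assumption)

/-- The functions p = h_t and r = h_yy stay unrelated here, so that the heat equation can appear as
a conclusion in `isInvariantSolution_weight_iff`. -/
lemma HasGrad.deriv_weight_mul {h q : ℝ × ℝ → ℝ} {u : ℝ → ℝ → ℝ} {p r : ℝ × ℝ → ℝ}
    (hσ : 0 < σ) (ho : IsOpen Ω) (hΩ : Ω ⊆ halfPlane)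
    (hu : ∀ t x, (t, x) ∈ Ω → u t x = weight σ k t x * h (t, Real.log x / σ))
    (hh : ∀ P ∈ heatDomain σ Ω, HasGrad h (p P) (q P) P)
    (hq : ∀ P ∈ heatDomain σ Ω, ∃ s, HasGrad q s (r P) P) {t x : ℝ} (hx : (t, x) ∈ Ω) :
    deriv (fun s => u s x) t = weight σ k t x *
      (p (t, Real.log x / σ) - σ ^ 2 / 8 * h (t, Real.log x / σ)) ∧
    deriv (u t) x = weight σ k t x *
      ((1 / 2 * x⁻¹ + k / σ ^ 2) * h (t, Real.log x / σ) + q (t, Real.log x / σ) * (x⁻¹ / σ)) ∧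
    deriv (deriv (u t)) x = weight σ k t x *
      ((1 / 2 * x⁻¹ + k / σ ^ 2) ^ 2 * h (t, Real.log x / σ)
        + 2 * (1 / 2 * x⁻¹ + k / σ ^ 2) * (x⁻¹ / σ) * q (t, Real.log x / σ)
        + (x⁻¹ / σ) ^ 2 * r (t, Real.log x / σ)
        - 1 / 2 * x⁻¹ ^ 2 * h (t, Real.log x / σ) - x⁻¹ ^ 2 / σ * q (t, Real.log x / σ)) := by
  have hx0 : ∀ {s y}, (s, y) ∈ Ω → 0 < y := fun h => hΩ h
  have hw : ∀ {y}, 0 < y → HasDerivAt (fun y => weight σ k t y)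
      (weight σ k t y * (1 / 2 * y⁻¹ + k / σ ^ 2)) y := fun {y} hy => by
    have := ((((Real.hasDerivAt_log hy.ne').const_mul (1 / 2)).add
      ((hasDerivAt_id y).const_mul (k / σ ^ 2))).sub_const (σ ^ 2 / 8 * t)).exp
    exact this.congr_deriv (by simp [weight])
  have hl : ∀ {y}, 0 < y → HasDerivAt (fun y => Real.log y / σ) (y⁻¹ / σ) y :=
    fun {y} hy => (Real.hasDerivAt_log hy.ne').div_const σ
  have hd : ∀ {y}, (t, y) ∈ Ω → HasDerivAt (u t) (weight σ k t y *
      ((1 / 2 * y⁻¹ + k / σ ^ 2) * h (t, Real.log y / σ)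
        + q (t, Real.log y / σ) * (y⁻¹ / σ))) y := fun {y} hy => by
    have h1 := (hh _ ((mem_heatDomain hσ (hx0 hy)).2 hy)).hasDerivAt_snd
    have h2 := (hw (hx0 hy)).mul (HasDerivAt.comp y h1 (hl (hx0 hy)))
    refine (h2.congr_deriv ?_).congr_of_eventuallyEq ?_
    · simp only [Function.comp]; ring
    · have : ∀ᶠ y' in nhds y, (t, y') ∈ Ω :=
        (continuous_const.prodMk continuous_id).continuousAt.preimage_mem_nhds (ho.mem_nhds hy)
      filter_upwards [this] with y' hy'
      exact hu t y' hy'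
  refine ⟨?_, (hd hx).deriv, ?_⟩
  · have h1 := (hh _ ((mem_heatDomain hσ (hx0 hx)).2 hx)).hasDerivAt_fst
    have h2 : HasDerivAt (fun s => weight σ k s x) (weight σ k t x * -(σ ^ 2 / 8)) t := by
      have := (((hasDerivAt_id t).const_mul (σ ^ 2 / 8)).const_sub
        (1 / 2 * Real.log x + k / σ ^ 2 * x)).exp
      exact this.congr_deriv (by simp [weight])
    refine HasDerivAt.deriv (((h2.mul h1).congr_deriv ?_).congr_of_eventuallyEq ?_)
    · ring
    · have : ∀ᶠ t' in nhds t, (t', x) ∈ Ω :=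
        (continuous_id.prodMk continuous_const).continuousAt.preimage_mem_nhds (ho.mem_nhds hx)
      filter_upwards [this] with t' ht'
      exact hu t' x ht'
  · have hP := (mem_heatDomain hσ (hx0 hx)).2 hx
    obtain ⟨s, hs⟩ := hq _ hP
    have x0 := (hx0 hx).ne'
    have k1 := HasDerivAt.comp x (hh _ hP).hasDerivAt_snd (hl (hx0 hx))
    have k2 := HasDerivAt.comp x hs.hasDerivAt_snd (hl (hx0 hx))
    have k3 := (hasDerivAt_inv x0)
    have k4 := (hw (hx0 hx)).mul ((((k3.const_mul (1 / 2)).add_const (k / σ ^ 2)).mul k1).add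
      (k2.mul (k3.div_const σ)))
    refine HasDerivAt.deriv ((k4.congr_deriv ?_).congr_of_eventuallyEq ?_)
    · simp only [Function.comp, Pi.add_apply, Pi.mul_apply]
      rw [inv_pow]
      ring
    · have : ∀ᶠ y' in nhds x, (t, y') ∈ Ω :=
        (continuous_const.prodMk continuous_id).continuousAt.preimage_mem_nhds (ho.mem_nhds hx)
      filter_upwards [this] with y' hy'
      exact (hd hy').deriv

variable {a₁ a₂ a₃ a₄ a₅ a₆ : ℝ}

/-- A function of the form `weight · h(t, ln x / σ)` is an invariant solution if and only if `h`
is one for the heat equation. -/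
lemma isInvariantSolution_weight_iff {h q p r : ℝ × ℝ → ℝ} {u : ℝ → ℝ → ℝ}
    (hσ : 0 < σ) (ho : IsOpen Ω) (hΩ : Ω ⊆ halfPlane)
    (hu : ∀ t x, (t, x) ∈ Ω → u t x = weight σ k t x * h (t, Real.log x / σ))
    (hh : ∀ P ∈ heatDomain σ Ω, HasGrad h (p P) (q P) P)
    (hq : ∀ P ∈ heatDomain σ Ω, ∃ s, HasGrad q s (r P) P)
    (hC : ContDiffOn ℝ 2 (Function.uncurry u) Ω) :
    IsInvariantSolution σ k (genField σ k a₁ a₂ a₃ a₄ a₅ a₆) Ω u ↔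
      ∀ P ∈ heatDomain σ Ω, p P = r P / 2 ∧
        (a₁ + a₂ * P.1 + a₃ * P.1 ^ 2) * p P
            + ((a₂ / 2 + a₃ * P.1) * P.2 + a₄ / σ + a₅ / σ * P.1) * q P
          = (a₁ * σ ^ 2 / 8 - a₄ / 2 + a₆ - a₅ / σ * P.2 - a₃ * (P.2 ^ 2 + P.1) / 2) * h P := by
  have e1 : ∀ t x, (t, x) ∈ Ω → ((deriv (fun s => u s x) t =
      1 / 2 * σ ^ 2 * x ^ 2 * deriv (deriv (u t)) x + k * x * (0 - x) * deriv (u t) x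
        + k ^ 2 / (2 * σ ^ 2) * x ^ 2 * u t x) ↔
      p (t, Real.log x / σ) = r (t, Real.log x / σ) / 2) := fun t x hx => by
    obtain ⟨d1, d2, d3⟩ := HasGrad.deriv_weight_mul hσ ho hΩ hu hh hq hx
    have x0 : x ≠ 0 := (hΩ hx : 0 < x).ne'
    have w0 := (weight_pos σ k t x).ne'
    rw [d1, d2, d3, hu t x hx]
    -- The weight is chosen for this cancellation: with α = 0 and λ = k²/(2σ²) all terms with k drop
    -- out. The remaining -σ²/8 · h matches the one produced by u_t.
    have e : 1 / 2 * σ ^ 2 * x ^ 2 * (weight σ k t x *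
      ((1 / 2 * x⁻¹ + k / σ ^ 2) ^ 2 * h (t, Real.log x / σ)
        + 2 * (1 / 2 * x⁻¹ + k / σ ^ 2) * (x⁻¹ / σ) * q (t, Real.log x / σ)
        + (x⁻¹ / σ) ^ 2 * r (t, Real.log x / σ)
        - 1 / 2 * x⁻¹ ^ 2 * h (t, Real.log x / σ) - x⁻¹ ^ 2 / σ * q (t, Real.log x / σ)))
        + k * x * (0 - x) * (weight σ k t x * ((1 / 2 * x⁻¹ + k / σ ^ 2) *
          h (t, Real.log x / σ) + q (t, Real.log x / σ) * (x⁻¹ / σ)))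
        + k ^ 2 / (2 * σ ^ 2) * x ^ 2 * (weight σ k t x * h (t, Real.log x / σ))
        = weight σ k t x * (r (t, Real.log x / σ) / 2 - σ ^ 2 / 8 * h (t, Real.log x / σ)) := by
      field_simp
      ring
    rw [e, mul_right_inj' w0, sub_left_inj]
  have e2 : ∀ t x, (t, x) ∈ Ω →
      ((genField σ k a₁ a₂ a₃ a₄ a₅ a₆ (t, x, u t x)).2.2 =
        (genField σ k a₁ a₂ a₃ a₄ a₅ a₆ (t, x, u t x)).1 * deriv (fun s => u s x) t
          + (genField σ k a₁ a₂ a₃ a₄ a₅ a₆ (t, x, u t x)).2.1 * deriv (u t) x ↔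
        (a₁ + a₂ * t + a₃ * t ^ 2) * p (t, Real.log x / σ)
            + ((a₂ / 2 + a₃ * t) * (Real.log x / σ) + a₄ / σ + a₅ / σ * t)
              * q (t, Real.log x / σ)
          = (a₁ * σ ^ 2 / 8 - a₄ / 2 + a₆ - a₅ / σ * (Real.log x / σ)
            - a₃ * ((Real.log x / σ) ^ 2 + t) / 2) * h (t, Real.log x / σ)) := fun t x hx => by
    obtain ⟨d1, d2, d3⟩ := HasGrad.deriv_weight_mul hσ ho hΩ hu hh hq hx
    have x0 : x ≠ 0 := (hΩ hx : 0 < x).ne'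
    have w0 := (weight_pos σ k t x).ne'
    rw [d1, d2, genField_apply, hu t x hx]
    generalize Real.log x = l
    simp only
    -- Both equations are written as "expression = 0", the second multiplied by the nonzero weight;
    -- the two expressions then coincide.
    rw [eq_comm, ← sub_eq_zero, ← mul_right_inj' w0 (b := _ + _),
      ← sub_eq_zero (a := weight σ k t x * _)]
    refine iff_of_eq (congrArg (· = 0) ?_)
    field_simp
    ring
  constructor
  · rintro ⟨⟨-, h1⟩, h2⟩ ⟨t, y⟩ hP
    have hP' : (t, Real.exp (σ * y)) ∈ Ω := hP
    have hy : Real.log (Real.exp (σ * y)) / σ = y := by rw [Real.log_exp]; field_simp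
    have k1 := (e1 _ _ hP').1 (h1 _ _ hP')
    have k2 := (e2 _ _ hP').1 (h2 _ _ hP')
    rw [hy] at k1 k2
    exact ⟨k1, k2⟩
  · intro H
    refine ⟨⟨hC, fun t x hx => (e1 t x hx).2 ?_⟩, fun t x hx => (e2 t x hx).2 ?_⟩
    · exact (H _ ((mem_heatDomain hσ (hΩ hx)).2 hx)).1
    · exact (H _ ((mem_heatDomain hσ (hΩ hx)).2 hx)).2

/-- The heat solution belonging to `u`. -/
def heatFun (σ k : ℝ) (u : ℝ → ℝ → ℝ) (P : ℝ × ℝ) : ℝ :=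
  u P.1 (Real.exp (σ * P.2)) / weight σ k P.1 (Real.exp (σ * P.2))

lemma weight_mul_heatFun (hσ : 0 < σ) (u : ℝ → ℝ → ℝ) {t x : ℝ} (hx : 0 < x) :
    weight σ k t x * heatFun σ k u (t, Real.log x / σ) = u t x := by
  simp only [heatFun]
  rw [mul_div_cancel₀ _ hσ.ne', Real.exp_log hx, mul_div_cancel₀ _ (weight_pos σ k t x).ne']

lemma exists_hasGrad {f : ℝ × ℝ → ℝ} {P : ℝ × ℝ} (hf : DifferentiableAt ℝ f P) :
    HasGrad f (fderiv ℝ f P (1, 0)) (fderiv ℝ f P (0, 1)) P :=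
  hf.hasFDerivAt.congr_fderiv (by ext <;> simp)

lemma IsInvariantSolution.heatInv {u : ℝ → ℝ → ℝ}
    (H : IsInvariantSolution σ k (genField σ k a₁ a₂ a₃ a₄ a₅ a₆) Ω u)
    (hσ : 0 < σ) (ho : IsOpen Ω) (hΩ : Ω ⊆ halfPlane) :
    HeatInv a₁ a₂ a₃ (a₄ / σ) (a₅ / σ) (a₁ * σ ^ 2 / 8 - a₄ / 2 + a₆) (heatDomain σ Ω)
      (heatFun σ k u) := by
  have hC := H.1.1
  have hO := isOpen_heatDomain (σ := σ) ho
  set h := heatFun σ k u with hh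
  have hC2 : ∀ P ∈ heatDomain σ Ω, ContDiffAt ℝ 2 h P := fun P hP => by
    have h1 : ContDiffAt ℝ 2 (Function.uncurry u) (P.1, Real.exp (σ * P.2)) :=
      hC.contDiffAt (ho.mem_nhds hP)
    have h2 : ContDiffAt ℝ 2 (fun P : ℝ × ℝ => (P.1, Real.exp (σ * P.2))) P := by fun_prop
    have h3 : ContDiffAt ℝ 2 (fun P : ℝ × ℝ => weight σ k P.1 (Real.exp (σ * P.2))) P := by
      simp only [weight, Real.log_exp]; fun_prop
    exact (h1.comp P h2).div h3 (weight_pos _ _ _ _).ne'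
  have hD : ∀ P ∈ heatDomain σ Ω, ContDiffAt ℝ 1 (fderiv ℝ h) P := fun P hP =>
    (hC2 P hP).fderiv_right (by norm_num)
  have g0 : ∀ P ∈ heatDomain σ Ω, HasGrad h (fderiv ℝ h P (1, 0)) (fderiv ℝ h P (0, 1)) P :=
    fun P hP => exists_hasGrad ((hC2 P hP).differentiableAt (by norm_num))
  have gv : ∀ v : ℝ × ℝ, ∀ P ∈ heatDomain σ Ω, HasGrad (fun P => fderiv ℝ h P v)
      (fderiv ℝ (fderiv ℝ h) P (1, 0) v) (fderiv ℝ (fderiv ℝ h) P (0, 1) v) P := fun v P hP => by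
    have hd := ((hD P hP).differentiableAt (by norm_num)).hasFDerivAt
    exact (hd.clm_apply (hasFDerivAt_const v P)).congr_fderiv (by ext <;> simp)
  -- Symmetry of second derivatives identifies ∂_y h_t with ∂_t h_y.
  have hsymm : ∀ P ∈ heatDomain σ Ω,
      fderiv ℝ (fderiv ℝ h) P (1, 0) (0, 1) = fderiv ℝ (fderiv ℝ h) P (0, 1) (1, 0) :=
    fun P hP => ((hC2 P hP).isSymmSndFDerivAt (by simp)).eq _ _
  have key := (isInvariantSolution_weight_iff (k := k) (u := u) (h := h) hσ ho hΩ
    (fun t x hx => (weight_mul_heatFun hσ u (hΩ hx)).symm) g0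
    (fun P hP => ⟨_, gv (0, 1) P hP⟩) hC).1 H
  refine ⟨fun P => fderiv ℝ h P (0, 1), fun P => fderiv ℝ (fderiv ℝ h) P (0, 1) (0, 1),
    fun P => fderiv ℝ (fderiv ℝ h) P (1, 0) (0, 1), fun P hP => ?_⟩
  obtain ⟨k1, k2⟩ := key P hP
  refine ⟨(g0 P hP).congr_grad k1 rfl, gv (0, 1) P hP, by rw [← k1, k2], ?_⟩
  obtain ⟨t, y⟩ := P
  -- The invariance identity holds on an open set, so it may be differentiated in y: `l1` and `l2`
  -- differentiate its two sides, and uniqueness of derivatives equates them.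
  have l1 := (((gv (1, 0) _ hP).hasDerivAt_snd).const_mul (a₁ + a₂ * t + a₃ * t ^ 2)).add
    ((((((hasDerivAt_id y).const_mul (a₂ / 2 + a₃ * t)).add_const (a₄ / σ)).add_const
      (a₅ / σ * t))).mul (gv (0, 1) _ hP).hasDerivAt_snd)
  have l2 := ((((hasDerivAt_id y).const_mul (a₅ / σ)).const_sub
    (a₁ * σ ^ 2 / 8 - a₄ / 2 + a₆)).sub
      (((((hasDerivAt_id y).pow 2).add_const t).const_mul a₃).div_const 2)).mul
        (g0 _ hP).hasDerivAt_snd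
  have l3 := l2.congr_of_eventuallyEq (f₁ := _) (by
    have : ∀ᶠ y' in nhds y, (t, y') ∈ heatDomain σ Ω :=
      (continuous_const.prodMk continuous_id).continuousAt.preimage_mem_nhds (hO.mem_nhds hP)
    filter_upwards [this] with y' hy'
    exact (key _ hy').2)
  have l4 := l1.unique l3
  simp only [id, Pi.sub_apply, Pi.pow_apply, hsymm _ hP] at l4 ⊢
  linear_combination l4

end

/-! ### The explicit invariant solutions -/

section
variable {σ k : ℝ} {Ω : Set (ℝ × ℝ)}

lemma contDiffOn_weight_mul {h : ℝ × ℝ → ℝ} {u : ℝ → ℝ → ℝ} (hσ : 0 < σ) (hΩ : Ω ⊆ halfPlane)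
    (hu : ∀ t x, (t, x) ∈ Ω → u t x = weight σ k t x * h (t, Real.log x / σ))
    (hh : ∀ P ∈ heatDomain σ Ω, ContDiffAt ℝ 2 h P) :
    ContDiffOn ℝ 2 (Function.uncurry u) Ω := by
  have h1 : ContDiffOn ℝ 2
      (fun P : ℝ × ℝ => weight σ k P.1 P.2 * h (P.1, Real.log P.2 / σ)) Ω := fun P hP => by
    have x0 : P.2 ≠ 0 := (hΩ hP : 0 < P.2).ne'
    have h2 : ContDiffAt ℝ 2 (fun P : ℝ × ℝ => (P.1, Real.log P.2 / σ)) P := by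
      fun_prop (disch := assumption)
    have h3 : ContDiffAt ℝ 2 (fun P : ℝ × ℝ => weight σ k P.1 P.2) P := by
      simp only [weight]; fun_prop (disch := assumption)
    have h4 := (hh _ ((mem_heatDomain hσ (hΩ hP)).2 hP)).comp P h2
    exact (h3.mul h4).contDiffWithinAt
  exact h1.congr fun P hP => hu P.1 P.2 hP

variable {a₁ a₂ a₃ a₄ a₅ a₆ b₀ b₁ c : ℝ}

/-- Common source of the characterisations for the listed generators with τ ≠ 0. The heat
coefficients are tied to a₄, a₅, a₆ by equations, so that each application can present them in
simplified form. -/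
lemma isInvariantSolution_iff_of_isSimilarity {Q : ℝ → ℝ} {U : Set (ℝ × ℝ)}
    {z μ A μt μy μyt μyy : ℝ × ℝ → ℝ} {f₁ f₁' f₂ f₂' : ℝ → ℝ} {v : ℝ → ℝ → ℝ → ℝ → ℝ}
    (hσ : 0 < σ) (ho : IsOpen Ω) (hc : IsConnected Ω) (hΩ : Ω ⊆ halfPlane)
    (S : IsSimilarity a₁ a₂ a₃ b₀ b₁ c Q U z μ A μt μy μyt μyy) (hb₀ : a₄ / σ = b₀)
    (hb₁ : a₅ / σ = b₁) (hc' : a₁ * σ ^ 2 / 8 - a₄ / 2 + a₆ = c) (hf : IsFundamental Q f₁ f₁' f₂ f₂') (hU : heatDomain σ Ω ⊆ U)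
    (hv : ∀ c₁ c₂ t x, (t, x) ∈ Ω → v c₁ c₂ t x = weight σ k t x *
      (Real.exp (μ (t, Real.log x / σ)) * (c₁ * f₁ (z (t, Real.log x / σ))
        + c₂ * f₂ (z (t, Real.log x / σ))))) (u : ℝ → ℝ → ℝ) :
    IsInvariantSolution σ k (genField σ k a₁ a₂ a₃ a₄ a₅ a₆) Ω u ↔
      ∃ c₁ c₂, AgreesOn Ω u (v c₁ c₂) := by
  subst hb₀ hb₁ hc'
  constructor
  · intro H
    obtain ⟨c₁, c₂, h⟩ := (H.heatInv hσ ho hΩ).eq_fundamental (isOpen_heatDomain ho)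
      (isConnected_heatDomain hσ hc hΩ) S hU hf
    refine ⟨c₁, c₂, fun t x hx => ?_⟩
    rw [hv c₁ c₂ t x hx, ← weight_mul_heatFun (k := k) hσ u (hΩ hx),
      h _ ((mem_heatDomain hσ (hΩ hx)).2 hx)]
  · rintro ⟨c₁, c₂, h⟩
    have hu := fun t x hx => (h t x hx).trans (hv c₁ c₂ t x hx)
    obtain ⟨q, r, hqr⟩ := S.hasGrad (f := fun z => c₁ * f₁ z + c₂ * f₂ z)
      (f' := fun z => c₁ * f₁' z + c₂ * f₂' z)
      (fun z => ((hf.deriv₁ z).const_mul c₁).add ((hf.deriv₂ z).const_mul c₂))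
      (fun z => (((hf.deriv₁' z).const_mul c₁).add ((hf.deriv₂' z).const_mul c₂)).congr_deriv
        (by ring))
    refine (isInvariantSolution_weight_iff
      (h := fun P => Real.exp (μ P) * (c₁ * f₁ (z P) + c₂ * f₂ (z P))) hσ ho hΩ hu (p := fun P => r P / 2) (q := q) (r := r)
      (fun P hP => (hqr P (hU hP)).1) (fun P hP => (hqr P (hU hP)).2.1)
      (contDiffOn_weight_mul (h := fun P => Real.exp (μ P) * (c₁ * f₁ (z P) + c₂ * f₂ (z P)))
        hσ hΩ hu fun P hP => ?_)).2
      fun P hP => ⟨rfl, (hqr P (hU hP)).2.2⟩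
    have k1 := hf.contDiff₁.contDiffAt.comp P (S.contDiff_z P (hU hP))
    have k2 := hf.contDiff₂.contDiffAt.comp P (S.contDiff_z P (hU hP))
    exact (S.contDiff_μ P (hU hP)).exp.mul
      ((contDiffAt_const.mul k1).add (contDiffAt_const.mul k2))

end

/-! ### Similarity variables of the normal forms -/

lemma isSimilarity_scaling (a : ℝ) :
    IsSimilarity 0 1 0 0 0 a (fun z => (2 * a + 1 / 2) + 1 / 4 * z ^ 2) {P | 0 < P.1}
      (fun P => P.1 ^ (-(1 / 2) : ℝ) * P.2)
      (fun P => a * Real.log P.1 - 1 / 4 * P.1⁻¹ * P.2 ^ 2)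
      (fun P => P.1 ^ (-(1 / 2) : ℝ))
      (fun P => a * P.1⁻¹ + 1 / 4 * P.1⁻¹ ^ 2 * P.2 ^ 2) (fun P => -(1 / 2 * P.1⁻¹ * P.2))
      (fun P => 1 / 2 * P.1⁻¹ ^ 2 * P.2) (fun P => -(1 / 2 * P.1⁻¹)) := by
  have hpow : ∀ {t : ℝ}, 0 < t → t ^ (-(1 / 2) - 1 : ℝ) = t⁻¹ * t ^ (-(1 / 2) : ℝ) :=
    fun {t} ht => by rw [Real.rpow_sub_one ht.ne', div_eq_inv_mul]
  have hsq : ∀ {t : ℝ}, 0 < t → (t ^ (-(1 / 2) : ℝ)) ^ 2 = t⁻¹ := fun {t} ht => by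
    rw [← Real.rpow_natCast, ← Real.rpow_mul ht.le]
    norm_num [Real.rpow_neg_one]
  have gA : ∀ P : ℝ × ℝ, 0 < P.1 → HasGrad (fun P => P.1 ^ (-(1 / 2) : ℝ))
      (-(1 / 2 * P.1⁻¹) * P.1 ^ (-(1 / 2) : ℝ)) 0 P := fun P hP => by
    refine (HasGrad.of_fst (φ := fun t => t ^ (-(1 / 2) : ℝ))
      (Real.hasDerivAt_rpow_const (Or.inl hP.ne'))).congr_grad ?_ rfl
    rw [hpow hP]; ring
  have gi : ∀ P : ℝ × ℝ, 0 < P.1 → HasGrad (fun P => P.1⁻¹) (-(P.1⁻¹ ^ 2)) 0 P := fun P hP =>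
    (HasGrad.of_fst (φ := fun t => t⁻¹) (hasDerivAt_inv hP.ne')).congr_grad (by rw [inv_pow]) rfl
  have gl : ∀ P : ℝ × ℝ, 0 < P.1 → HasGrad (fun P => Real.log P.1) (P.1⁻¹) 0 P := fun P hP =>
    HasGrad.of_fst (Real.hasDerivAt_log hP.ne')
  constructor <;> intro P hP <;> replace hP : 0 < P.1 := hP
  · exact gA P hP
  · positivity
  · exact ((gA P hP).mul HasGrad.snd).congr_grad (by ring) (by ring)
  · have gy : HasGrad (fun P : ℝ × ℝ => P.2 ^ 2) 0 (2 * P.2) P :=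
      (HasGrad.comp (φ := fun y => y ^ 2) (hasDerivAt_pow 2 P.2) HasGrad.snd).congr_grad
        (by ring) (by simp)
    exact (((HasGrad.const a).mul (gl P hP)).sub
      (((HasGrad.const (1 / 4)).mul (gi P hP)).mul gy)).congr_grad (by ring) (by ring)
  · exact ((((HasGrad.const (1 / 2)).mul (gi P hP)).mul HasGrad.snd).neg).congr_grad
      (by ring) (by ring)
  · have := hP.ne'
    exact ((contDiffAt_fst).rpow_const_of_ne this).mul contDiffAt_snd
  · have := hP.ne'
    fun_prop (disch := assumption)
  · simpa using hP.ne'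
  · field_simp; ring
  · field_simp; ring
  · field_simp; ring
  · field_simp; ring
  · simp only [mul_pow, hsq hP]; field_simp; ring

lemma isSimilarity_projective (b : ℝ) :
    IsSimilarity 1 0 1 0 0 b (fun z => b - 1 / 4 * z ^ 2) Set.univ
      (fun P => √2 * (1 + P.1 ^ 2) ^ (-(1 / 2) : ℝ) * P.2)
      (fun P => -(1 / 4) * Real.log (1 + P.1 ^ 2) + b * Real.arctan P.1
        - 1 / 2 * (P.1 * (1 + P.1 ^ 2)⁻¹) * P.2 ^ 2)
      (fun P => √2 * (1 + P.1 ^ 2) ^ (-(1 / 2) : ℝ))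
      (fun P => -(1 / 2) * P.1 * (1 + P.1 ^ 2)⁻¹ + b * (1 + P.1 ^ 2)⁻¹
        - 1 / 2 * ((1 - P.1 ^ 2) * (1 + P.1 ^ 2)⁻¹ ^ 2) * P.2 ^ 2)
      (fun P => -(P.1 * (1 + P.1 ^ 2)⁻¹ * P.2))
      (fun P => -((1 - P.1 ^ 2) * (1 + P.1 ^ 2)⁻¹ ^ 2 * P.2))
      (fun P => -(P.1 * (1 + P.1 ^ 2)⁻¹)) := by
  have pos : ∀ t : ℝ, 0 < 1 + t ^ 2 := fun t => by positivity
  have hsq : ∀ t : ℝ, ((1 + t ^ 2) ^ (-(1 / 2) : ℝ)) ^ 2 = (1 + t ^ 2)⁻¹ := fun t => by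
    rw [← Real.rpow_natCast, ← Real.rpow_mul (pos t).le]
    norm_num [Real.rpow_neg_one]
  have d : ∀ t : ℝ, HasDerivAt (fun t => 1 + t ^ 2) (2 * t) t := fun t =>
    ((hasDerivAt_pow 2 t).const_add 1).congr_deriv (by simp)
  have gA : ∀ P : ℝ × ℝ, HasGrad (fun P => √2 * (1 + P.1 ^ 2) ^ (-(1 / 2) : ℝ))
      (-(P.1 * (1 + P.1 ^ 2)⁻¹) * (√2 * (1 + P.1 ^ 2) ^ (-(1 / 2) : ℝ))) 0 P := fun P => by
    refine (HasGrad.of_fst (φ := fun t => √2 * (1 + t ^ 2) ^ (-(1 / 2) : ℝ))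
      (((d P.1).rpow_const (p := -(1 / 2)) (Or.inl (pos P.1).ne')).const_mul √2)).congr_grad ?_ rfl
    rw [Real.rpow_sub_one (pos P.1).ne']; field_simp
  have gi : ∀ P : ℝ × ℝ, HasGrad (fun P => P.1 * (1 + P.1 ^ 2)⁻¹)
      ((1 - P.1 ^ 2) * (1 + P.1 ^ 2)⁻¹ ^ 2) 0 P := fun P => by
    refine (HasGrad.of_fst (φ := fun t => t * (1 + t ^ 2)⁻¹)
      ((hasDerivAt_id P.1).mul ((d P.1).inv (pos P.1).ne'))).congr_grad ?_ rfl
    have := (pos P.1).ne'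
    simp only [id]
    field_simp; ring
  have gl : ∀ P : ℝ × ℝ, HasGrad (fun P => Real.log (1 + P.1 ^ 2))
      (2 * P.1 * (1 + P.1 ^ 2)⁻¹) 0 P := fun P =>
    HasGrad.of_fst (φ := fun t => Real.log (1 + t ^ 2))
      (((d P.1).log (pos P.1).ne').congr_deriv (div_eq_mul_inv _ _))
  have ga : ∀ P : ℝ × ℝ, HasGrad (fun P => Real.arctan P.1) ((1 + P.1 ^ 2)⁻¹) 0 P := fun P =>
    HasGrad.of_fst ((Real.hasDerivAt_arctan P.1).congr_deriv (by simp))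
  have s2 : √2 ^ 2 = (2 : ℝ) := Real.sq_sqrt (by norm_num)
  constructor <;> intro P _ <;> have p0 := (pos P.1).ne'
  · exact gA P
  · have := pos P.1; positivity
  · exact ((gA P).mul HasGrad.snd).congr_grad (by ring) (by ring)
  · have gy : HasGrad (fun P : ℝ × ℝ => P.2 ^ 2) 0 (2 * P.2) P :=
      (HasGrad.comp (φ := fun y => y ^ 2) (hasDerivAt_pow 2 P.2) HasGrad.snd).congr_grad
        (by ring) (by simp)
    exact ((((HasGrad.const (-(1 / 4))).mul (gl P)).add ((HasGrad.const b).mul (ga P))).sub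
      (((HasGrad.const (1 / 2)).mul (gi P)).mul gy)).congr_grad (by ring) (by ring)
  · exact ((gi P).mul HasGrad.snd).neg.congr_grad (by ring) (by ring)
  · have h1 : ContDiffAt ℝ 2 (fun P : ℝ × ℝ => 1 + P.1 ^ 2) P := by fun_prop
    exact (contDiffAt_const.mul (h1.rpow_const_of_ne p0)).mul contDiffAt_snd
  · have h1 : ContDiffAt ℝ 2 (fun P : ℝ × ℝ => Real.arctan P.1) P :=
      contDiff_fst.contDiffAt.arctan
    fun_prop (disch := assumption)
  · simpa using p0
  · field_simp; ring
  · field_simp; ring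
  · field_simp; ring
  · field_simp; ring
  · simp only [mul_pow, hsq, s2]; field_simp; ring

/-- The cases β = ±1/σ are the two signs V₁ ± V₅. The variable z is an affine function of the
invariant y - βt²/2, scaled so that the reduced equation is exactly Airy's. -/
lemma isSimilarity_galilei {σ β : ℝ} (hσ : 0 < σ) (hβ : β ^ 2 * σ ^ 2 = 1) :
    IsSimilarity 1 0 0 0 β (σ ^ 2 / 8) (fun z => z) Set.univ
      (fun P => (4 * σ) ^ (-(4 / 3) : ℝ) * (σ ^ 4 - 8 * (β * σ ^ 2) * P.2 + 4 * P.1 ^ 2))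
      (fun P => σ ^ 2 / 8 * P.1 - β * P.1 * P.2 + 1 / 3 * β ^ 2 * P.1 ^ 3)
      (fun _ => -(8 * (β * σ ^ 2) * (4 * σ) ^ (-(4 / 3) : ℝ)))
      (fun P => σ ^ 2 / 8 - β * P.2 + β ^ 2 * P.1 ^ 2) (fun P => -(β * P.1))
      (fun _ => -β) (fun _ => 0) := by
  -- Only κ³ = (4σ)⁻⁴ enters the Airy normalisation, so the real power can be replaced by a variable
  -- κ.
  have hκ : ((4 * σ) ^ (-(4 / 3) : ℝ)) ^ 3 * (256 * σ ^ 4) = 1 := by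
    rw [← Real.rpow_natCast, ← Real.rpow_mul (by positivity),
      show (-(4 / 3) : ℝ) * (3 : ℕ) = -(4 : ℕ) by norm_num, Real.rpow_neg (by positivity),
      Real.rpow_natCast]
    field_simp
    norm_num
  have hκ0 : 0 < (4 * σ) ^ (-(4 / 3) : ℝ) := by positivity
  generalize (4 * σ) ^ (-(4 / 3) : ℝ) = κ at hκ hκ0
  have hβ0 : β ≠ 0 := by rintro rfl; simp at hβ
  have g2 : ∀ P : ℝ × ℝ, HasGrad (fun P => P.1 ^ 2) (2 * P.1) 0 P := fun P =>
    HasGrad.of_fst (φ := fun t => t ^ 2) ((hasDerivAt_pow 2 P.1).congr_deriv (by simp))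
  have g3 : ∀ P : ℝ × ℝ, HasGrad (fun P => P.1 ^ 3) (3 * P.1 ^ 2) 0 P := fun P =>
    HasGrad.of_fst (φ := fun t => t ^ 3) ((hasDerivAt_pow 3 P.1).congr_deriv (by simp))
  constructor <;> intro P _
  · exact (HasGrad.const _).congr_grad (by ring) rfl
  · simp only [ne_eq, neg_eq_zero]; positivity
  · refine ((HasGrad.const κ).mul (((HasGrad.const (σ ^ 4)).sub
      ((HasGrad.const (8 * (β * σ ^ 2))).mul HasGrad.snd)).add
      ((HasGrad.const 4).mul (g2 P)))).congr_grad ?_ ?_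
    · linear_combination -8 * κ * P.1 * hβ
    · ring
  · exact ((((HasGrad.const (σ ^ 2 / 8)).mul HasGrad.fst).sub
      (((HasGrad.const β).mul HasGrad.fst).mul HasGrad.snd)).add
      ((HasGrad.const (1 / 3 * β ^ 2)).mul (g3 P))).congr_grad (by ring) (by ring)
  · exact ((HasGrad.const β).mul HasGrad.fst).neg.congr_grad (by ring) (by ring)
  · fun_prop
  · fun_prop
  · simp
  · ring
  · ring
  · ring
  · ring
  · have hβ4 : β ^ 2 = 1 / σ ^ 2 := by field_simp; exact hβ
    have hκ3 : κ ^ 3 = 1 / (256 * σ ^ 4) := by field_simp; linarith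
    calc _ = 64 * (β ^ 2 * σ ^ 2) * σ ^ 2 * κ ^ 3 *
          (σ ^ 4 - 8 * (β * σ ^ 2) * P.2 + 4 * P.1 ^ 2) := by ring
      _ = σ ^ 2 / 4 - 2 * β * P.2 + β ^ 2 * P.1 ^ 2 := by
        rw [hβ, hκ3, hβ4]; field_simp; ring
      _ = _ := by ring

lemma isSimilarity_translation (c : ℝ) :
    IsSimilarity 1 0 0 0 0 c (fun _ => 2 * c) Set.univ
      (fun P => P.2) (fun P => c * P.1) (fun _ => 1) (fun _ => c) (fun _ => 0)
      (fun _ => 0) (fun _ => 0) := by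
  constructor <;> intro P _
  · exact (HasGrad.const _).congr_grad (by ring) rfl
  · simp
  · exact HasGrad.snd.congr_grad (by ring) rfl
  · exact ((HasGrad.const c).mul HasGrad.fst).congr_grad (by ring) (by ring)
  · exact HasGrad.const 0
  · fun_prop
  · fun_prop
  all_goals simp

/-! ### Fundamental systems for constant coefficients -/

lemma isFundamental_exp {w : ℝ} (hw : 0 < w) :
    IsFundamental (fun _ => w ^ 2) (fun z => Real.exp (w * z)) (fun z => Real.exp (w * z) * w)
      (fun z => Real.exp (-(w * z))) (fun z => Real.exp (-(w * z)) * -w) := by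
  have d : ∀ z, HasDerivAt (fun z => w * z) w z := fun z =>
    ((hasDerivAt_id z).const_mul w).congr_deriv (by simp)
  refine .of_wronskian_zero (fun z => (d z).exp)
    (fun z => ((d z).exp.mul_const w).congr_deriv (by ring)) (fun z => (d z).neg.exp)
    (fun z => ((d z).neg.exp.mul_const (-w)).congr_deriv (by simp only [Pi.neg_apply]; ring)) (by fun_prop) (by fun_prop) ?_
  simp only [mul_zero, neg_zero, Real.exp_zero]
  linarith

/-- The scale w serves to make the second function ln x itself: w = σ and z = ln x / σ. -/
lemma isFundamental_linear {w : ℝ} (hw : 0 < w) :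
    IsFundamental (fun _ => 0) (fun _ => 1) (fun _ => 0) (fun z => w * z) (fun _ => w) :=
  .of_wronskian_zero (fun z => hasDerivAt_const z 1)
    (fun z => (hasDerivAt_const z 0).congr_deriv (by ring))
    (fun z => ((hasDerivAt_id z).const_mul w).congr_deriv (by simp))
    (fun z => (hasDerivAt_const z w).congr_deriv (by ring)) (by fun_prop) (by fun_prop)
    (by simpa using hw.ne')

lemma isFundamental_trig {w : ℝ} (hw : 0 < w) :
    IsFundamental (fun _ => -w ^ 2) (fun z => Real.cos (w * z)) (fun z => -Real.sin (w * z) * w)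
      (fun z => Real.sin (w * z)) (fun z => Real.cos (w * z) * w) := by
  have d : ∀ z, HasDerivAt (fun z => w * z) w z := fun z =>
    ((hasDerivAt_id z).const_mul w).congr_deriv (by simp)
  refine .of_wronskian_zero (fun z => (d z).cos)
    (fun z => ((d z).sin.neg.mul_const w).congr_deriv (by ring)) (fun z => (d z).sin)
    (fun z => ((d z).cos.mul_const w).congr_deriv (by ring)) (by fun_prop) (by fun_prop) ?_
  simpa using hw.ne'

/-! ### The explicit solutions as weight times a heat solution -/

section formulas
variable {σ : ℝ} (k : ℝ) {t x : ℝ}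

lemma rpow_half_eq (hx : 0 < x) : x ^ (1 / 2 : ℝ) = Real.exp (1 / 2 * Real.log x) := by
  rw [Real.rpow_def_of_pos hx, mul_comm]

lemma solV4_eq (hσ : 0 < σ) (c : ℝ) :
    solV4 σ k c t x = weight σ k t x *
      (c * Real.exp (-σ / 2 * (Real.log x / σ) + σ ^ 2 / 8 * t)) := by
  rw [solV4, weight, mul_left_comm, ← Real.exp_add]
  congr 2
  field_simp
  ring

lemma solV2_eq (hσ : 0 < σ) (ht : 0 < t) (hx : 0 < x) (a c₁ c₂ : ℝ) :
    solV2 σ k a c₁ c₂ t x = weight σ k t x *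
      (Real.exp (a * Real.log t - 1 / 4 * t⁻¹ * (Real.log x / σ) ^ 2) *
        (c₁ * pcU (2 * a + 1 / 2) (t ^ (-(1 / 2) : ℝ) * (Real.log x / σ))
        + c₂ * pcV (2 * a + 1 / 2) (t ^ (-(1 / 2) : ℝ) * (Real.log x / σ)))) := by
  have e : 1 / σ * t ^ (-(1 / 2) : ℝ) * Real.log x = t ^ (-(1 / 2) : ℝ) * (Real.log x / σ) := by
    ring
  rw [solV2, e, rpow_half_eq hx, Real.rpow_def_of_pos ht a, ← mul_assoc (weight σ k t x), weight,
    ← Real.exp_add, ← Real.exp_add, ← Real.exp_add]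
  congr 2
  field_simp; ring

lemma solV1V3_eq (hσ : 0 < σ) (hx : 0 < x) (a c₁ c₂ : ℝ) :
    solV1V3 σ k a c₁ c₂ t x = weight σ k t x *
      (Real.exp (-(1 / 4) * Real.log (1 + t ^ 2) + (σ ^ 2 + 8 * a) / 8 * Real.arctan t
          - 1 / 2 * (t * (1 + t ^ 2)⁻¹) * (Real.log x / σ) ^ 2) *
        (c₁ * pcW ((σ ^ 2 + 8 * a) / 8) (√2 * (1 + t ^ 2) ^ (-(1 / 2) : ℝ) * (Real.log x / σ))
        + c₂ * pcW ((σ ^ 2 + 8 * a) / 8)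
          (-(√2 * (1 + t ^ 2) ^ (-(1 / 2) : ℝ) * (Real.log x / σ))))) := by
  have hp : 0 < 1 + t ^ 2 := by positivity
  have e : √2 / σ * (1 + t ^ 2) ^ (-(1 / 2) : ℝ) * Real.log x =
      √2 * (1 + t ^ 2) ^ (-(1 / 2) : ℝ) * (Real.log x / σ) := by ring
  rw [solV1V3, e, rpow_half_eq hx, Real.rpow_def_of_pos hp (-(1 / 4)), ← mul_assoc (weight σ k t x),
    weight, ← Real.exp_add, ← Real.exp_add, ← Real.exp_add]
  congr 2
  field_simp; ring

lemma solV1addV5_eq (hσ : 0 < σ) (hx : 0 < x) (c₁ c₂ : ℝ) :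
    solV1addV5 σ k c₁ c₂ t x = weight σ k t x *
      (Real.exp (σ ^ 2 / 8 * t - 1 / σ * t * (Real.log x / σ) + 1 / 3 * (1 / σ) ^ 2 * t ^ 3) *
        (c₁ * airyAi ((4 * σ) ^ (-(4 / 3) : ℝ) *
          (σ ^ 4 - 8 * (1 / σ * σ ^ 2) * (Real.log x / σ) + 4 * t ^ 2))
        + c₂ * airyBi ((4 * σ) ^ (-(4 / 3) : ℝ) *
          (σ ^ 4 - 8 * (1 / σ * σ ^ 2) * (Real.log x / σ) + 4 * t ^ 2)))) := by
  have e : 8 * (1 / σ * σ ^ 2) * (Real.log x / σ) = 8 * Real.log x := by field_simp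
  rw [solV1addV5, rpow_half_eq hx, ← mul_assoc (weight σ k t x), weight, ← Real.exp_add,
    ← Real.exp_add, e]
  congr 2
  field_simp; ring

lemma solV1subV5_eq (hσ : 0 < σ) (hx : 0 < x) (c₁ c₂ : ℝ) :
    solV1subV5 σ k c₁ c₂ t x = weight σ k t x *
      (Real.exp (σ ^ 2 / 8 * t - -1 / σ * t * (Real.log x / σ) + 1 / 3 * (-1 / σ) ^ 2 * t ^ 3) *
        (c₁ * airyAi ((4 * σ) ^ (-(4 / 3) : ℝ) *
          (σ ^ 4 - 8 * (-1 / σ * σ ^ 2) * (Real.log x / σ) + 4 * t ^ 2))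
        + c₂ * airyBi ((4 * σ) ^ (-(4 / 3) : ℝ) *
          (σ ^ 4 - 8 * (-1 / σ * σ ^ 2) * (Real.log x / σ) + 4 * t ^ 2)))) := by
  have e : σ ^ 4 - 8 * (-1 / σ * σ ^ 2) * (Real.log x / σ) = σ ^ 4 + 8 * Real.log x := by
    field_simp; ring
  rw [solV1subV5, rpow_half_eq hx, ← mul_assoc (weight σ k t x), weight, ← Real.exp_add,
    ← Real.exp_add, e]
  congr 2
  field_simp; ring

/-- The reduced equation is f'' = ((σ² + 8a)/4) f, with frequency or rate √|σ² + 8a| / 2 in y; the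
sign of σ² + 8a selects trigonometric, affine or exponential solutions. -/
lemma exists_isFundamental_solV1 (hσ : 0 < σ) (a : ℝ) :
    ∃ f₁ f₁' f₂ f₂' : ℝ → ℝ,
      IsFundamental (fun _ => 2 * ((σ ^ 2 + 8 * a) / 8)) f₁ f₁' f₂ f₂' ∧
      ∀ c₁ c₂ t x, 0 < x → solV1 σ k a c₁ c₂ t x = weight σ k t x *
        (Real.exp ((σ ^ 2 + 8 * a) / 8 * t) *
          (c₁ * f₁ (Real.log x / σ) + c₂ * f₂ (Real.log x / σ))) := by
  have key : ∀ t x : ℝ, 0 < x → x ^ (1 / 2 : ℝ) * Real.exp (k / σ ^ 2 * x + a * t) =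
      weight σ k t x * Real.exp ((σ ^ 2 + 8 * a) / 8 * t) := fun t x hx => by
    rw [rpow_half_eq hx, weight, ← Real.exp_add, ← Real.exp_add]
    congr 1; ring
  rcases lt_trichotomy (σ ^ 2 + 8 * a) 0 with hneg | hz | hpos
  · have hw : 0 < √(-σ ^ 2 - 8 * a) / 2 := by
      have : 0 < √(-σ ^ 2 - 8 * a) := Real.sqrt_pos.2 (by linarith)
      positivity
    have F := isFundamental_trig hw
    have hQ : -(√(-σ ^ 2 - 8 * a) / 2) ^ 2 = 2 * ((σ ^ 2 + 8 * a) / 8) := by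
      rw [div_pow, Real.sq_sqrt (by linarith)]
      ring
    rw [hQ] at F
    refine ⟨_, _, _, _, F, fun c₁ c₂ t x hx => ?_⟩
    have e : √(-σ ^ 2 - 8 * a) / (2 * σ) * Real.log x
        = √(-σ ^ 2 - 8 * a) / 2 * (Real.log x / σ) := by field_simp
    rw [solV1, if_neg hneg.not_gt, if_neg hneg.ne, key t x hx, mul_assoc, e]
  · have F := isFundamental_linear hσ
    -- This replaces every 0 in `F`, also the derivative of the constant solution; the derivatives
    -- are existentially quantified, so their form is immaterial.
    rw [← hz] at F
    have hQ : σ ^ 2 + 8 * a = 2 * ((σ ^ 2 + 8 * a) / 8) := by rw [hz]; norm_num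
    rw [hQ] at F
    refine ⟨_, _, _, _, F, fun c₁ c₂ t x hx => ?_⟩
    have e : σ * (Real.log x / σ) = Real.log x := by field_simp
    rw [solV1, if_neg (by rw [hz]; exact lt_irrefl 0), if_pos hz, key t x hx, mul_assoc, e,
      mul_one]
  · have hw : 0 < √(σ ^ 2 + 8 * a) / 2 := by
      have : 0 < √(σ ^ 2 + 8 * a) := Real.sqrt_pos.2 (by linarith)
      positivity
    have F := isFundamental_exp hw
    have hQ : (√(σ ^ 2 + 8 * a) / 2) ^ 2 = 2 * ((σ ^ 2 + 8 * a) / 8) := by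
      rw [div_pow, Real.sq_sqrt (by linarith)]
      ring
    rw [hQ] at F
    refine ⟨_, _, _, _, F, fun c₁ c₂ t x hx => ?_⟩
    have e : Real.log x * (1 / (2 * σ) * √(σ ^ 2 + 8 * a))
        = √(σ ^ 2 + 8 * a) / 2 * (Real.log x / σ) := by field_simp
    rw [solV1, if_pos hpos, key t x hx, mul_assoc, Real.rpow_def_of_pos hx,
      Real.rpow_def_of_pos hx, mul_neg, e]

end formulas

/-! ### Invariant solutions of the listed generators -/

section
variable {σ k : ℝ} {Ω : Set (ℝ × ℝ)} {u : ℝ → ℝ → ℝ}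

lemma V4_eq_genField : V4 σ k = genField σ k 0 0 0 1 0 0 := by simp [genField]

lemma V2_add_eq_genField (a : ℝ) : V2 σ k + a • V6 = genField σ k 0 1 0 0 0 a := by
  simp [genField]

lemma V1_add_V3_add_eq_genField (a : ℝ) :
    V1 + V3 σ k + a • V6 = genField σ k 1 0 1 0 0 a := by simp [genField]

lemma V1_add_V5_eq_genField : V1 + V5 σ k = genField σ k 1 0 0 0 1 0 := by simp [genField]

lemma V1_sub_V5_eq_genField : V1 - V5 σ k = genField σ k 1 0 0 0 (-1) 0 := by
  simp [genField, sub_eq_add_neg]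

lemma V1_add_eq_genField (a : ℝ) : V1 + a • V6 = genField σ k 1 0 0 0 0 a := by simp [genField]

/-- With τ = 0 invariance reads h_y = (c/b₀) h. Its y-derivative gives h_yy, and the heat equation
then gives h_t, so h divided by the stated exponential has zero gradient. -/
lemma HeatInv.eq_exp {h : ℝ × ℝ → ℝ} {b₀ c : ℝ} (H : HeatInv 0 0 0 b₀ 0 c Ω h) (hb : b₀ ≠ 0)
    (ho : IsOpen Ω) (hc : IsConnected Ω) :
    ∃ C, ∀ P ∈ Ω, h P = C * Real.exp (c / b₀ * P.2 + (c / b₀) ^ 2 / 2 * P.1) := by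
  obtain ⟨q, r, s, H⟩ := H
  have key : ∀ P ∈ Ω, HasGrad (fun P => h P *
      Real.exp (-(c / b₀ * P.2 + (c / b₀) ^ 2 / 2 * P.1))) 0 0 P := fun P hP => by
    obtain ⟨h1, -, h3, h4⟩ := H P hP
    have e1 : q P = c / b₀ * h P := by field_simp; linear_combination h3
    have e2 : r P = c / b₀ * q P := by field_simp; linear_combination h4
    have e := (((HasGrad.const (P := P) (c / b₀)).mul HasGrad.snd).add
      ((HasGrad.const ((c / b₀) ^ 2 / 2)).mul HasGrad.fst)).neg.exp
    refine (h1.mul e).congr_grad ?_ ?_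
    · rw [e2, e1]; ring
    · rw [e1]; ring
  obtain ⟨C, hC⟩ := HasGrad.exists_const ho hc key
  refine ⟨C, fun P hP => ?_⟩
  rw [← hC P hP, mul_assoc, ← Real.exp_add]
  simp

/-- Here τ = 0 and `IsSimilarity` does not apply. The heat solution is e^{-σy/2 + σ²t/8}, which
cancels the factor x^{1/2} e^{-σ²t/8} of the weight. -/
lemma isInvariantSolution_V4_iff (hσ : 0 < σ) (ho : IsOpen Ω) (hc : IsConnected Ω)
    (hΩ : Ω ⊆ halfPlane) :
    IsInvariantSolution σ k (V4 σ k) Ω u ↔ ∃ c, AgreesOn Ω u (solV4 σ k c) := by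
  rw [V4_eq_genField]
  constructor
  · intro H
    have H' := H.heatInv hσ ho hΩ
    simp only [zero_div] at H'
    obtain ⟨C, hC⟩ := H'.eq_exp (by positivity) (isOpen_heatDomain ho)
      (isConnected_heatDomain hσ hc hΩ)
    refine ⟨C, fun t x hx => ?_⟩
    rw [solV4_eq k hσ, ← weight_mul_heatFun (k := k) hσ u (hΩ hx),
      hC _ ((mem_heatDomain hσ (hΩ hx)).2 hx)]
    congr 3
    field_simp
    ring
  · rintro ⟨c, h⟩
    set f : ℝ × ℝ → ℝ := fun P => c * Real.exp (-σ / 2 * P.2 + σ ^ 2 / 8 * P.1) with hf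
    have hu : ∀ t x, (t, x) ∈ Ω → u t x = weight σ k t x * f (t, Real.log x / σ) :=
      fun t x hx => (h t x hx).trans (solV4_eq k hσ c)
    have g : ∀ (a : ℝ) (P : ℝ × ℝ), HasGrad (fun P => a * f P)
        (σ ^ 2 / 8 * (a * f P)) (-σ / 2 * (a * f P)) P := fun a P => by
      have e := (((HasGrad.const (P := P) (-σ / 2)).mul HasGrad.snd).add
        ((HasGrad.const (σ ^ 2 / 8)).mul HasGrad.fst)).exp
      exact ((HasGrad.const a).mul ((HasGrad.const c).mul e)).congr_grad
        (by simp only [hf]; ring) (by simp only [hf]; ring)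
    refine (isInvariantSolution_weight_iff hσ ho hΩ hu (p := fun P => σ ^ 2 / 8 * f P)
      (q := fun P => -σ / 2 * f P) (r := fun P => -σ / 2 * (-σ / 2 * f P))
      (fun P _ => ?_) (fun P _ => ⟨_, g _ P⟩)
      (contDiffOn_weight_mul hσ hΩ hu fun P _ => by simp only [hf]; fun_prop)).2
      fun P _ => ⟨by ring, by field_simp; ring⟩
    simpa only [one_mul] using g 1 P

lemma isInvariantSolution_V2_iff (hσ : 0 < σ) (ho : IsOpen Ω) (hc : IsConnected Ω)
    (hΩ : Ω ⊆ halfPlane) (a : ℝ) (ht : Ω ⊆ {p | 0 < p.1}) :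
    IsInvariantSolution σ k (V2 σ k + a • V6) Ω u ↔
      ∃ c₁ c₂, AgreesOn Ω u (solV2 σ k a c₁ c₂) := by
  obtain ⟨f₁', f₂', hf⟩ := exists_isFundamental_pcUV (2 * a + 1 / 2)
  rw [V2_add_eq_genField]
  refine isInvariantSolution_iff_of_isSimilarity hσ ho hc hΩ (isSimilarity_scaling a)
    (by simp) (by simp) (by simp) hf
    (fun P hP => by simpa using ht (show (P.1, Real.exp (σ * P.2)) ∈ Ω from hP))
    (fun c₁ c₂ t x hx => solV2_eq k hσ (ht hx) (hΩ hx) a c₁ c₂) u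

lemma isInvariantSolution_V1V3_iff (hσ : 0 < σ) (ho : IsOpen Ω) (hc : IsConnected Ω)
    (hΩ : Ω ⊆ halfPlane) (a : ℝ) :
    IsInvariantSolution σ k (V1 + V3 σ k + a • V6) Ω u ↔
      ∃ c₁ c₂, AgreesOn Ω u (solV1V3 σ k a c₁ c₂) := by
  obtain ⟨f₁', f₂', hf⟩ := exists_isFundamental_pcW ((σ ^ 2 + 8 * a) / 8)
  rw [V1_add_V3_add_eq_genField]
  exact isInvariantSolution_iff_of_isSimilarity hσ ho hc hΩ
    (isSimilarity_projective ((σ ^ 2 + 8 * a) / 8)) (by simp) (by simp) (by ring) hf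
    (Set.subset_univ _) (fun c₁ c₂ t x hx => solV1V3_eq k hσ (hΩ hx) a c₁ c₂) u

lemma isInvariantSolution_V1addV5_iff (hσ : 0 < σ) (ho : IsOpen Ω) (hc : IsConnected Ω)
    (hΩ : Ω ⊆ halfPlane) :
    IsInvariantSolution σ k (V1 + V5 σ k) Ω u ↔
      ∃ c₁ c₂, AgreesOn Ω u (solV1addV5 σ k c₁ c₂) := by
  obtain ⟨f₁', f₂', hf⟩ := exists_isFundamental_airy
  rw [V1_add_V5_eq_genField]
  exact isInvariantSolution_iff_of_isSimilarity hσ ho hc hΩ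
    (isSimilarity_galilei (β := 1 / σ) hσ (by field_simp)) (by simp) rfl (by ring) hf
    (Set.subset_univ _) (fun c₁ c₂ t x hx => solV1addV5_eq k hσ (hΩ hx) c₁ c₂) u

lemma isInvariantSolution_V1subV5_iff (hσ : 0 < σ) (ho : IsOpen Ω) (hc : IsConnected Ω)
    (hΩ : Ω ⊆ halfPlane) :
    IsInvariantSolution σ k (V1 - V5 σ k) Ω u ↔
      ∃ c₁ c₂, AgreesOn Ω u (solV1subV5 σ k c₁ c₂) := by
  obtain ⟨f₁', f₂', hf⟩ := exists_isFundamental_airy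
  rw [V1_sub_V5_eq_genField]
  exact isInvariantSolution_iff_of_isSimilarity hσ ho hc hΩ
    (isSimilarity_galilei (β := -1 / σ) hσ (by field_simp)) (by simp) rfl (by ring) hf
    (Set.subset_univ _) (fun c₁ c₂ t x hx => solV1subV5_eq k hσ (hΩ hx) c₁ c₂) u

lemma isInvariantSolution_V1_iff (hσ : 0 < σ) (ho : IsOpen Ω) (hc : IsConnected Ω)
    (hΩ : Ω ⊆ halfPlane) (a : ℝ) :
    IsInvariantSolution σ k (V1 + a • V6) Ω u ↔
      ∃ c₁ c₂, AgreesOn Ω u (solV1 σ k a c₁ c₂) := by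
  obtain ⟨f₁, f₁', f₂, f₂', hf, hv⟩ := exists_isFundamental_solV1 k hσ a
  rw [V1_add_eq_genField]
  exact isInvariantSolution_iff_of_isSimilarity hσ ho hc hΩ
    (isSimilarity_translation ((σ ^ 2 + 8 * a) / 8)) (by simp) (by simp) (by ring) hf
    (Set.subset_univ _) (fun c₁ c₂ t x hx => hv c₁ c₂ t x (hΩ hx)) u

lemma isInvariantSolution_V6_iff (ho : IsOpen Ω) :
    IsInvariantSolution σ k V6 Ω u ↔ AgreesOn Ω u 0 := by
  constructor
  · rintro ⟨-, h⟩ t x hx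
    simpa [V6] using h t x hx
  · intro h
    have e1 : ∀ t x, (t, x) ∈ Ω → (fun s => u s x) =ᶠ[nhds t] fun _ => 0 := fun t x hx => by
      have : ∀ᶠ t' in nhds t, (t', x) ∈ Ω :=
        (continuous_id.prodMk continuous_const).continuousAt.preimage_mem_nhds (ho.mem_nhds hx)
      filter_upwards [this] with t' ht'
      exact h t' x ht'
    have e2 : ∀ t x, (t, x) ∈ Ω → u t =ᶠ[nhds x] fun _ => 0 := fun t x hx => by
      have : ∀ᶠ x' in nhds x, (t, x') ∈ Ω :=
        (continuous_const.prodMk continuous_id).continuousAt.preimage_mem_nhds (ho.mem_nhds hx)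
      filter_upwards [this] with x' hx'
      exact h t x' hx'
    have h0 : ∀ t x, (t, x) ∈ Ω → u t x = 0 := h
    refine ⟨⟨(contDiffOn_const (c := (0 : ℝ))).congr fun P hP => h P.1 P.2 hP,
      fun t x hx => ?_⟩, fun t x hx => ?_⟩
    · rw [(e1 t x hx).deriv_eq, (e2 t x hx).deriv.deriv_eq, (e2 t x hx).deriv_eq, h0 t x hx]
      simp
    · simp [V6, h0 t x hx]

end

/-! ### Transformations of invariant solutions -/

/-- The point with coordinates `(t, y, h)` in the original coordinates `(t, x, u)`. -/
def lift (σ k : ℝ) (P : ℝ × ℝ) (c : ℝ) : ℝ × ℝ × ℝ :=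
  (P.1, Real.exp (σ * P.2), weight σ k P.1 (Real.exp (σ * P.2)) * c)

lemma GroupMaps.append {σ k : ℝ} {g : List (Fin 6 × ℝ)} {i : Fin 6} {ε : ℝ}
    {p m q : ℝ × ℝ × ℝ} (h : GroupMaps σ k g p m) (hf : FlowsTo (basisField σ k i) ε m q) :
    GroupMaps σ k (g ++ [(i, ε)]) p q := by
  induction g generalizing p with
  | nil => obtain rfl : p = m := h; exact ⟨q, hf, rfl⟩
  | cons a g ih => obtain ⟨n, h1, h2⟩ := h; exact ⟨n, h1, ih h2⟩

/-- Over `Ω`, the function `u` belonging to `h` is a transform of an explicit solution. -/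
def IsReachable (σ k : ℝ) (Ω : Set (ℝ × ℝ)) (h : ℝ × ℝ → ℝ) : Prop :=
  ∃ (D : Set (ℝ × ℝ)) (v : ℝ → ℝ → ℝ) (g : List (Fin 6 × ℝ)), OptimalSolution σ k D v ∧
    ∀ P ∈ Ω, ∃ t₀ x₀ : ℝ, (t₀, x₀) ∈ D ∧
      GroupMaps σ k g (t₀, x₀, v t₀ x₀) (lift σ k P (h P))

/-- All invariant solutions for the generator with the given coefficients, on domains over `I`,
are transforms of explicit solutions. -/
def Reducible (σ k a₁ a₂ a₃ b₀ b₁ c : ℝ) (I : Set ℝ) : Prop :=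
  ∀ (Ω : Set (ℝ × ℝ)) (h : ℝ × ℝ → ℝ), IsOpen Ω → IsConnected Ω → (∀ P ∈ Ω, P.1 ∈ I) →
    HeatInv a₁ a₂ a₃ b₀ b₁ c Ω h → IsReachable σ k Ω h

section
variable {σ k a₁ a₂ a₃ b₀ b₁ c a₁' a₂' a₃' b₀' b₁' c' : ℝ} {I I' : Set ℝ}

lemma Reducible.mono (H : Reducible σ k a₁ a₂ a₃ b₀ b₁ c I') (hI : I ⊆ I') :
    Reducible σ k a₁ a₂ a₃ b₀ b₁ c I :=
  fun Ω h ho hc hΩ hh => H Ω h ho hc (fun P hP => hI (hΩ P hP)) hh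

lemma Reducible.of_smul (l : ℝ)
    (H : Reducible σ k (l * a₁) (l * a₂) (l * a₃) (l * b₀) (l * b₁) (l * c) I) :
    Reducible σ k a₁ a₂ a₃ b₀ b₁ c I :=
  fun Ω h ho hc hΩ hh => H Ω h ho hc hΩ (hh.smul l)

/-- Reduction along a symmetry `Φ = (T, Y)`, defined on `S` and with inverse `Ψ`. -/
lemma Reducible.of_symmetry {S : Set (ℝ × ℝ)} {T Y μ : ℝ × ℝ → ℝ} {Ψ : ℝ × ℝ → ℝ × ℝ}
    (H : Reducible σ k a₁' a₂' a₃' b₀' b₁' c' I')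
    (i : Fin 6) (ε : ℝ) (hS : IsOpen S) (hT : ContinuousOn T S) (hY : ContinuousOn Y S)
    (hΨ : ContinuousOn Ψ {P | P.1 ∈ I}) (hΨS : ∀ P : ℝ × ℝ, P.1 ∈ I → Ψ P ∈ S)
    (hΦΨ : ∀ P : ℝ × ℝ, P.1 ∈ I → (T (Ψ P), Y (Ψ P)) = P)
    (hΨΦ : ∀ P ∈ S, Ψ (T P, Y P) = P)
    (hI : ∀ P ∈ S, T P ∈ I → P.1 ∈ I')
    (hflow : ∀ P ∈ S, ∀ c, FlowsTo (basisField σ k i) ε (lift σ k P (Real.exp (μ P) * c))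
      (lift σ k (T P, Y P) c))
    (hpull : ∀ (Ω Ω' : Set (ℝ × ℝ)) (h : ℝ × ℝ → ℝ), Ω' ⊆ S → (∀ P ∈ Ω', (T P, Y P) ∈ Ω) →
      HeatInv a₁ a₂ a₃ b₀ b₁ c Ω h →
      HeatInv a₁' a₂' a₃' b₀' b₁' c' Ω' (fun P => Real.exp (μ P) * h (T P, Y P))) :
    Reducible σ k a₁ a₂ a₃ b₀ b₁ c I := by
  intro Ω h ho hc hΩ hh
  set Ω' := S ∩ (fun P => (T P, Y P)) ⁻¹' Ω with hΩ'
  -- The preimage of Ω is open by continuity of Φ; being the image of Ω under the continuous inverse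
  -- Ψ, it is also connected.
  have himg : Ω' = Ψ '' Ω := by
    ext P
    constructor
    · rintro ⟨h1, h2⟩
      exact ⟨_, h2, hΨΦ P h1⟩
    · rintro ⟨P, hP, rfl⟩
      refine ⟨hΨS P (hΩ P hP), ?_⟩
      rw [Set.mem_preimage, hΦΨ P (hΩ P hP)]
      exact hP
  obtain ⟨D, v, g, hv, hg⟩ := H Ω' (fun P => Real.exp (μ P) * h (T P, Y P))
    ((hT.prodMk hY).isOpen_inter_preimage hS ho)
    (himg ▸ hc.image Ψ (hΨ.mono hΩ)) (fun P hP => hI P hP.1 (hΩ _ hP.2))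
    (hpull Ω Ω' h Set.inter_subset_left (fun P hP => hP.2) hh)
  refine ⟨D, v, g ++ [(i, ε)], hv, fun P hP => ?_⟩
  have hP' : Ψ P ∈ Ω' := himg ▸ ⟨P, hP, rfl⟩
  obtain ⟨t₀, x₀, h1, h2⟩ := hg _ hP'
  refine ⟨t₀, x₀, h1, h2.append ?_⟩
  simpa only [hΦΨ P (hΩ P hP)] using hflow _ hP'.1 (h (T (Ψ P), Y (Ψ P)))

/-- In heat coordinates the integral curves are (T, Y, e^ν c), since the vertical component is
linear in h. The condition ν(ε) = 0 makes the flow carry the graph of e^m h(T, Y) to that of h. -/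
lemma flowsTo_lift {a₄ a₅ a₆ : ℝ} (hσ : 0 < σ) {T Y ν : ℝ → ℝ} {ε : ℝ} {P P' : ℝ × ℝ} {m : ℝ}
    (h0 : (T 0, Y 0) = P) (hε : (T ε, Y ε) = P') (hν0 : ν 0 = m) (hνε : ν ε = 0)
    (hT : ∀ s ∈ Set.uIcc 0 ε, HasDerivAt T (a₁ + a₂ * T s + a₃ * T s ^ 2) s)
    (hY : ∀ s ∈ Set.uIcc 0 ε,
      HasDerivAt Y ((a₂ / 2 + a₃ * T s) * Y s + a₄ / σ + a₅ / σ * T s) s)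
    (hν : ∀ s ∈ Set.uIcc 0 ε, HasDerivAt ν
      (a₁ * σ ^ 2 / 8 - a₄ / 2 + a₆ - a₅ / σ * Y s - a₃ * (Y s ^ 2 + T s) / 2) s) (c : ℝ) :
    FlowsTo (genField σ k a₁ a₂ a₃ a₄ a₅ a₆) ε (lift σ k P (Real.exp m * c))
      (lift σ k P' c) := by
  refine ⟨fun s => lift σ k (T s, Y s) (Real.exp (ν s) * c), ?_, ?_, fun s hs =>
    ⟨Real.exp_pos _, ?_⟩⟩
  · simp only [h0, hν0]
  · simp only [hε, hνε, Real.exp_zero, one_mul]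
  · have e := ((hY s hs).const_mul σ).exp
    have w : HasDerivAt (fun s => weight σ k (T s) (Real.exp (σ * Y s))) _ s :=
      (((((hY s hs).const_mul σ).const_mul (1 / 2)).add (e.const_mul (k / σ ^ 2))).sub
        ((hT s hs).const_mul (σ ^ 2 / 8))).exp.congr_of_eventuallyEq
        (Filter.Eventually.of_forall fun s => by simp [weight])
    have hd := (hT s hs).prodMk (e.prodMk (w.mul ((hν s hs).exp.mul_const c)))
    refine hd.congr_deriv ?_
    simp only [lift, genField_apply, Real.log_exp, weight, Pi.add_apply, Pi.sub_apply]
    refine Prod.ext rfl (Prod.ext ?_ ?_)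
    · simp only
      field_simp
      ring
    · simp only
      field_simp
      ring

end

/-! ### Reduction steps by the one-parameter groups -/

section
variable {σ k a₁ a₂ a₃ b₀ b₁ c : ℝ} {I I' : Set ℝ}

lemma basisField_eq_genField (i : Fin 6) : basisField σ k i =
    genField σ k (if i = 0 then 1 else 0) (if i = 1 then 1 else 0) (if i = 2 then 1 else 0)
      (if i = 3 then 1 else 0) (if i = 4 then 1 else 0) (if i = 5 then 1 else 0) := by
  fin_cases i <;> simp [basisField, genField]

/-- Reduction by the flow of `V₁`. -/
lemma Reducible.of_translation (hσ : 0 < σ) (ε : ℝ)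
    (H : Reducible σ k (a₁ + a₂ * ε + a₃ * ε ^ 2) (a₂ + 2 * a₃ * ε) a₃ (b₀ + b₁ * ε) b₁
      (c - a₃ * ε / 2) I') (hI : ∀ s, s + ε ∈ I → s ∈ I') :
    Reducible σ k a₁ a₂ a₃ b₀ b₁ c I := by
  -- The constant μ compensates the factor e^{-σ²t/8} of the weight, owing to which V₁ has c = σ²/8
  -- in heat coordinates.
  refine H.of_symmetry (S := Set.univ) (T := fun P => P.1 + ε) (Y := fun P => P.2)
    (μ := fun _ => -(σ ^ 2 / 8 * ε)) (Ψ := fun P => (P.1 - ε, P.2)) 0 ε isOpen_univ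
    (by fun_prop) (by fun_prop) (by fun_prop) (fun _ _ => trivial) (fun P _ => by simp)
    (fun P _ => by simp) (fun P _ h => hI _ h) (fun P _ c => ?_) (fun Ω Ω' h _ hm hh => ?_)
  · rw [basisField_eq_genField]
    refine flowsTo_lift hσ (T := fun s => P.1 + s) (Y := fun _ => P.2)
      (ν := fun s => σ ^ 2 / 8 * (s - ε)) (by simp) rfl (by simp) (by simp)
      (fun s _ => ?_) (fun s _ => ?_) (fun s _ => ?_) c
    · simpa using (hasDerivAt_id s).const_add P.1
    · simpa using hasDerivAt_const s P.2
    · refine (((hasDerivAt_id s).sub_const ε).const_mul (σ ^ 2 / 8)).congr_deriv ?_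
      simp
  · refine hh.pullback (fun P => P.1 + ε) (fun _ => 1) (fun P => P.2)
      (fun _ => -(σ ^ 2 / 8 * ε)) (fun _ => 0) (fun _ => 0) (fun _ => 0) (fun _ => 0)
      (fun P _ => (HasGrad.fst.add (HasGrad.const ε)).congr_grad (by ring) (by ring))
      (fun P _ => HasGrad.const 1) (fun P _ => HasGrad.snd.congr_grad (by ring) rfl)
      (fun P _ => (HasGrad.const _).congr_grad (by ring) rfl) (fun P _ => HasGrad.const 0)
      ?_ ?_ ?_ ?_ ?_ ?_ ?_ hm <;> intro P _ <;> ring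

/-- Reduction by the flow of `V₂`. -/
lemma Reducible.of_dilation (hσ : 0 < σ) {r : ℝ} (hr : 0 < r)
    (H : Reducible σ k (a₁ / r ^ 2) a₂ (r ^ 2 * a₃) (b₀ / r) (r * b₁) c Set.univ) :
    Reducible σ k a₁ a₂ a₃ b₀ b₁ c Set.univ := by
  have hr0 := hr.ne'
  have hexp : Real.exp (2 * Real.log r) = r ^ 2 := by
    rw [mul_comm, ← Real.rpow_def_of_pos hr]; norm_cast
  have hexp' : Real.exp (Real.log r) = r := Real.exp_log hr
  -- The flow of V₂ multiplies t by e^s and y by e^{s/2}, hence the parameter 2 ln r.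
  refine H.of_symmetry (S := Set.univ) (T := fun P => r ^ 2 * P.1) (Y := fun P => r * P.2)
    (μ := fun _ => 0) (Ψ := fun P => (P.1 / r ^ 2, P.2 / r)) 1 (2 * Real.log r) isOpen_univ
    (by fun_prop) (by fun_prop) (by fun_prop) (fun _ _ => trivial)
    (fun P _ => by ext <;> simp <;> field_simp)
    (fun P _ => by ext <;> simp <;> field_simp) (fun P _ h => trivial)
    (fun P _ c => ?_) (fun Ω Ω' h _ hm hh => ?_)
  · rw [basisField_eq_genField]
    refine flowsTo_lift hσ (T := fun s => Real.exp s * P.1)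
      (Y := fun s => Real.exp (s / 2) * P.2)
      (ν := fun s => 0) (by simp) ?_ (by simp) (by simp)
      (fun s _ => ?_) (fun s _ => ?_) (fun s _ => ?_) c
    · simp only [hexp]
      rw [mul_div_cancel_left₀ _ two_ne_zero, hexp']
    · simpa using (Real.hasDerivAt_exp s).mul_const P.1
    · refine ((((hasDerivAt_id s).div_const 2).exp).mul_const P.2).congr_deriv ?_
      simp; ring
    · simpa using hasDerivAt_const s (0 : ℝ)
  · refine hh.pullback (fun P => r ^ 2 * P.1) (fun _ => r) (fun P => r * P.2)
      (fun _ => 0) (fun _ => 0) (fun _ => 0) (fun _ => 0) (fun _ => 0)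
      (fun P _ => ((HasGrad.const (r ^ 2)).mul HasGrad.fst).congr_grad (by ring) (by ring))
      (fun P _ => HasGrad.const r)
      (fun P _ => ((HasGrad.const r).mul HasGrad.snd).congr_grad (by ring) (by ring))
      (fun P _ => (HasGrad.const _).congr_grad (by ring) rfl) (fun P _ => HasGrad.const 0)
      ?_ ?_ ?_ ?_ ?_ ?_ ?_ hm <;> intro P _ <;> field_simp <;> ring

/-- Reduction by the flow of `V₃`. -/
lemma Reducible.of_projective (hσ : 0 < σ) (ε : ℝ)
    (H : Reducible σ k a₁ (a₂ - 2 * ε * a₁) (a₃ - ε * a₂ + ε ^ 2 * a₁) b₀ (b₁ - ε * b₀)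
      (c + ε * a₁ / 2) I') (hI0 : ∀ t ∈ I, 0 < 1 + ε * t)
    (hI : ∀ s, 0 < 1 - ε * s → s * (1 - ε * s)⁻¹ ∈ I → s ∈ I') :
    Reducible σ k a₁ a₂ a₃ b₀ b₁ c I := by
  have hS : ∀ t ∈ I, 1 - ε * (t * (1 + ε * t)⁻¹) = (1 + ε * t)⁻¹ := fun t ht => by
    have := (hI0 t ht).ne'
    field_simp; ring
  have d : ∀ z s : ℝ, HasDerivAt (fun s => 1 - s * z) (-z) s := fun z s => by
    simpa using ((hasDerivAt_id s).mul_const z).const_sub 1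
  -- The flow of V₃ starting at time t reaches the parameter ε without a pole exactly when 1 - εt >
  -- 0.
  refine H.of_symmetry (S := {P | 0 < 1 - ε * P.1}) (T := fun P => P.1 * (1 - ε * P.1)⁻¹)
    (Y := fun P => P.2 * (1 - ε * P.1)⁻¹)
    (μ := fun P => -(1 / 2 * Real.log (1 - ε * P.1)) + 1 / 2 * ε * (1 - ε * P.1)⁻¹ * P.2 ^ 2)
    (Ψ := fun P => (P.1 * (1 + ε * P.1)⁻¹, P.2 * (1 + ε * P.1)⁻¹)) 2 ε
    (isOpen_lt continuous_const (by fun_prop)) ?_ ?_ ?_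
    (fun P hP => ?_) (fun P hP => ?_) (fun P hP => ?_) (fun P hP h => hI _ hP h)
    (fun P hP c => ?_) (fun Ω Ω' h hΩ hm hh => ?_)
  · exact fun P hP => ContinuousAt.continuousWithinAt (by
      have : 1 - ε * P.1 ≠ 0 := (show 0 < 1 - ε * P.1 from hP).ne'
      fun_prop (disch := assumption))
  · exact fun P hP => ContinuousAt.continuousWithinAt (by
      have : 1 - ε * P.1 ≠ 0 := (show 0 < 1 - ε * P.1 from hP).ne'
      fun_prop (disch := assumption))
  · exact fun P hP => ContinuousAt.continuousWithinAt (by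
      have : 1 + ε * P.1 ≠ 0 := (hI0 _ hP).ne'
      fun_prop (disch := assumption))
  · have := hI0 _ hP
    simp only [Set.mem_ofPred_eq]
    rw [hS _ hP]
    positivity
  · have := (hI0 _ hP).ne'
    ext <;> simp only [hS _ hP, inv_inv, mul_assoc, inv_mul_cancel₀ this, mul_one]
  · have h0 : 1 - ε * P.1 ≠ 0 := (show 0 < 1 - ε * P.1 from hP).ne'
    have e : 1 + ε * (P.1 * (1 - ε * P.1)⁻¹) = (1 - ε * P.1)⁻¹ := by field_simp; ring
    ext <;> simp only [e, inv_inv, mul_assoc, inv_mul_cancel₀ h0, mul_one]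
  · rw [basisField_eq_genField]
    have hP' : 0 < 1 - ε * P.1 := hP
    -- The expression is affine in s and positive at both ends s = 0 and s = ε.
    have hpos : ∀ s ∈ Set.uIcc 0 ε, 0 < 1 - s * P.1 := fun s hs => by
      rcases Set.mem_uIcc.1 hs with ⟨h1, h2⟩ | ⟨h1, h2⟩
      · rcases le_total 0 P.1 with h3 | h3 <;> nlinarith
      · rcases le_total 0 P.1 with h3 | h3 <;> nlinarith
    refine flowsTo_lift hσ (T := fun s => P.1 * (1 - s * P.1)⁻¹)
      (Y := fun s => P.2 * (1 - s * P.1)⁻¹)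
      (ν := fun s => 1 / 2 * Real.log (1 - s * P.1) - 1 / 2 * (s * (1 - s * P.1)⁻¹) * P.2 ^ 2
        + (-(1 / 2 * Real.log (1 - ε * P.1)) + 1 / 2 * ε * (1 - ε * P.1)⁻¹ * P.2 ^ 2))
      (by simp) rfl (by simp) (by ring)
      (fun s hs => ?_) (fun s hs => ?_) (fun s hs => ?_) c
    all_goals have h0 := (hpos s hs).ne'
    · refine (((d P.1 s).inv h0).const_mul P.1).congr_deriv ?_
      simp; field_simp
    · refine (((d P.1 s).inv h0).const_mul P.2).congr_deriv ?_
      simp; field_simp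
    · refine (((((d P.1 s).log h0).const_mul (1 / 2)).sub
        ((((hasDerivAt_id s).mul ((d P.1 s).inv h0)).const_mul (1 / 2)).mul_const
          (P.2 ^ 2))).add_const _).congr_deriv ?_
      simp; field_simp; ring
  · have pos : ∀ P ∈ Ω', 1 - ε * P.1 ≠ 0 := fun P hP =>
      (show 0 < 1 - ε * P.1 from hΩ hP).ne'
    have d' : ∀ t : ℝ, HasDerivAt (fun t => 1 - ε * t) (-ε) t := fun t => by
      simpa using ((hasDerivAt_id t).const_mul ε).const_sub 1
    have gA : ∀ P ∈ Ω', HasGrad (fun P => (1 - ε * P.1)⁻¹) (ε * (1 - ε * P.1)⁻¹ ^ 2) 0 P :=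
      fun P hP => HasGrad.of_fst (φ := fun t => (1 - ε * t)⁻¹)
        (((d' P.1).inv (pos P hP)).congr_deriv (by field_simp))
    have gl : ∀ P ∈ Ω', HasGrad (fun P => Real.log (1 - ε * P.1)) (-ε * (1 - ε * P.1)⁻¹) 0 P :=
      fun P hP => HasGrad.of_fst (φ := fun t => Real.log (1 - ε * t))
        (((d' P.1).log (pos P hP)).congr_deriv (div_eq_mul_inv _ _))
    have gy : ∀ P : ℝ × ℝ, HasGrad (fun P : ℝ × ℝ => P.2 ^ 2) 0 (2 * P.2) P := fun P =>
      (HasGrad.comp (φ := fun y => y ^ 2) (hasDerivAt_pow 2 P.2) HasGrad.snd).congr_grad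
        (by ring) (by simp)
    refine hh.pullback (fun P => P.1 * (1 - ε * P.1)⁻¹) (fun P => (1 - ε * P.1)⁻¹)
      (fun P => P.2 * (1 - ε * P.1)⁻¹) _ (fun P => ε * (1 - ε * P.1)⁻¹ * P.2)
      (fun P => ε ^ 2 * (1 - ε * P.1)⁻¹ ^ 2 * P.2) (fun P => ε * (1 - ε * P.1)⁻¹)
      (fun P => ε * (1 - ε * P.1)⁻¹ ^ 2)
      (fun P hP => (HasGrad.fst.mul (gA P hP)).congr_grad ?_ (by ring)) gA
      (fun P hP => (HasGrad.snd.mul (gA P hP)).congr_grad (by ring) (by ring))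
      (fun P hP => (((HasGrad.const (1 / 2)).mul (gl P hP)).neg.add
        (((HasGrad.const (1 / 2 * ε)).mul (gA P hP)).mul (gy P))).congr_grad (by ring) (by ring))
      (fun P hP => (((HasGrad.const ε).mul (gA P hP)).mul HasGrad.snd).congr_grad
        (by ring) (by ring))
      ?_ ?_ ?_ ?_ ?_ ?_ ?_ hm
    · have := pos P hP; field_simp; ring
    all_goals
      intro P hP
      have := pos P hP
      field_simp
      try ring

/-- Reduction by the flow of `V₄`. -/
lemma Reducible.of_shift (hσ : 0 < σ) (δ : ℝ)
    (H : Reducible σ k a₁ a₂ a₃ (b₀ + a₂ / 2 * δ) (b₁ + a₃ * δ)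
      (c - b₁ * δ - a₃ * δ ^ 2 / 2) I) :
    Reducible σ k a₁ a₂ a₃ b₀ b₁ c I := by
  have hσ0 := hσ.ne'
  -- V₄ moves ln x = σy at unit speed, so a shift of y by δ takes the parameter σδ; μ offsets the
  -- factor x^{1/2} of the weight.
  refine H.of_symmetry (S := Set.univ) (T := fun P => P.1) (Y := fun P => P.2 + δ)
    (μ := fun _ => σ * δ / 2) (Ψ := fun P => (P.1, P.2 - δ)) 3 (σ * δ) isOpen_univ
    (by fun_prop) (by fun_prop) (by fun_prop) (fun _ _ => trivial) (fun P _ => by simp)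
    (fun P _ => by simp) (fun P _ h => h) (fun P _ c => ?_) (fun Ω Ω' h _ hm hh => ?_)
  · rw [basisField_eq_genField]
    refine flowsTo_lift hσ (T := fun s => P.1) (Y := fun s => P.2 + s / σ)
      (ν := fun s => -(1 / 2) * s + σ * δ / 2) (by simp) ?_ (by simp) (by ring)
      (fun s _ => ?_) (fun s _ => ?_) (fun s _ => ?_) c
    · ext
      · rfl
      · simp only; field_simp
    · simpa using hasDerivAt_const s P.1
    · simpa using ((hasDerivAt_id s).div_const σ).const_add P.2
    · refine (((hasDerivAt_id s).const_mul (-(1 / 2))).add_const _).congr_deriv ?_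
      simp
  · refine hh.pullback (fun P => P.1) (fun _ => 1) (fun P => P.2 + δ)
      (fun _ => σ * δ / 2) (fun _ => 0) (fun _ => 0) (fun _ => 0) (fun _ => 0)
      (fun P _ => HasGrad.fst.congr_grad (by ring) (by ring))
      (fun P _ => HasGrad.const 1)
      (fun P _ => (HasGrad.snd.add (HasGrad.const δ)).congr_grad (by ring) (by ring))
      (fun P _ => (HasGrad.const _).congr_grad (by ring) rfl) (fun P _ => HasGrad.const 0)
      ?_ ?_ ?_ ?_ ?_ ?_ ?_ hm <;> intro P _ <;> ring

/-- Reduction by the flow of `V₅`. -/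
lemma Reducible.of_boost (hσ : 0 < σ) (δ : ℝ)
    (H : Reducible σ k a₁ a₂ a₃ (b₀ - δ * a₁) (b₁ - δ * a₂ / 2)
      (c + δ * b₀ - δ ^ 2 * a₁ / 2) I) :
    Reducible σ k a₁ a₂ a₃ b₀ b₁ c I := by
  have hσ0 := hσ.ne'
  refine H.of_symmetry (S := Set.univ) (T := fun P => P.1) (Y := fun P => P.2 + δ * P.1)
    (μ := fun P => δ * P.2 + δ ^ 2 / 2 * P.1) (Ψ := fun P => (P.1, P.2 - δ * P.1)) 4 (σ * δ)
    isOpen_univ (by fun_prop) (by fun_prop) (by fun_prop) (fun _ _ => trivial)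
    (fun P _ => by simp)
    (fun P _ => by simp) (fun P _ h => h) (fun P _ c => ?_) (fun Ω Ω' h _ hm hh => ?_)
  · rw [basisField_eq_genField]
    refine flowsTo_lift hσ (T := fun s => P.1) (Y := fun s => P.2 + s * (P.1 / σ))
      (ν := fun s => -(P.2 / σ * s + P.1 / (2 * σ ^ 2) * s ^ 2)
        + (δ * P.2 + δ ^ 2 / 2 * P.1)) (by simp) ?_ (by simp) (by field_simp; ring)
      (fun s _ => ?_) (fun s _ => ?_) (fun s _ => ?_) c
    · ext
      · rfl
      · simp only; field_simp
    · simpa using hasDerivAt_const s P.1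
    · refine (((hasDerivAt_id s).mul_const (P.1 / σ)).const_add P.2).congr_deriv ?_
      simp; ring
    · refine ((((hasDerivAt_id s).const_mul (P.2 / σ)).add
        ((hasDerivAt_pow 2 s).const_mul (P.1 / (2 * σ ^ 2)))).neg.add_const _).congr_deriv ?_
      simp; field_simp; ring
  · refine hh.pullback (fun P => P.1) (fun _ => 1) (fun P => P.2 + δ * P.1)
      _ (fun _ => δ) (fun _ => 0) (fun _ => 0) (fun _ => 0)
      (fun P _ => HasGrad.fst.congr_grad (by ring) (by ring))
      (fun P _ => HasGrad.const 1)
      (fun P _ => (HasGrad.snd.add ((HasGrad.const δ).mul HasGrad.fst)).congr_grad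
        (by ring) (by ring))
      (fun P _ => (((HasGrad.const δ).mul HasGrad.snd).add
        ((HasGrad.const (δ ^ 2 / 2)).mul HasGrad.fst)).congr_grad (by ring) (by ring))
      (fun P _ => HasGrad.const δ)
      ?_ ?_ ?_ ?_ ?_ ?_ ?_ hm <;> intro P _ <;> ring

/-- Reduction by `t ↦ -1/t`, a composition of three flows, for `t` of constant sign `ε`. -/
lemma Reducible.of_inversion (hσ : 0 < σ) {ε : ℝ} (hε : ε ^ 2 = 1)
    (H : Reducible σ k a₃ (-a₂) a₁ (ε * b₁) (-(ε * b₀)) (c + a₂ / 2) {s | ε * s < 0}) :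
    Reducible σ k a₁ a₂ a₃ b₀ b₁ c {t | 0 < ε * t} := by
  -- The Weyl element of SL₂ is a product of three unipotents: s + ε, then t/(1 - εt), then adding ε
  -- again gives -1/s for ε = ±1. The middle map requires 1 - ε(s + ε) = -εs > 0, which fixes the
  -- sign of s.
  refine Reducible.of_translation hσ ε (I' := {s | 0 < 1 + ε * s}) ?_ fun s hs => ?_
  · refine Reducible.of_projective hσ ε (I' := {s | 0 < 1 - ε * s}) ?_ (fun t ht => ht)
      fun s hs _ => hs
    refine Reducible.of_translation hσ ε (I' := {s | ε * s < 0}) ?_ fun s hs => ?_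
    · have h1 : (ε - 1) * (ε + 1) = 0 := by linear_combination hε
      rcases mul_eq_zero.1 h1 with h | h
      · obtain rfl : ε = 1 := by linarith
        convert H using 1 <;> ring
      · obtain rfl : ε = -1 := by linarith
        convert H using 1 <;> ring
    · simp only [Set.mem_ofPred_eq] at hs ⊢
      nlinarith
  · simp only [Set.mem_ofPred_eq] at hs ⊢
    nlinarith

end

/-! ### Normal forms -/

section
variable {σ k a₁ a₂ a₃ b₀ b₁ c : ℝ} {I : Set ℝ}

lemma IsReachable.of_eq {D Ω : Set (ℝ × ℝ)} {v : ℝ → ℝ → ℝ} {h : ℝ × ℝ → ℝ}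
    (hv : OptimalSolution σ k D v) (hD : ∀ P ∈ Ω, (P.1, Real.exp (σ * P.2)) ∈ D)
    (he : ∀ P ∈ Ω, v P.1 (Real.exp (σ * P.2)) = weight σ k P.1 (Real.exp (σ * P.2)) * h P) :
    IsReachable σ k Ω h := by
  refine ⟨D, v, [], hv, fun P hP => ⟨_, _, hD P hP, ?_⟩⟩
  show _ = _
  rw [lift, he P hP]

lemma Reducible.of_isSimilarity {Q : ℝ → ℝ} {U : Set (ℝ × ℝ)}
    {z μ A μt μy μyt μyy : ℝ × ℝ → ℝ} {f₁ f₁' f₂ f₂' : ℝ → ℝ} {v : ℝ → ℝ → ℝ → ℝ → ℝ}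
    {D : Set (ℝ × ℝ)} (hσ : 0 < σ)
    (S : IsSimilarity a₁ a₂ a₃ b₀ b₁ c Q U z μ A μt μy μyt μyy)
    (hf : IsFundamental Q f₁ f₁' f₂ f₂') (hU : ∀ P : ℝ × ℝ, P.1 ∈ I → P ∈ U)
    (hD : ∀ P : ℝ × ℝ, P.1 ∈ I → (P.1, Real.exp (σ * P.2)) ∈ D)
    (hO : ∀ c₁ c₂, OptimalSolution σ k D (v c₁ c₂))
    (hv : ∀ c₁ c₂ t x, t ∈ I → 0 < x → v c₁ c₂ t x = weight σ k t x *
      (Real.exp (μ (t, Real.log x / σ)) * (c₁ * f₁ (z (t, Real.log x / σ))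
        + c₂ * f₂ (z (t, Real.log x / σ))))) :
    Reducible σ k a₁ a₂ a₃ b₀ b₁ c I := by
  intro Ω h ho hc hΩ hh
  obtain ⟨c₁, c₂, he⟩ := hh.eq_fundamental ho hc S (fun P hP => hU P (hΩ P hP)) hf
  refine .of_eq (hO c₁ c₂) (fun P hP => hD P (hΩ P hP)) fun P hP => ?_
  rw [hv c₁ c₂ _ _ (hΩ P hP) (Real.exp_pos _), he P hP, Real.log_exp,
    mul_div_cancel_left₀ _ hσ.ne']

lemma reducible_V2 (hσ : 0 < σ) (c : ℝ) : Reducible σ k 0 1 0 0 0 c {t | 0 < t} := by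
  obtain ⟨f₁', f₂', hf⟩ := exists_isFundamental_pcUV (2 * c + 1 / 2)
  exact .of_isSimilarity (D := {p | 0 < p.1 ∧ 0 < p.2}) hσ (isSimilarity_scaling c) hf
    (fun P hP => hP)
    (fun P hP => ⟨hP, Real.exp_pos _⟩) (fun c₁ c₂ => .v2 c c₁ c₂)
    fun c₁ c₂ t x ht hx => solV2_eq k hσ ht hx c c₁ c₂

lemma reducible_V1V3 (hσ : 0 < σ) (c : ℝ) : Reducible σ k 1 0 1 0 0 c Set.univ := by
  obtain ⟨a, rfl⟩ : ∃ a, c = (σ ^ 2 + 8 * a) / 8 := ⟨c - σ ^ 2 / 8, by ring⟩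
  obtain ⟨f₁', f₂', hf⟩ := exists_isFundamental_pcW ((σ ^ 2 + 8 * a) / 8)
  exact .of_isSimilarity hσ (isSimilarity_projective _) hf (fun P _ => trivial)
    (fun P _ => Real.exp_pos _) (fun c₁ c₂ => .v1v3 a c₁ c₂)
    fun c₁ c₂ t x _ hx => solV1V3_eq k hσ hx a c₁ c₂

lemma reducible_V1 (hσ : 0 < σ) (c : ℝ) : Reducible σ k 1 0 0 0 0 c Set.univ := by
  obtain ⟨a, rfl⟩ : ∃ a, c = (σ ^ 2 + 8 * a) / 8 := ⟨c - σ ^ 2 / 8, by ring⟩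
  obtain ⟨f₁, f₁', f₂, f₂', hf, hv⟩ := exists_isFundamental_solV1 k hσ a
  exact .of_isSimilarity hσ (isSimilarity_translation _) hf (fun P _ => trivial)
    (fun P _ => Real.exp_pos _) (fun c₁ c₂ => .v1 a c₁ c₂)
    fun c₁ c₂ t x _ hx => hv c₁ c₂ t x hx

lemma reducible_V1addV5 (hσ : 0 < σ) :
    Reducible σ k 1 0 0 0 (1 / σ) (σ ^ 2 / 8) Set.univ := by
  obtain ⟨f₁', f₂', hf⟩ := exists_isFundamental_airy
  exact .of_isSimilarity hσ (isSimilarity_galilei (β := 1 / σ) hσ (by field_simp)) hf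
    (fun P _ => trivial) (fun P _ => Real.exp_pos _) (fun c₁ c₂ => .v1addv5 c₁ c₂)
    fun c₁ c₂ t x _ hx => solV1addV5_eq k hσ hx c₁ c₂

lemma reducible_V1subV5 (hσ : 0 < σ) :
    Reducible σ k 1 0 0 0 (-1 / σ) (σ ^ 2 / 8) Set.univ := by
  obtain ⟨f₁', f₂', hf⟩ := exists_isFundamental_airy
  exact .of_isSimilarity hσ (isSimilarity_galilei (β := -1 / σ) hσ (by field_simp)) hf
    (fun P _ => trivial) (fun P _ => Real.exp_pos _) (fun c₁ c₂ => .v1subv5 c₁ c₂)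
    fun c₁ c₂ t x _ hx => solV1subV5_eq k hσ hx c₁ c₂

lemma reducible_V4 (hσ : 0 < σ) :
    Reducible σ k 0 0 0 (1 / σ) 0 (-(1 / 2)) Set.univ := by
  intro Ω h ho hc _ hh
  obtain ⟨C, hC⟩ := hh.eq_exp (by positivity) ho hc
  refine .of_eq (.v4 C) (fun P _ => Real.exp_pos _) fun P hP => ?_
  rw [solV4_eq k hσ, hC P hP, Real.log_exp, mul_div_cancel_left₀ _ hσ.ne']
  congr 3
  field_simp
  ring

/-- Generators with constant `τ ≠ 0`. -/
lemma reducible_of_const (hσ : 0 < σ) (ha : a₁ ≠ 0) (b₀ b₁ c : ℝ) :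
    Reducible σ k a₁ 0 0 b₀ b₁ c Set.univ := by
  have airy : ∀ β c : ℝ, β ≠ 0 → Reducible σ k 1 0 0 0 β (σ ^ 2 / 8) Set.univ →
      Reducible σ k 1 0 0 0 β c Set.univ := fun β c hβ H => by
    -- A shift by δ replaces c by c - βδ, so for β ≠ 0 the constant can be prescribed.
    refine Reducible.of_shift hσ ((c - σ ^ 2 / 8) / β) ?_
    convert H using 1
    · ring
    · ring
    · field_simp; ring
  have key : ∀ b₁ c : ℝ, Reducible σ k 1 0 0 0 b₁ c Set.univ := fun b₁ c => by
    rcases eq_or_ne b₁ 0 with rfl | hb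
    · exact reducible_V1 hσ c
    have hx : 0 < 1 / (σ * |b₁|) := by have := abs_pos.2 hb; positivity
    -- Dilation by r and rescaling by r² keep a₁ = 1 and turn b₁ into r³b₁, which is to be ±1/σ.
    set r := (1 / (σ * |b₁|)) ^ (1 / 3 : ℝ) with hr
    have hr0 : 0 < r := by positivity
    have hr3 : r ^ 3 = 1 / (σ * |b₁|) := by
      rw [hr, ← Real.rpow_natCast, ← Real.rpow_mul hx.le]; norm_num
    refine Reducible.of_dilation hσ hr0 (Reducible.of_smul (r ^ 2) ?_)
    rcases lt_or_gt_of_ne hb with hneg | hpos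
    · convert airy (-1 / σ) (r ^ 2 * c) (by simp [hσ.ne']) (reducible_V1subV5 hσ) using 1
      · field_simp
      · ring
      · ring
      · ring
      · rw [abs_of_neg hneg] at hr3
        calc r ^ 2 * (r * b₁) = r ^ 3 * b₁ := by ring
          _ = _ := by rw [hr3]; field_simp
    · convert airy (1 / σ) (r ^ 2 * c) (by simp [hσ.ne']) (reducible_V1addV5 hσ) using 1
      · field_simp
      · ring
      · ring
      · ring
      · rw [abs_of_pos hpos] at hr3
        calc r ^ 2 * (r * b₁) = r ^ 3 * b₁ := by ring
          _ = _ := by rw [hr3]; field_simp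
  refine Reducible.of_smul a₁⁻¹ (Reducible.of_boost hσ (a₁⁻¹ * b₀) ?_)
  convert key (a₁⁻¹ * b₁) (a₁⁻¹ * c + (a₁⁻¹ * b₀) ^ 2 / 2) using 1
  · field_simp
  · ring
  · ring
  · field_simp; ring
  · ring
  · field_simp; ring

/-- Generators with `τ` a multiple of `t`. -/
lemma reducible_of_linear (hσ : 0 < σ) (ha : a₂ ≠ 0) (b₀ b₁ c : ℝ) :
    Reducible σ k 0 a₂ 0 b₀ b₁ c {t | 0 < t} ∧ Reducible σ k 0 a₂ 0 b₀ b₁ c {t | t < 0} := by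
  have key : ∀ a₂ b₀ b₁ c : ℝ, a₂ ≠ 0 → Reducible σ k 0 a₂ 0 b₀ b₁ c {t | 0 < t} := by
    intro a₂ b₀ b₁ c ha
    -- Once a₂ = 1, the shift by -2b₀ removes b₀ and the boost by 2b₁ removes b₁.
    refine Reducible.of_smul a₂⁻¹ (Reducible.of_shift hσ (-(2 * (a₂⁻¹ * b₀)))
      (Reducible.of_boost hσ (2 * (a₂⁻¹ * b₁)) ?_))
    convert reducible_V2 hσ (a₂⁻¹ * c + 2 * (a₂⁻¹ * b₀) * (a₂⁻¹ * b₁)) using 1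
    all_goals field_simp
    all_goals ring
  refine ⟨key a₂ b₀ b₁ c ha, ?_⟩
  -- Negative times are carried to positive ones by t ↦ -1/t, which only changes the sign of a₂.
  have H := Reducible.of_inversion (k := k) (a₁ := 0) (a₂ := a₂) (a₃ := 0) (b₀ := b₀) (b₁ := b₁)
    (c := c) hσ (ε := -1) (by norm_num)
    ((key (-a₂) _ _ _ (neg_ne_zero.2 ha)).mono fun s hs => by simpa using hs)
  exact H.mono fun t ht => by simpa using ht

/-- Generators with `τ` a multiple of `t²`. -/
lemma reducible_of_square (hσ : 0 < σ) (ha : a₃ ≠ 0) (b₀ b₁ c : ℝ) :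
    Reducible σ k 0 0 a₃ b₀ b₁ c {t | 0 < t} ∧ Reducible σ k 0 0 a₃ b₀ b₁ c {t | t < 0} := by
  -- The inversion exchanges a₁ and a₃: the double zero at 0 goes to infinity and τ becomes
  -- constant.
  have H := fun ε hε => Reducible.of_inversion (k := k) (a₁ := 0) (a₂ := 0) (a₃ := a₃) (b₀ := b₀)
    (b₁ := b₁) (c := c) hσ (ε := ε) hε
    (by simpa using (reducible_of_const hσ ha _ _ _).mono (Set.subset_univ _))
  exact ⟨(H 1 (by norm_num)).mono fun t ht => by simpa using ht,
    (H (-1) (by norm_num)).mono fun t ht => by simpa using ht⟩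

/-- Generators with definite `τ`. -/
lemma reducible_of_definite (hσ : 0 < σ) (hd : a₂ ^ 2 < 4 * a₁ * a₃) (b₀ b₁ c : ℝ) :
    Reducible σ k a₁ a₂ a₃ b₀ b₁ c Set.univ := by
  have ha : a₃ ≠ 0 := by rintro rfl; nlinarith [sq_nonneg a₂]
  have key : ∀ b₀ b₁ c : ℝ, Reducible σ k 1 0 1 b₀ b₁ c Set.univ := fun b₀ b₁ c => by
    refine Reducible.of_shift hσ (-b₁) (Reducible.of_boost hσ b₀ ?_)
    convert reducible_V1V3 hσ (c + b₁ ^ 2 / 2 + b₀ ^ 2 / 2) using 1 <;> ring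
  have hd' : 0 < a₁ / a₃ - (a₂ / (2 * a₃)) ^ 2 := by
    have : a₁ / a₃ - (a₂ / (2 * a₃)) ^ 2 = (4 * a₁ * a₃ - a₂ ^ 2) / (2 * a₃) ^ 2 := by
      field_simp
      ring
    rw [this]
    have : 0 < 4 * a₁ * a₃ - a₂ ^ 2 := by linarith
    positivity
  -- After translation to the vertex and division by a₃, τ = t² + r⁴; dilation by r gives r²(1 +
  -- t²).
  obtain ⟨r, hr, hr4⟩ : ∃ r : ℝ, 0 < r ∧ r ^ 4 = a₁ / a₃ - (a₂ / (2 * a₃)) ^ 2 := by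
    refine ⟨√√(a₁ / a₃ - (a₂ / (2 * a₃)) ^ 2), Real.sqrt_pos.2 (Real.sqrt_pos.2 hd'), ?_⟩
    rw [show 4 = 2 * 2 by norm_num, pow_mul, Real.sq_sqrt (Real.sqrt_nonneg _),
      Real.sq_sqrt hd'.le]
  refine Reducible.of_smul a₃⁻¹ (Reducible.of_translation hσ (I' := Set.univ)
    (-(a₂ / (2 * a₃))) (Reducible.of_dilation hσ hr (Reducible.of_smul (r ^ 2)⁻¹ ?_))
    fun _ _ => trivial)
  convert key _ _ _ using 1
  · have : a₃⁻¹ * a₁ + a₃⁻¹ * a₂ * -(a₂ / (2 * a₃)) + a₃⁻¹ * a₃ * (-(a₂ / (2 * a₃))) ^ 2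
        = a₁ / a₃ - (a₂ / (2 * a₃)) ^ 2 := by field_simp; ring
    rw [this, ← hr4]
    field_simp
  · field_simp; ring
  · field_simp

/-- Generators with `τ` having the simple root `0`, on an interval ending at this root and not
containing another one. -/
lemma reducible_of_root (hσ : 0 < σ) (ha : a₂ ≠ 0) (b₀ b₁ c : ℝ)
    (hI : ∀ t ∈ I, 0 < 1 + a₃ / a₂ * t) (hI0 : (∀ t ∈ I, 0 < t) ∨ (∀ t ∈ I, t < 0)) :
    Reducible σ k 0 a₂ a₃ b₀ b₁ c I := by
  have aux : ∀ s, 0 < 1 - a₃ / a₂ * s → s = s * (1 - a₃ / a₂ * s)⁻¹ * (1 - a₃ / a₂ * s) :=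
    fun s hs => by rw [mul_assoc, inv_mul_cancel₀ hs.ne', mul_one]
  rcases hI0 with hI0 | hI0
  -- With a₁ = 0 this parameter makes the new a₃ vanish, sending the other zero -a₂/a₃ to infinity;
  -- `hI` says that I lies on the same side of it as 0.
  · refine Reducible.of_projective hσ (a₃ / a₂) (I' := {t | 0 < t}) ?_ hI fun s hs h => ?_
    · convert (reducible_of_linear hσ ha _ _ _).1 using 1
      · ring
      · field_simp; ring
    · rw [Set.mem_ofPred_eq, aux s hs]
      exact mul_pos (hI0 _ h) hs
  · refine Reducible.of_projective hσ (a₃ / a₂) (I' := {t | t < 0}) ?_ hI fun s hs h => ?_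
    · convert (reducible_of_linear hσ ha _ _ _).2 using 1
      · ring
      · field_simp; ring
    · rw [Set.mem_ofPred_eq, aux s hs]
      exact mul_neg_of_neg_of_pos (hI0 _ h) hs

/-- Generators with `τ = 0` and `ξ ≠ 0`. -/
lemma reducible_of_vertical (hσ : 0 < σ) (c : ℝ) (hI : ∀ t ∈ I, b₀ + b₁ * t ≠ 0)
    (hI0 : ∀ r, (∀ t ∈ I, t ≠ r) → (∀ t ∈ I, r < t) ∨ (∀ t ∈ I, t < r)) (hne : I.Nonempty) :
    Reducible σ k 0 0 0 b₀ b₁ c I := by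
  have key : ∀ b₀ c : ℝ, b₀ ≠ 0 → Reducible σ k 0 0 0 b₀ 0 c Set.univ := fun b₀ c hb => by
    -- Rescaling makes b₀ = 1/σ; a boost by δ then adds δ/σ to c, and δ is chosen to reach c = -1/2,
    -- the value for V₄.
    refine Reducible.of_smul (σ * b₀)⁻¹ (Reducible.of_boost hσ
      (-(σ / 2) - c / b₀) ?_)
    convert reducible_V4 hσ using 1
    all_goals field_simp
    all_goals ring
  rcases eq_or_ne b₁ 0 with rfl | hb
  · obtain ⟨t, ht⟩ := hne
    exact (key b₀ c (by simpa using hI t ht)).mono (Set.subset_univ _)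
  have H := fun ε hε => Reducible.of_inversion (k := k) (a₁ := 0) (a₂ := 0) (a₃ := 0) (b₀ := 0)
    (b₁ := b₁) (c := c) hσ (ε := ε) hε (by
      have : ε ≠ 0 := by rintro rfl; norm_num at hε
      simpa using (key (ε * b₁) c (mul_ne_zero this hb)).mono (Set.subset_univ _))
  -- Translation moves the zero of ξ to t = 0; the inversion in `H` then turns b₁t into a constant.
  have e : ∀ I', Reducible σ k 0 0 0 0 b₁ c I' → (∀ s, s + -(b₀ / b₁) ∈ I → s ∈ I') →
      Reducible σ k 0 0 0 b₀ b₁ c I := fun I' h hI' => by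
    refine Reducible.of_translation hσ (-(b₀ / b₁)) (I' := I') ?_ hI'
    convert h using 1
    · ring
    · ring
    · field_simp; ring
    · ring
  rcases hI0 (-(b₀ / b₁)) (fun t ht h => hI t ht (by rw [h]; field_simp; ring)) with h | h
  · refine e _ (H 1 (by norm_num)) fun s hs => ?_
    have := h _ hs
    rw [Set.mem_ofPred_eq]; linarith
  · refine e _ (H (-1) (by norm_num)) fun s hs => ?_
    have := h _ hs
    rw [Set.mem_ofPred_eq]; linarith

/-- Generators with `τ ≠ 0`. -/
lemma reducible_of_ne_zero (hσ : 0 < σ) (b₀ b₁ c : ℝ)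
    (hI : ∀ t ∈ I, a₁ + a₂ * t + a₃ * t ^ 2 ≠ 0)
    (hI0 : ∀ r, (∀ t ∈ I, t ≠ r) → (∀ t ∈ I, r < t) ∨ (∀ t ∈ I, t < r)) (hne : I.Nonempty) :
    Reducible σ k a₁ a₂ a₃ b₀ b₁ c I := by
  -- A simple zero r with slope A = τ'(r) is moved to 0.
  have root : ∀ A r, A ≠ 0 → a₁ + a₂ * r + a₃ * r ^ 2 = 0 → a₂ + 2 * a₃ * r = A →
      (∀ t ∈ I, 0 < 1 + a₃ / A * (t - r)) → Reducible σ k a₁ a₂ a₃ b₀ b₁ c I := by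
    intro A r hA h1 h2 h3
    refine Reducible.of_translation hσ r (I' := {s | s + r ∈ I}) ?_ fun s hs => hs
    rw [h1, h2]
    refine reducible_of_root hσ hA _ _ _ (fun s hs => by simpa using h3 _ hs) ?_
    rcases hI0 r (fun t ht h => hI t ht (by rw [h, h1])) with h | h
    · exact Or.inl fun s hs => by linarith [h _ hs]
    · exact Or.inr fun s hs => by linarith [h _ hs]
  rcases eq_or_ne a₃ 0 with rfl | h3
  · rcases eq_or_ne a₂ 0 with rfl | h2
    · obtain ⟨t, ht⟩ := hne
      exact (reducible_of_const hσ (by simpa using hI t ht) _ _ _).mono (Set.subset_univ _)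
    · exact root a₂ (-(a₁ / a₂)) h2 (by field_simp; ring) (by ring) (by simp)
  rcases lt_trichotomy (a₂ ^ 2) (4 * a₁ * a₃) with hd | hd | hd
  · exact (reducible_of_definite hσ hd _ _ _).mono (Set.subset_univ _)
  · have e1 : a₁ + a₂ * -(a₂ / (2 * a₃)) + a₃ * (-(a₂ / (2 * a₃))) ^ 2 = 0 := by
      field_simp; linarith
    have e2 : a₂ + 2 * a₃ * -(a₂ / (2 * a₃)) = 0 := by field_simp; ring
    rcases hI0 _ (fun t ht h => hI t ht (by rw [h, e1])) with h | h
    · refine Reducible.of_translation hσ (-(a₂ / (2 * a₃))) (I' := {t | 0 < t}) ?_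
        fun s hs => by rw [Set.mem_ofPred_eq]; linarith [h _ hs]
      rw [e1, e2]
      exact (reducible_of_square hσ h3 _ _ _).1
    · refine Reducible.of_translation hσ (-(a₂ / (2 * a₃))) (I' := {t | t < 0}) ?_
        fun s hs => by rw [Set.mem_ofPred_eq]; linarith [h _ hs]
      rw [e1, e2]
      exact (reducible_of_square hσ h3 _ _ _).2
  · obtain ⟨m, d, hd0, e2, e1⟩ : ∃ m d : ℝ, 0 < d ∧ a₂ = -2 * a₃ * m ∧
        a₁ = a₃ * (m ^ 2 - d ^ 2) := by
      refine ⟨-(a₂ / (2 * a₃)), √(a₂ ^ 2 - 4 * a₁ * a₃) / |2 * a₃|, ?_, ?_, ?_⟩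
      · have := Real.sqrt_pos.2 (sub_pos.2 hd)
        positivity
      · field_simp
      · rw [div_pow, Real.sq_sqrt (sub_nonneg.2 hd.le), sq_abs]
        field_simp; ring
    have r1 : a₁ + a₂ * (m - d) + a₃ * (m - d) ^ 2 = 0 := by rw [e1, e2]; ring
    have r2 : a₁ + a₂ * (m + d) + a₃ * (m + d) ^ 2 = 0 := by rw [e1, e2]; ring
    have c1 := root (-2 * a₃ * d) (m - d) (by simp [h3, hd0.ne']) r1 (by rw [e2]; ring)
    have c2 := root (2 * a₃ * d) (m + d) (by simp [h3, hd0.ne']) r2 (by rw [e2]; ring)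
    have f1 : ∀ t, 1 + a₃ / (-2 * a₃ * d) * (t - (m - d)) = (m + d - t) / (2 * d) := fun t => by
      field_simp; ring
    have f2 : ∀ t, 1 + a₃ / (2 * a₃ * d) * (t - (m + d)) = (t - (m - d)) / (2 * d) := fun t => by
      field_simp; ring
    -- Above m + d the zero m + d is moved to 0; below m + d it is m - d. In either case I lies on
    -- the right side of the zero that goes to infinity.
    rcases hI0 (m + d) (fun t ht h => hI t ht (by rw [h, r2])) with h | h
    · refine c2 fun t ht => ?_
      rw [f2]
      have := h t ht
      exact div_pos (by linarith) (by linarith)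
    · refine c1 fun t ht => ?_
      rw [f1]
      have := h t ht
      exact div_pos (by linarith) (by linarith)

end

/-! ### Assembly of the classification -/

lemma lt_or_gt_of_isConnected {Ω : Set (ℝ × ℝ)} (hc : IsConnected Ω) (r : ℝ)
    (h : ∀ t ∈ Prod.fst '' Ω, t ≠ r) :
    (∀ t ∈ Prod.fst '' Ω, r < t) ∨ (∀ t ∈ Prod.fst '' Ω, t < r) := by
  have hp := (hc.isPreconnected.image Prod.fst continuousOn_fst).ordConnected
  by_contra! hcon
  obtain ⟨⟨t, ht, h1⟩, s, hs, h2⟩ := hcon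
  exact h r (hp.out ht hs ⟨h1, h2⟩) rfl

lemma exists_genField {σ k : ℝ} {X : VField} (hX : X ∈ symAlgebra σ k) :
    ∃ a₁ a₂ a₃ a₄ a₅ a₆, X = genField σ k a₁ a₂ a₃ a₄ a₅ a₆ := by
  obtain ⟨a, rfl⟩ := (Submodule.mem_span_range_iff_exists_fun ℝ).1 hX
  exact ⟨a 0, a 1, a 2, a 3, a 4, a 5, by simp [Fin.sum_univ_six, basisField, genField]⟩

/-- A quadratic polynomial in `t` vanishing on a non-empty open set of the plane is zero. -/
lemma coeff_eq_zero_of_isOpen {Ω : Set (ℝ × ℝ)} (ho : IsOpen Ω) (hne : Ω.Nonempty)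
    {a b c : ℝ} (h : ∀ P ∈ Ω, a + b * P.1 + c * P.1 ^ 2 = 0) : a = 0 ∧ b = 0 ∧ c = 0 := by
  obtain ⟨⟨t, x⟩, hP⟩ := hne
  have h1 : ∀ᶠ s in nhds t, (s, x) ∈ Ω :=
    (continuous_id.prodMk continuous_const).continuousAt.preimage_mem_nhds (ho.mem_nhds hP)
  obtain ⟨δ, hδ, hB⟩ := Metric.eventually_nhds_iff.1 h1
  -- The values at t and t ± δ/2: their second difference isolates c, then their first difference
  -- isolates b.
  have e0 := h _ hP
  have e1 := h _ (hB (y := t + δ / 2) (by rw [Real.dist_eq]; rw [add_sub_cancel_left, abs_of_pos (by linarith)]; linarith))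
  have e2 := h _ (hB (y := t - δ / 2) (by
    rw [Real.dist_eq, sub_sub_cancel_left, abs_neg, abs_of_pos (by linarith)]; linarith))
  simp only at e0 e1 e2
  have hc : c = 0 := by
    have : δ ^ 2 * c = 0 := by linear_combination 2 * e1 + 2 * e2 - 4 * e0
    simpa [hδ.ne'] using this
  subst hc
  have hb : b = 0 := by
    have : δ * b = 0 := by linear_combination e1 - e2
    simpa [hδ.ne'] using this
  subst hb
  exact ⟨by simpa using e0, rfl, rfl⟩

lemma IsReachable.isTransformOn {σ k : ℝ} {Ω : Set (ℝ × ℝ)} {u : ℝ → ℝ → ℝ} (hσ : 0 < σ)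
    (hΩ : Ω ⊆ halfPlane) (H : IsReachable σ k (heatDomain σ Ω) (heatFun σ k u)) :
    ∃ (D : Set (ℝ × ℝ)) (v : ℝ → ℝ → ℝ) (g : List (Fin 6 × ℝ)),
      OptimalSolution σ k D v ∧ IsTransformOn σ k g D v Ω u := by
  obtain ⟨D, v, g, hv, hg⟩ := H
  refine ⟨D, v, g, hv, fun t x hx => ?_⟩
  obtain ⟨t₀, x₀, h1, h2⟩ := hg _ ((mem_heatDomain hσ (hΩ hx)).2 hx)
  refine ⟨t₀, x₀, h1, ?_⟩
  have e : lift σ k (t, Real.log x / σ) (heatFun σ k u (t, Real.log x / σ)) = (t, x, u t x) := by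
    simp only [lift]
    rw [mul_div_cancel₀ _ hσ.ne', Real.exp_log (hΩ hx), weight_mul_heatFun hσ u (hΩ hx)]
  rwa [e] at h2

/-- Every solution invariant under an element of the symmetry algebra is a transform of an
explicit solution. -/
lemma exists_isTransformOn {σ k : ℝ} (hσ : 0 < σ) {X : VField} (hX : X ∈ symAlgebra σ k)
    (hX0 : X ≠ 0) {Ω : Set (ℝ × ℝ)} {u : ℝ → ℝ → ℝ} (ho : IsOpen Ω) (hc : IsConnected Ω)
    (hΩ : Ω ⊆ halfPlane) (hreg : IsRegularOn X Ω) (hu : IsInvariantSolution σ k X Ω u) :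
    ∃ (D : Set (ℝ × ℝ)) (v : ℝ → ℝ → ℝ) (g : List (Fin 6 × ℝ)),
      OptimalSolution σ k D v ∧ IsTransformOn σ k g D v Ω u := by
  obtain ⟨a₁, a₂, a₃, a₄, a₅, a₆, rfl⟩ := exists_genField hX
  have hh := hu.heatInv hσ ho hΩ
  have hO := isOpen_heatDomain (σ := σ) ho
  have hC := isConnected_heatDomain hσ hc hΩ
  have hI0 := lt_or_gt_of_isConnected hC
  have hne : (Prod.fst '' heatDomain σ Ω).Nonempty := hC.nonempty.image _
  have hmem : ∀ P ∈ heatDomain σ Ω, P.1 ∈ Prod.fst '' heatDomain σ Ω :=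
    fun P hP => ⟨P, hP, rfl⟩
  simp only [IsRegularOn, genField_apply] at hreg
  rcases hreg with hτ | ⟨hτ, hξ⟩
  · refine IsReachable.isTransformOn hσ hΩ (reducible_of_ne_zero hσ _ _ _ ?_ hI0 hne
      _ _ hO hC hmem hh)
    rintro _ ⟨P, hP, rfl⟩
    exact hτ P.1 _ 0 hP
  · obtain ⟨rfl, rfl, rfl⟩ := coeff_eq_zero_of_isOpen ho hc.nonempty
      (fun P hP => hτ P.1 P.2 0 hP)
    simp only [zero_div, zero_mul, add_zero, zero_add] at hξ hh
    rcases hξ with hξ | hξ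
    · refine IsReachable.isTransformOn hσ hΩ (reducible_of_vertical hσ _ ?_ hI0 hne
        _ _ hO hC hmem hh)
      rintro _ ⟨P, hP, rfl⟩ h0
      refine hξ P.1 _ 0 hP ?_
      have : a₄ + a₅ * P.1 = 0 := by field_simp at h0; linarith
      rw [this, zero_mul]
    · have h45 : ∀ P ∈ Ω, a₄ + a₅ * P.1 + 0 * P.1 ^ 2 = 0 := fun P hP => by
        have := hξ P.1 P.2 0 hP
        have hx : P.2 ≠ 0 := (hΩ hP : 0 < P.2).ne'
        simpa [hx] using this
      obtain ⟨rfl, rfl, -⟩ := coeff_eq_zero_of_isOpen ho hc.nonempty h45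
      have h6 : a₆ ≠ 0 := by rintro rfl; exact hX0 (by simp [genField])
      -- Only a₆ ≠ 0 is left, so invariance forces u = 0, the V₄ solution with c = 0 under the empty
      -- composition.
      refine ⟨halfPlane, solV4 σ k 0, [], .v4 0, fun t x hx => ⟨t, x, hΩ hx, ?_⟩⟩
      have h := hu.2 t x hx
      simp only [genField_apply] at h
      have hu0 : u t x = 0 := by simpa [h6] using h
      show _ = _
      rw [hu0, solV4, zero_mul]

end GMR

end

theorem theorem4p1 (σ k : ℝ) (hσ : 0 < σ) (hk : 0 < k) :
    -- the explicit families are exactly the invariant solutions for the listed generators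
    (∀ (Ω : Set (ℝ × ℝ)) (u : ℝ → ℝ → ℝ),
      IsOpen Ω → IsConnected Ω → Ω ⊆ GMR.halfPlane →
        (GMR.IsInvariantSolution σ k (GMR.V4 σ k) Ω u ↔
          ∃ c : ℝ, GMR.AgreesOn Ω u (GMR.solV4 σ k c)) ∧
        (∀ a : ℝ, Ω ⊆ {p | 0 < p.1} →
          (GMR.IsInvariantSolution σ k (GMR.V2 σ k + a • GMR.V6) Ω u ↔
            ∃ c₁ c₂ : ℝ, GMR.AgreesOn Ω u (GMR.solV2 σ k a c₁ c₂))) ∧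
        (∀ a : ℝ,
          (GMR.IsInvariantSolution σ k (GMR.V1 + GMR.V3 σ k + a • GMR.V6) Ω u ↔
            ∃ c₁ c₂ : ℝ, GMR.AgreesOn Ω u (GMR.solV1V3 σ k a c₁ c₂))) ∧
        (GMR.IsInvariantSolution σ k (GMR.V1 + GMR.V5 σ k) Ω u ↔
          ∃ c₁ c₂ : ℝ, GMR.AgreesOn Ω u (GMR.solV1addV5 σ k c₁ c₂)) ∧
        (GMR.IsInvariantSolution σ k (GMR.V1 - GMR.V5 σ k) Ω u ↔
          ∃ c₁ c₂ : ℝ, GMR.AgreesOn Ω u (GMR.solV1subV5 σ k c₁ c₂)) ∧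
        (∀ a : ℝ,
          (GMR.IsInvariantSolution σ k (GMR.V1 + a • GMR.V6) Ω u ↔
            ∃ c₁ c₂ : ℝ, GMR.AgreesOn Ω u (GMR.solV1 σ k a c₁ c₂))) ∧
        (GMR.IsInvariantSolution σ k GMR.V6 Ω u ↔ GMR.AgreesOn Ω u 0)) ∧
    -- every invariant solution is a transform of one on the list
    (∀ X ∈ GMR.symAlgebra σ k, X ≠ 0 →
      ∀ (Ω : Set (ℝ × ℝ)) (u : ℝ → ℝ → ℝ),
        IsOpen Ω → IsConnected Ω → Ω ⊆ GMR.halfPlane → GMR.IsRegularOn X Ω →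
        GMR.IsInvariantSolution σ k X Ω u →
          ∃ (D : Set (ℝ × ℝ)) (v : ℝ → ℝ → ℝ) (g : List (Fin 6 × ℝ)),
            GMR.OptimalSolution σ k D v ∧ GMR.IsTransformOn σ k g D v Ω u) := by

  refine ⟨fun Ω u ho hc hΩ => ⟨GMR.isInvariantSolution_V4_iff hσ ho hc hΩ,
    fun a ht => GMR.isInvariantSolution_V2_iff hσ ho hc hΩ a ht,
    fun a => GMR.isInvariantSolution_V1V3_iff hσ ho hc hΩ a,
    GMR.isInvariantSolution_V1addV5_iff hσ ho hc hΩ,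
    GMR.isInvariantSolution_V1subV5_iff hσ ho hc hΩ,
    fun a => GMR.isInvariantSolution_V1_iff hσ ho hc hΩ a,
    GMR.isInvariantSolution_V6_iff ho⟩,
    fun X hX hX0 Ω u ho hc hΩ hreg hu =>
      GMR.exists_isTransformOn hσ hX hX0 ho hc hΩ hreg hu⟩
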